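/- Let $m\ge 1$, let $\sigma_m=2\pi^{m/2}/\Gamma(m/2)$, and let $e_1,\dots,e_m$ be the generators of the (complexified) Clifford algebra $\mathbb{R}_{0,m}$, $e_je_k+e_ke_j=-2\delta_{jk}$; write $\underline{x}=\sum_j e_jx_j$, $r=|\underline x|$, $\underline\omega=\underline x/r$, $\underline\partial=\sum_j e_j\partial_{x_j}$. For $\lambda\in\mathbb{C}$ let $T_\lambda=\mathrm{Fp}\,r^\lambda$ and $U_\lambda=\mathrm{Fp}\,r^\lambda\underline\omega$ be the tempered distributions on $\mathbb{R}^m$ $$\langle T_\lambda,\varphi\rangle=\mathrm{Fp}\!\int_0^\infty r^{\lambda+m-1}\Big(\int_{S^{m-1}}\varphi(r\underline\omega)\,dS(\underline\omega)\Big)dr,\qquad \langle U_\lambda,\varphi\rangle=\mathrm{Fp}\!\int_0^\infty r^{\lambda+m-1}\Big(\int_{S^{m-1}}\underline\omega\,\varphi(r\underline\omega)\,dS(\underline\omega)\Big)dr,$$ where $\mathrm{Fp}$ is Hadamard's finite part. Let $T^*_\lambda=\pi^{\frac{\lambda+m}{2}}T_\lambda/\Gamma(\frac{\lambda+m}{2})$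 for $\lambda\notin\{-m-2l: l=0,1,\dots\}$ and $T^*_{-m-2l}=\frac{\pi^{m/2-l}}{2^{2l}\Gamma(m/2+l)}(-\Delta_m)^l\delta$; let $U^*_\lambda=\pi^{\frac{\lambda+m+1}{2}}U_\lambda/\Gamma(\frac{\lambda+m+1}{2})$ for $\lambda\notin\{-m-2l-1: l=0,1,\dots\}$ and $U^*_{-m-2l-1}=-\frac{\pi^{m/2-l}}{2^{2l+1}\Gamma(m/2+l+1)}\underline\partial^{2l+1}\delta$. Put $$H=-\frac{2}{\sigma_{m+1}}U^*_{-m},\qquad K_\beta=(-\Delta_m)^{-\beta}\delta=2^{-2\beta}\frac{\Gamma(\frac{m-2\beta}{2})}{\pi^{\frac{m+2\beta}{2}}}\,T^*_{-m+2\beta},\qquad L_\beta=(-\Delta_m)^{-\beta}H=-2^{-2\beta}\frac{\Gamma(\frac{m-2\beta+1}{2})}{\pi^{\frac{m+2\beta+1}{2}}}\,U^*_{-m+2\beta}.$$ The Hilbert transform of a scalar tempered distribution $S$ is the convolution $\mathcal H[S]=H*S$, understood in the finite part sense: it is the Clifford-valued tempered distribution $W$ such that, for every Schwartz function $\varphi$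 and every $\chi\in C_c^\infty(\mathbb{R}^m)$ equal to $1$ near $0$, each component of $\langle W,\varphi\rangle$ is the Hadamard finite part, as $R\to\infty$, of the same component of $\langle H*(\chi(\cdot/R)S),\varphi\rangle$, that is, the limit after removal of finitely many terms $c\,R^{z}$ with $\operatorname{Re}z\ge 0$, $z\ne0$. **Proposition.** For every $\beta\in\mathbb{C}\setminus\{\frac{m+n}{2}: n=0,1,2,\dots\}$ one has $\mathcal H[K_\beta]=L_\beta$ (that is, $K_\beta$ and $L_\beta$ form a Hilbert pair). If moreover $\operatorname{Re}\beta<\frac m2$, no terms have to be removed: for all $\varphi$ and $\chi$ as above, $\langle H*(\chi(\cdot/R)K_\beta),\varphi\rangle$ converges componentwise to $\langle L_\beta,\varphi\rangle$ as $R\to\infty$. -/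

import Mathlib

noncomputable section

namespace CliffordDist

open MeasureTheory Set Filter Topology
open scoped SchwartzMap
open Laplacian LineDeriv

/-- Euclidean space `ℝ^m`. -/
abbrev Eu (m : ℕ) : Type := EuclideanSpace ℝ (Fin m)

/-- The unit sphere `S^{m-1}` of `ℝ^m`. -/
abbrev USphere (m : ℕ) : Set (Eu m) := Metric.sphere (0 : Eu m) 1

/-- The area `σ_m = 2 π^{m/2} / Γ(m/2)` of the unit sphere of `ℝ^m`. -/
def sphereArea (m : ℕ) : ℝ := 2 * Real.pi ^ ((m : ℝ) / 2) / Real.Gamma ((m : ℝ) / 2)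

/-- The weighted spherical mean
`r ↦ σ_m⁻¹ ∫_{S^{m-1}} w(ω) φ(r ω) dS(ω)`. -/
def sphericalMean {m : ℕ} (w : C(USphere m, ℝ)) (φ : Eu m → ℂ) (r : ℝ) : ℂ :=
  ((sphereArea m)⁻¹ : ℝ) *
    ∫ ω : USphere m, (w ω : ℂ) * φ (r • (ω : Eu m)) ∂(volume : Measure (Eu m)).toSphere

/-- The number of Taylor coefficients at `0` that are subtracted in `Fp ∫_0^∞ r^μ ψ(r) dr`. -/
def fpOrder (μ : ℂ) : ℕ := ⌊-μ.re⌋₊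

/-- The Taylor polynomial of `ψ` at `0` with `N` terms. -/
def taylorPoly (N : ℕ) (ψ : ℝ → ℂ) (r : ℝ) : ℂ :=
  ∑ k ∈ Finset.range N, (r : ℂ) ^ k * (iteratedDeriv k ψ 0 / (k.factorial : ℂ))

/-- Hadamard's finite part `Fp ∫_0^∞ r^μ ψ(r) dr` of a function `ψ` that is smooth on `[0, ∞)`,
including at `0`, and rapidly decreasing at infinity, that is, the finite part as `ε → 0+` of
`∫_ε^∞ r^μ ψ(r) dr`.  Near `0` the first Taylor terms of `ψ` are subtracted, and the finite part of
`∫_ε^1 r^(μ+k) dr`, which is `1/(μ+k+1)`, is put back.  If `μ = -k-1`, that integral is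
`-log ε`, its finite part is `0`, and so is Lean's `1/(μ+k+1)`. -/
def finitePart (μ : ℂ) (ψ : ℝ → ℂ) : ℂ :=
  (∫ r in Ioc (0 : ℝ) 1, (r : ℂ) ^ μ * (ψ r - taylorPoly (fpOrder μ) ψ r)) +
    (∑ k ∈ Finset.range (fpOrder μ),
      iteratedDeriv k ψ 0 / (k.factorial : ℂ) / (μ + k + 1)) +
    ∫ r in Ioi (1 : ℝ), (r : ℂ) ^ μ * ψ r

/-- An integral formula for the `k`-th derivative of the spherical mean. -/
def sphericalMeanDeriv {m : ℕ} (w : C(USphere m, ℝ)) (φ : 𝓢(Eu m, ℂ)) (k : ℕ) (r : ℝ) : ℂ :=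
  ((sphereArea m)⁻¹ : ℝ) *
    ∫ ω : USphere m, (w ω : ℂ) * iteratedFDeriv ℝ k φ (r • (ω : Eu m)) (fun _ => (ω : Eu m))
      ∂(volume : Measure (Eu m)).toSphere

variable {m : ℕ}

lemma continuous_integrand (w : C(USphere m, ℝ)) (φ : 𝓢(Eu m, ℂ)) (k : ℕ) :
    Continuous (fun p : ℝ × USphere m =>
      (w p.2 : ℂ) * iteratedFDeriv ℝ k φ (p.1 • (p.2 : Eu m)) (fun _ => (p.2 : Eu m))) := by
  have h1 : Continuous (iteratedFDeriv ℝ k φ) :=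
    (φ.smooth k).continuous_iteratedFDeriv (by exact_mod_cast le_rfl)
  refine (Complex.continuous_ofReal.comp (w.continuous.comp continuous_snd)).mul ?_
  have h2 : Continuous (fun p : ℝ × USphere m =>
      (iteratedFDeriv ℝ k φ (p.1 • (p.2 : Eu m)), (fun _ : Fin k => (p.2 : Eu m)))) := by
    fun_prop
  exact (ContinuousEval.continuous_eval).comp h2

lemma norm_integrand_le (w : C(USphere m, ℝ)) (φ : 𝓢(Eu m, ℂ)) (k : ℕ) (r : ℝ)
    (ω : USphere m) :
    ‖(w ω : ℂ) * iteratedFDeriv ℝ k φ (r • (ω : Eu m)) (fun _ => (ω : Eu m))‖ ≤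
      ‖w‖ * SchwartzMap.seminorm ℂ 0 k φ := by
  rw [norm_mul]
  have hω : ‖(ω : Eu m)‖ = 1 := by simp
  have h1 : ‖(w ω : ℂ)‖ ≤ ‖w‖ := by simpa using w.norm_coe_le_norm ω
  have h2 : ‖iteratedFDeriv ℝ k φ (r • (ω : Eu m)) (fun _ => (ω : Eu m))‖ ≤
      SchwartzMap.seminorm ℂ 0 k φ := by
    refine (ContinuousMultilinearMap.le_opNorm _ _).trans ?_
    simpa [hω] using SchwartzMap.norm_iteratedFDeriv_le_seminorm ℂ φ k (r • (ω : Eu m))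
  exact mul_le_mul h1 h2 (norm_nonneg _) (norm_nonneg _)

lemma integrable_integrand (w : C(USphere m, ℝ)) (φ : 𝓢(Eu m, ℂ)) (k : ℕ) (r : ℝ) :
    Integrable (fun ω : USphere m => (w ω : ℂ) *
      iteratedFDeriv ℝ k φ (r • (ω : Eu m)) (fun _ => (ω : Eu m)))
      (volume : Measure (Eu m)).toSphere := by
  refine Integrable.of_bound (C := ‖w‖ * SchwartzMap.seminorm ℂ 0 k φ) ?_
    (Filter.Eventually.of_forall (norm_integrand_le w φ k r))
  exact ((continuous_integrand w φ k).comp (Continuous.prodMk_right r)).aestronglyMeasurable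

/-- A bound for the total mass of the weight. -/
def massBound (w : C(USphere m, ℝ)) : ℝ :=
  |(sphereArea m)⁻¹| * (‖w‖ * (volume : Measure (Eu m)).toSphere.real univ)

lemma massBound_nonneg (w : C(USphere m, ℝ)) : 0 ≤ massBound w := by
  unfold massBound; positivity

lemma norm_sphericalMeanDeriv_le (w : C(USphere m, ℝ)) (φ : 𝓢(Eu m, ℂ)) (k : ℕ) (r : ℝ) :
    ‖sphericalMeanDeriv w φ k r‖ ≤ massBound w * SchwartzMap.seminorm ℂ 0 k φ := by
  unfold sphericalMeanDeriv massBound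
  rw [norm_mul, Complex.norm_real, Real.norm_eq_abs, mul_assoc]
  refine mul_le_mul_of_nonneg_left ?_ (abs_nonneg _)
  refine (norm_integral_le_of_norm_le_const
    (Filter.Eventually.of_forall (norm_integrand_le w φ k r))).trans (le_of_eq ?_)
  ring

lemma sphericalMeanDeriv_zero (w : C(USphere m, ℝ)) (φ : 𝓢(Eu m, ℂ)) :
    sphericalMeanDeriv w φ 0 = sphericalMean w φ := by
  ext r
  simp [sphericalMeanDeriv, sphericalMean]

lemma hasDerivAt_sphericalMeanDeriv (w : C(USphere m, ℝ)) (φ : 𝓢(Eu m, ℂ)) (k : ℕ) (r : ℝ) :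
    HasDerivAt (sphericalMeanDeriv w φ k) (sphericalMeanDeriv w φ (k + 1) r) r := by
  unfold sphericalMeanDeriv
  refine HasDerivAt.const_mul _ ?_
  refine (hasDerivAt_integral_of_dominated_loc_of_deriv_le (s := univ)
    (bound := fun _ => ‖w‖ * SchwartzMap.seminorm ℂ 0 (k + 1) φ)
    (F := fun r (ω : USphere m) => (w ω : ℂ) *
      iteratedFDeriv ℝ k φ (r • (ω : Eu m)) (fun _ => (ω : Eu m)))
    (F' := fun r (ω : USphere m) => (w ω : ℂ) *
      iteratedFDeriv ℝ (k + 1) φ (r • (ω : Eu m)) (fun _ => (ω : Eu m)))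
    Filter.univ_mem ?_ (integrable_integrand w φ k r)
    (integrable_integrand w φ (k + 1) r).aestronglyMeasurable ?_ (integrable_const _) ?_).2
  · exact Filter.Eventually.of_forall fun x => (integrable_integrand w φ k x).aestronglyMeasurable
  · exact Filter.Eventually.of_forall fun ω x _ => norm_integrand_le w φ (k + 1) x ω
  · refine Filter.Eventually.of_forall fun ω x _ => HasDerivAt.const_mul _ ?_
    have h1 : HasFDerivAt (iteratedFDeriv ℝ k φ)
        (fderiv ℝ (iteratedFDeriv ℝ k φ) (x • (ω : Eu m))) (x • (ω : Eu m)) := by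
      refine DifferentiableAt.hasFDerivAt ?_
      exact ((φ.smooth ⊤).differentiable_iteratedFDeriv
        (by exact_mod_cast WithTop.coe_lt_top k)) _
    have h2 : HasDerivAt (fun x : ℝ => x • (ω : Eu m)) (ω : Eu m) x := by
      simpa using (hasDerivAt_id x).smul_const (ω : Eu m)
    have h3 := h1.comp_hasDerivAt x h2
    have h4 := (ContinuousMultilinearMap.apply ℝ (fun _ : Fin k => Eu m) ℂ
      (fun _ => (ω : Eu m))).hasFDerivAt.comp_hasDerivAt x h3
    rw [iteratedFDeriv_succ_apply_left]
    exact h4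

lemma iteratedDeriv_sphericalMean (w : C(USphere m, ℝ)) (φ : 𝓢(Eu m, ℂ)) (k : ℕ) :
    iteratedDeriv k (sphericalMean w φ) = sphericalMeanDeriv w φ k := by
  induction k with
  | zero => simp [sphericalMeanDeriv_zero]
  | succ k ih =>
    rw [iteratedDeriv_succ, ih]
    ext r
    exact (hasDerivAt_sphericalMeanDeriv w φ k r).deriv

lemma contDiff_sphericalMean (w : C(USphere m, ℝ)) (φ : 𝓢(Eu m, ℂ)) (n : ℕ) :
    ContDiff ℝ n (sphericalMean w φ) := by
  refine contDiff_of_differentiable_iteratedDeriv fun k _ => ?_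
  rw [iteratedDeriv_sphericalMean]
  exact fun r => (hasDerivAt_sphericalMeanDeriv w φ k r).differentiableAt

lemma sphericalMean_add (w : C(USphere m, ℝ)) (φ χ : 𝓢(Eu m, ℂ)) :
    sphericalMean w (φ + χ : 𝓢(Eu m, ℂ)) = sphericalMean w φ + sphericalMean w χ := by
  ext r
  have h1 := integrable_integrand w φ 0 r
  have h2 := integrable_integrand w χ 0 r
  simp only [iteratedFDeriv_zero_apply] at h1 h2
  simp only [sphericalMean, add_apply, Pi.add_apply, mul_add]
  rw [integral_add h1 h2, mul_add]

lemma sphericalMean_smul (w : C(USphere m, ℝ)) (c : ℂ) (φ : 𝓢(Eu m, ℂ)) :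
    sphericalMean w (c • φ : 𝓢(Eu m, ℂ)) = c • sphericalMean w φ := by
  ext r
  have h : ∀ ω : USphere m, (w ω : ℂ) * (c • φ : 𝓢(Eu m, ℂ)) (r • (ω : Eu m)) =
      c * ((w ω : ℂ) * φ (r • (ω : Eu m))) := fun ω => by
    simp only [smul_apply, smul_eq_mul]
    ring
  simp only [sphericalMean, Pi.smul_apply, smul_eq_mul, h, integral_const_mul]
  ring

lemma norm_sphericalMean_le (w : C(USphere m, ℝ)) (φ : 𝓢(Eu m, ℂ)) (K : ℕ) {r : ℝ}
    (hr : 0 < r) :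
    ‖sphericalMean w φ r‖ ≤ massBound w * SchwartzMap.seminorm ℂ K 0 φ * r ^ (-(K : ℝ)) := by
  have hb : ∀ ω : USphere m, ‖(w ω : ℂ) * φ (r • (ω : Eu m))‖ ≤
      ‖w‖ * (SchwartzMap.seminorm ℂ K 0 φ * r ^ (-(K : ℝ))) := by
    intro ω
    have hω : ‖(ω : Eu m)‖ = 1 := by simp
    have h1 : ‖(w ω : ℂ)‖ ≤ ‖w‖ := by simpa using w.norm_coe_le_norm ω
    have h2 := SchwartzMap.norm_pow_mul_le_seminorm ℂ φ K (r • (ω : Eu m))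
    rw [norm_smul, hω, mul_one, Real.norm_of_nonneg hr.le] at h2
    rw [norm_mul]
    refine mul_le_mul h1 ?_ (norm_nonneg _) (norm_nonneg _)
    rw [Real.rpow_neg hr.le, Real.rpow_natCast, ← div_eq_mul_inv, le_div_iff₀ (by positivity)]
    linarith
  unfold sphericalMean massBound
  rw [norm_mul, Complex.norm_real, Real.norm_eq_abs]
  calc _ ≤ |(sphereArea m)⁻¹| * (‖w‖ * (SchwartzMap.seminorm ℂ K 0 φ * r ^ (-(K : ℝ))) *
        (volume : Measure (Eu m)).toSphere.real univ) :=
        mul_le_mul_of_nonneg_left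
          (norm_integral_le_of_norm_le_const (Filter.Eventually.of_forall hb)) (abs_nonneg _)
    _ = _ := by ring

lemma norm_sub_taylorPoly_le (w : C(USphere m, ℝ)) (φ : 𝓢(Eu m, ℂ)) (N : ℕ) {r : ℝ}
    (hr : r ∈ Ioc (0 : ℝ) 1) :
    ‖sphericalMean w φ r - taylorPoly N (sphericalMean w φ) r‖ ≤
      massBound w * SchwartzMap.seminorm ℂ 0 N φ * r ^ N := by
  rcases N with _ | n
  · simpa [taylorPoly, sphericalMeanDeriv_zero] using norm_sphericalMeanDeriv_le w φ 0 r
  · have hd : ∀ k, ∀ y ∈ Icc (0 : ℝ) 1, iteratedDerivWithin k (sphericalMean w φ) (Icc 0 1) y =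
        sphericalMeanDeriv w φ k y := by
      intro k y hy
      rw [iteratedDerivWithin_eq_iteratedDeriv (uniqueDiffOn_Icc zero_lt_one)
        (contDiff_sphericalMean w φ k).contDiffAt hy, iteratedDeriv_sphericalMean]
    have h := taylor_mean_remainder_bound (f := sphericalMean w φ) (a := 0) (b := 1) (x := r)
      (n := n) (C := massBound w * SchwartzMap.seminorm ℂ 0 (n + 1) φ) zero_le_one
      (by exact_mod_cast (contDiff_sphericalMean w φ (n + 1)).contDiffOn) ⟨hr.1.le, hr.2⟩
      (fun y hy => by rw [hd _ y hy]; exact norm_sphericalMeanDeriv_le w φ (n + 1) y)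
    have he : taylorWithinEval (sphericalMean w φ) n (Icc 0 1) 0 r =
        taylorPoly (n + 1) (sphericalMean w φ) r := by
      rw [taylor_within_apply, taylorPoly]
      refine Finset.sum_congr rfl fun k _ => ?_
      rw [hd k 0 (by simp), iteratedDeriv_sphericalMean, Complex.real_smul]
      push_cast
      ring
    rw [he, sub_zero] at h
    refine h.trans (div_le_self ?_ (by exact_mod_cast Nat.succ_le_of_lt n.factorial_pos))
    have := massBound_nonneg w
    have := hr.1
    positivity

lemma taylorPoly_add (N : ℕ) (w : C(USphere m, ℝ)) (φ χ : 𝓢(Eu m, ℂ)) (r : ℝ) :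
    taylorPoly N (sphericalMean w φ + sphericalMean w χ) r =
      taylorPoly N (sphericalMean w φ) r + taylorPoly N (sphericalMean w χ) r := by
  simp only [taylorPoly, ← Finset.sum_add_distrib]
  refine Finset.sum_congr rfl fun k _ => ?_
  rw [iteratedDeriv_add (contDiff_sphericalMean w φ k).contDiffAt
    (contDiff_sphericalMean w χ k).contDiffAt]
  ring

lemma taylorPoly_smul (N : ℕ) (w : C(USphere m, ℝ)) (c : ℂ) (φ : 𝓢(Eu m, ℂ)) (r : ℝ) :
    taylorPoly N (c • sphericalMean w φ) r = c * taylorPoly N (sphericalMean w φ) r := by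
  simp only [taylorPoly, Finset.mul_sum]
  refine Finset.sum_congr rfl fun k _ => ?_
  rw [iteratedDeriv_const_smul_field]
  simp only [smul_eq_mul]
  ring

lemma fpOrder_spec (μ : ℂ) : -1 < μ.re + fpOrder μ := by
  have := Nat.lt_floor_add_one (-μ.re)
  unfold fpOrder
  linarith

/-- A decay exponent that makes `r^μ r^{-K}` integrable at infinity. -/
def fpDecay (μ : ℂ) : ℕ := ⌈μ.re⌉₊ + 2

lemma fpDecay_spec (μ : ℂ) : μ.re - fpDecay μ < -1 := by
  have := Nat.le_ceil μ.re
  unfold fpDecay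
  push_cast
  linarith

lemma norm_inner_le (w : C(USphere m, ℝ)) (φ : 𝓢(Eu m, ℂ)) (μ : ℂ) {r : ℝ}
    (hr : r ∈ Ioc (0 : ℝ) 1) :
    ‖(r : ℂ) ^ μ * (sphericalMean w φ r - taylorPoly (fpOrder μ) (sphericalMean w φ) r)‖ ≤
      massBound w * SchwartzMap.seminorm ℂ 0 (fpOrder μ) φ * r ^ (μ.re + fpOrder μ) := by
  rw [norm_mul, Complex.norm_cpow_eq_rpow_re_of_pos hr.1, Real.rpow_add_natCast hr.1.ne']
  have h := mul_le_mul_of_nonneg_left (norm_sub_taylorPoly_le w φ (fpOrder μ) hr)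
    (Real.rpow_nonneg hr.1.le μ.re)
  linarith

lemma norm_outer_le (w : C(USphere m, ℝ)) (φ : 𝓢(Eu m, ℂ)) (μ : ℂ) {r : ℝ} (hr : 0 < r) :
    ‖(r : ℂ) ^ μ * sphericalMean w φ r‖ ≤
      massBound w * SchwartzMap.seminorm ℂ (fpDecay μ) 0 φ * r ^ (μ.re - fpDecay μ) := by
  rw [norm_mul, Complex.norm_cpow_eq_rpow_re_of_pos hr, sub_eq_add_neg, Real.rpow_add hr]
  have h := mul_le_mul_of_nonneg_left (norm_sphericalMean_le w φ (fpDecay μ) hr)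
    (Real.rpow_nonneg hr.le μ.re)
  linarith

lemma integrableOn_rpow_Ioc {s : ℝ} (hs : -1 < s) :
    IntegrableOn (fun r : ℝ => r ^ s) (Ioc 0 1) := by
  have := intervalIntegral.intervalIntegrable_rpow' (a := 0) (b := 1) hs
  rwa [intervalIntegrable_iff_integrableOn_Ioc_of_le zero_le_one] at this

lemma integrableOn_inner (w : C(USphere m, ℝ)) (φ : 𝓢(Eu m, ℂ)) (μ : ℂ) :
    IntegrableOn (fun r : ℝ => (r : ℂ) ^ μ *
      (sphericalMean w φ r - taylorPoly (fpOrder μ) (sphericalMean w φ) r)) (Ioc 0 1) := by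
  refine Integrable.mono' ((integrableOn_rpow_Ioc (fpOrder_spec μ)).const_mul
    (massBound w * SchwartzMap.seminorm ℂ 0 (fpOrder μ) φ)) ?_ ?_
  · refine ContinuousOn.aestronglyMeasurable (fun r hr => ?_) measurableSet_Ioc
    have h1 := Complex.continuousAt_ofReal_cpow_const r μ (Or.inr hr.1.ne')
    have h2 : Continuous (sphericalMean w φ) := (contDiff_sphericalMean w φ 0).continuous
    have h3 : Continuous (taylorPoly (fpOrder μ) (sphericalMean w φ)) := by
      unfold taylorPoly; fun_prop
    exact (h1.mul (h2.sub h3).continuousAt).continuousWithinAt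
  · exact (ae_restrict_iff' measurableSet_Ioc).2
      (Filter.Eventually.of_forall fun r hr => norm_inner_le w φ μ hr)

lemma integrableOn_outer (w : C(USphere m, ℝ)) (φ : 𝓢(Eu m, ℂ)) (μ : ℂ) :
    IntegrableOn (fun r : ℝ => (r : ℂ) ^ μ * sphericalMean w φ r) (Ioi 1) := by
  refine Integrable.mono' ((integrableOn_Ioi_rpow_of_lt (fpDecay_spec μ) zero_lt_one).const_mul
    (massBound w * SchwartzMap.seminorm ℂ (fpDecay μ) 0 φ)) ?_ ?_
  · refine ContinuousOn.aestronglyMeasurable (fun r hr => ?_) measurableSet_Ioi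
    have h1 := Complex.continuousAt_ofReal_cpow_const r μ
      (Or.inr (zero_lt_one.trans (mem_Ioi.1 hr)).ne')
    have h2 : Continuous (sphericalMean w φ) := (contDiff_sphericalMean w φ 0).continuous
    exact (h1.mul h2.continuousAt).continuousWithinAt
  · exact (ae_restrict_iff' measurableSet_Ioi).2
      (Filter.Eventually.of_forall fun r hr =>
        norm_outer_le w φ μ (zero_lt_one.trans (mem_Ioi.1 hr)))

lemma finitePart_add (w : C(USphere m, ℝ)) (φ χ : 𝓢(Eu m, ℂ)) (μ : ℂ) :
    finitePart μ (sphericalMean w (φ + χ : 𝓢(Eu m, ℂ))) =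
      finitePart μ (sphericalMean w φ) + finitePart μ (sphericalMean w χ) := by
  rw [sphericalMean_add]
  have h1 : (∫ r in Ioc (0 : ℝ) 1, (r : ℂ) ^ μ * ((sphericalMean w φ + sphericalMean w χ) r -
      taylorPoly (fpOrder μ) (sphericalMean w φ + sphericalMean w χ) r)) =
      (∫ r in Ioc (0 : ℝ) 1, (r : ℂ) ^ μ * (sphericalMean w φ r -
        taylorPoly (fpOrder μ) (sphericalMean w φ) r)) +
      ∫ r in Ioc (0 : ℝ) 1, (r : ℂ) ^ μ * (sphericalMean w χ r -
        taylorPoly (fpOrder μ) (sphericalMean w χ) r) := by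
    rw [← integral_add (integrableOn_inner w φ μ) (integrableOn_inner w χ μ)]
    congr 1
    ext r
    rw [taylorPoly_add, Pi.add_apply]
    ring
  have h2 : (∫ r in Ioi (1 : ℝ), (r : ℂ) ^ μ * (sphericalMean w φ + sphericalMean w χ) r) =
      (∫ r in Ioi (1 : ℝ), (r : ℂ) ^ μ * sphericalMean w φ r) +
      ∫ r in Ioi (1 : ℝ), (r : ℂ) ^ μ * sphericalMean w χ r := by
    rw [← integral_add (integrableOn_outer w φ μ) (integrableOn_outer w χ μ)]
    congr 1
    ext r
    rw [Pi.add_apply]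
    ring
  have h3 : ∀ k, iteratedDeriv k (sphericalMean w φ + sphericalMean w χ) 0 =
      iteratedDeriv k (sphericalMean w φ) 0 + iteratedDeriv k (sphericalMean w χ) 0 := fun k =>
    iteratedDeriv_add (contDiff_sphericalMean w φ k).contDiffAt
      (contDiff_sphericalMean w χ k).contDiffAt
  unfold finitePart
  rw [h1, h2]
  simp only [h3, add_div, Finset.sum_add_distrib]
  ring

lemma finitePart_smul (w : C(USphere m, ℝ)) (c : ℂ) (φ : 𝓢(Eu m, ℂ)) (μ : ℂ) :
    finitePart μ (sphericalMean w (c • φ : 𝓢(Eu m, ℂ))) =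
      c * finitePart μ (sphericalMean w φ) := by
  rw [sphericalMean_smul]
  unfold finitePart
  rw [mul_add, mul_add, Finset.mul_sum, ← integral_const_mul, ← integral_const_mul]
  congr 1
  · congr 1
    · congr 1
      ext r
      rw [taylorPoly_smul, Pi.smul_apply, smul_eq_mul]
      ring
    · refine Finset.sum_congr rfl fun k _ => ?_
      rw [iteratedDeriv_const_smul_field]
      simp only [smul_eq_mul]
      ring
  · congr 1
    ext r
    rw [Pi.smul_apply, smul_eq_mul]
    ring

lemma exists_finitePart_bound (w : C(USphere m, ℝ)) (μ : ℂ) :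
    ∃ (s : Finset (ℕ × ℕ)) (C : ℝ), 0 ≤ C ∧ ∀ φ : 𝓢(Eu m, ℂ),
      ‖finitePart μ (sphericalMean w φ)‖ ≤ C * s.sup (schwartzSeminormFamily ℂ (Eu m) ℂ) φ := by
  have hM := massBound_nonneg w
  set I : ℝ := ∫ r in Ioc (0 : ℝ) 1, r ^ (μ.re + fpOrder μ) with hI
  set J : ℝ := ∫ r in Ioi (1 : ℝ), r ^ (μ.re - fpDecay μ) with hJ
  have hI0 : 0 ≤ I := setIntegral_nonneg measurableSet_Ioc fun r hr => Real.rpow_nonneg hr.1.le _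
  have hJ0 : 0 ≤ J := setIntegral_nonneg measurableSet_Ioi fun r hr =>
    Real.rpow_nonneg (zero_le_one.trans (mem_Ioi.1 hr).le) _
  set D : ℝ := ∑ k ∈ Finset.range (fpOrder μ), ‖(k.factorial : ℂ)‖⁻¹ * ‖μ + k + 1‖⁻¹ with hD
  have hD0 : 0 ≤ D := Finset.sum_nonneg fun k _ => by positivity
  refine ⟨Finset.range (fpDecay μ + 1) ×ˢ Finset.range (fpOrder μ + 1),
    massBound w * (I + D + J), by positivity, fun φ => ?_⟩
  set P : ℝ := (Finset.range (fpDecay μ + 1) ×ˢ Finset.range (fpOrder μ + 1)).sup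
    (schwartzSeminormFamily ℂ (Eu m) ℂ) φ with hP
  have hle : ∀ a b : ℕ, a ≤ fpDecay μ → b ≤ fpOrder μ → SchwartzMap.seminorm ℂ a b φ ≤ P := by
    intro a b ha hb
    have : schwartzSeminormFamily ℂ (Eu m) ℂ (a, b) ≤
        (Finset.range (fpDecay μ + 1) ×ˢ Finset.range (fpOrder μ + 1)).sup
          (schwartzSeminormFamily ℂ (Eu m) ℂ) :=
      Finset.le_sup (by simp; omega)
    exact this φ
  have h1 : ‖∫ r in Ioc (0 : ℝ) 1, (r : ℂ) ^ μ * (sphericalMean w φ r -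
      taylorPoly (fpOrder μ) (sphericalMean w φ) r)‖ ≤ massBound w * P * I := by
    rw [hI, ← integral_const_mul]
    refine norm_integral_le_of_norm_le
      ((integrableOn_rpow_Ioc (fpOrder_spec μ)).const_mul _)
      ((ae_restrict_iff' measurableSet_Ioc).2 (Filter.Eventually.of_forall fun r hr => ?_))
    refine (norm_inner_le w φ μ hr).trans ?_
    have := Real.rpow_nonneg hr.1.le (μ.re + fpOrder μ)
    gcongr
    exact hle _ _ (Nat.zero_le _) le_rfl
  have h2 : ‖∫ r in Ioi (1 : ℝ), (r : ℂ) ^ μ * sphericalMean w φ r‖ ≤ massBound w * P * J := by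
    rw [hJ, ← integral_const_mul]
    refine norm_integral_le_of_norm_le
      ((integrableOn_Ioi_rpow_of_lt (fpDecay_spec μ) zero_lt_one).const_mul _)
      ((ae_restrict_iff' measurableSet_Ioi).2 (Filter.Eventually.of_forall fun r hr => ?_))
    have hr0 : 0 < r := zero_lt_one.trans (mem_Ioi.1 hr)
    refine (norm_outer_le w φ μ hr0).trans ?_
    have := Real.rpow_nonneg hr0.le (μ.re - fpDecay μ)
    gcongr
    exact hle _ _ le_rfl (Nat.zero_le _)
  have h3 : ‖∑ k ∈ Finset.range (fpOrder μ), iteratedDeriv k (sphericalMean w φ) 0 /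
      (k.factorial : ℂ) / (μ + k + 1)‖ ≤ massBound w * P * D := by
    rw [hD, Finset.mul_sum]
    refine norm_sum_le_of_le _ fun k hk => ?_
    rw [iteratedDeriv_sphericalMean, norm_div, norm_div, div_eq_mul_inv, div_eq_mul_inv, mul_assoc]
    refine mul_le_mul_of_nonneg_right ((norm_sphericalMeanDeriv_le w φ k 0).trans ?_)
      (by positivity)
    exact mul_le_mul_of_nonneg_left
      (hle _ _ (Nat.zero_le _) (Finset.mem_range.1 hk).le) hM
  calc ‖finitePart μ (sphericalMean w φ)‖ ≤ massBound w * P * I + massBound w * P * D +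
        massBound w * P * J := (norm_add₃_le).trans (add_le_add (add_le_add h1 h3) h2)
    _ = _ := by ring

/-- The tempered distribution `φ ↦ ⟨Fp r_+^(lam+m-1), Σ_w[φ]⟩`, where `Σ_w[φ]` is the spherical
mean of `φ` with weight `w`. -/
def fpRadial (w : C(USphere m, ℝ)) (lam : ℂ) : 𝓢'(Eu m, ℂ) :=
  ContinuousLinearMap.toPointwiseConvergenceCLM _ _ _ _ <|
    (SchwartzMap.mkCLMtoNormedSpace (𝕜 := ℂ) (σ := RingHom.id ℂ)
      (fun φ : 𝓢(Eu m, ℂ) => finitePart (lam + m - 1) (sphericalMean w φ))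
      (fun φ χ => finitePart_add w φ χ _) (fun c φ => finitePart_smul w c φ _)
      (exists_finitePart_bound w _) : 𝓢(Eu m, ℂ) →L[ℂ] ℂ)

lemma fpRadial_apply (w : C(USphere m, ℝ)) (lam : ℂ) (φ : 𝓢(Eu m, ℂ)) :
    fpRadial w lam φ = finitePart (lam + m - 1) (sphericalMean w φ) := rfl

/-! ### The Clifford algebra and Clifford-valued distributions -/

/-- The quadratic form `z ↦ -(z_1² + ... + z_m²)` on `ℂ^m`. -/
def cliffordForm (m : ℕ) : QuadraticForm ℂ (Fin m → ℂ) :=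
  QuadraticMap.weightedSumSquares ℂ (fun _ : Fin m => (-1 : ℂ))

/-- The complexification of the real Clifford algebra `ℝ_{0,m}`: generators `e_1, ..., e_m` with
`e_i e_j + e_j e_i = -2 δ_ij`. -/
abbrev Cl (m : ℕ) : Type := CliffordAlgebra (cliffordForm m)

/-- The generator `e_j`. -/
def e (m : ℕ) (j : Fin m) : Cl m := CliffordAlgebra.ι (cliffordForm m) (Pi.single j 1)

lemma e_mul_self (m : ℕ) (j : Fin m) : e m j * e m j = -1 := by
  have h : cliffordForm m (Pi.single j 1) = -1 := by
    simp [cliffordForm, QuadraticMap.weightedSumSquares_apply, Pi.single_apply]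
  rw [e, CliffordAlgebra.ι_sq_scalar, h, map_neg, map_one]

/-- The usual vector space topology of the finite-dimensional complex vector space `Cl m`. -/
instance instTopologicalSpaceCl (m : ℕ) : TopologicalSpace (Cl m) := moduleTopology ℂ (Cl m)

instance instIsModuleTopologyCl (m : ℕ) : IsModuleTopology ℂ (Cl m) := ⟨rfl⟩

instance instIsTopologicalAddGroupCl (m : ℕ) : IsTopologicalAddGroup (Cl m) :=
  IsModuleTopology.topologicalAddGroup ℂ (Cl m)

/-- Left multiplication `a ↦ e_j a` as a continuous linear map. -/
def leftMulE (m : ℕ) (j : Fin m) : Cl m →L[ℂ] Cl m where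
  toLinearMap := LinearMap.mulLeft ℂ (e m j)
  cont := IsModuleTopology.continuous_of_linearMap (LinearMap.mulLeft ℂ (e m j))

/-- The inclusion of the scalars `ℂ → Cl m`. -/
def scalarCl (m : ℕ) : ℂ →L[ℂ] Cl m where
  toLinearMap := Algebra.linearMap ℂ (Cl m)
  cont := IsModuleTopology.continuous_of_linearMap (Algebra.linearMap ℂ (Cl m))

/-- A linear functional on `Cl m` as a continuous linear map. -/
def functionalCl (l : Module.Dual ℂ (Cl m)) : Cl m →L[ℂ] ℂ where
  toLinearMap := l
  cont := IsModuleTopology.continuous_of_linearMap l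

/-- A scalar distribution, viewed as a Clifford-valued one. -/
def ofScalar (S : 𝓢'(Eu m, ℂ)) : 𝓢'(Eu m, Cl m) :=
  PointwiseConvergenceCLM.postcomp _ (scalarCl m) S

/-- The product `e_j W` of a generator and a Clifford-valued distribution. -/
def eMul (j : Fin m) (W : 𝓢'(Eu m, Cl m)) : 𝓢'(Eu m, Cl m) :=
  PointwiseConvergenceCLM.postcomp _ (leftMulE m j) W

/-- The scalar distribution `φ ↦ l (W φ)`. -/
def component (l : Module.Dual ℂ (Cl m)) (W : 𝓢'(Eu m, Cl m)) : 𝓢'(Eu m, ℂ) :=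
  PointwiseConvergenceCLM.postcomp _ (functionalCl l) W

lemma ofScalar_apply (S : 𝓢'(Eu m, ℂ)) (φ : 𝓢(Eu m, ℂ)) :
    ofScalar S φ = algebraMap ℂ (Cl m) (S φ) := rfl

lemma eMul_apply (j : Fin m) (W : 𝓢'(Eu m, Cl m)) (φ : 𝓢(Eu m, ℂ)) :
    eMul j W φ = e m j * W φ := rfl

lemma component_apply (l : Module.Dual ℂ (Cl m)) (W : 𝓢'(Eu m, Cl m)) (φ : 𝓢(Eu m, ℂ)) :
    component l W φ = l (W φ) := rfl

/-- The Dirac operator `∑_j e_j ∂_{x_j}` on Clifford-valued distributions. -/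
def dirac (W : 𝓢'(Eu m, Cl m)) : 𝓢'(Eu m, Cl m) :=
  ∑ j : Fin m, eMul j (∂_{(EuclideanSpace.single j 1 : Eu m)} W)

/-- The operator `-Δ_m` on scalar distributions. -/
def negLaplacian (S : 𝓢'(Eu m, ℂ)) : 𝓢'(Eu m, ℂ) := -(Δ S)

/-! ### The families `T_lam`, `U_lam` and their normalizations -/

/-- The weight `ω ↦ ω_j` on the unit sphere. -/
def coordWeight (m : ℕ) (j : Fin m) : C(USphere m, ℝ) where
  toFun ω := (ω : Eu m) j
  continuous_toFun := by fun_prop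

/-- `T_lam = Fp r^lam`. -/
def T (m : ℕ) (lam : ℂ) : 𝓢'(Eu m, ℂ) := (sphereArea m : ℂ) • fpRadial 1 lam

/-- `U_lam = Fp r^lam ω`, where `ω = x / |x| = ∑_j e_j x_j / |x|`. -/
def U (m : ℕ) (lam : ℂ) : 𝓢'(Eu m, Cl m) :=
  ∑ j : Fin m, eMul j (ofScalar ((sphereArea m : ℂ) • fpRadial (coordWeight m j) lam))

open Classical in
/-- The normalized distributions `T*_lam`. -/
def Tstar (m : ℕ) (lam : ℂ) : 𝓢'(Eu m, ℂ) :=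
  if h : ∃ l : ℕ, lam = -m - 2 * l then
    ((Real.pi : ℂ) ^ ((m : ℂ) / 2 - h.choose) /
        (2 ^ (2 * h.choose) * Complex.Gamma ((m : ℂ) / 2 + h.choose))) •
      negLaplacian^[h.choose] (TemperedDistribution.delta 0)
  else
    ((Real.pi : ℂ) ^ ((lam + m) / 2) / Complex.Gamma ((lam + m) / 2)) • T m lam

open Classical in
/-- The normalized distributions `U*_lam`. -/
def Ustar (m : ℕ) (lam : ℂ) : 𝓢'(Eu m, Cl m) :=
  if h : ∃ l : ℕ, lam = -m - 2 * l - 1 then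
    (-((Real.pi : ℂ) ^ ((m : ℂ) / 2 - h.choose) /
        (2 ^ (2 * h.choose + 1) * Complex.Gamma ((m : ℂ) / 2 + h.choose + 1)))) •
      dirac^[2 * h.choose + 1] (ofScalar (TemperedDistribution.delta 0))
  else
    ((Real.pi : ℂ) ^ ((lam + m + 1) / 2) / Complex.Gamma ((lam + m + 1) / 2)) • U m lam

/-- The Hilbert kernel `H = -(2/σ_{m+1}) U*_{-m} = -(2/σ_{m+1}) Pv (x / |x|^(m+1))`. -/
def hilbertKernel (m : ℕ) : 𝓢'(Eu m, Cl m) :=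
  (-(2 / (sphereArea (m + 1) : ℂ))) • Ustar m (-m)

/-- `K_β = (-Δ_m)^(-β) δ`, the kernel of the complex power `(-Δ_m)^(-β)`; its Fourier transform is
`(2π|ξ|)^(-2β)`.  (For `β = (m+2n)/2` the Gamma function has a pole and the formula is not used.) -/
def K (m : ℕ) (β : ℂ) : 𝓢'(Eu m, ℂ) :=
  ((2 : ℂ) ^ (-2 * β) * Complex.Gamma ((m - 2 * β) / 2) /
    (Real.pi : ℂ) ^ ((m + 2 * β) / 2)) • Tstar m (-m + 2 * β)

/-- `L_β = (-Δ_m)^(-β) H`, given by its explicit formula.  (For `β = (m+1+2n)/2` the Gamma function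
has a pole and the formula is not used.) -/
def L (m : ℕ) (β : ℂ) : 𝓢'(Eu m, Cl m) :=
  (-((2 : ℂ) ^ (-2 * β) * Complex.Gamma ((m - 2 * β + 1) / 2) /
    (Real.pi : ℂ) ^ ((m + 2 * β + 1) / 2))) • Ustar m (-m + 2 * β)

/-! ### Convolution -/

/-- Smooth compactly supported functions that are `1` near the origin. -/
def IsCutoff (χ : Eu m → ℝ) : Prop :=
  ContDiff ℝ ((⊤ : ℕ∞) : WithTop ℕ∞) χ ∧ HasCompactSupport χ ∧ ∀ᶠ x in 𝓝 0, χ x = 1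

/-- The test functions `ψ_R(y) = χ(y/R) ⟨A_x, φ(x + y)⟩`, `R > 0`.  For any distribution `S`, the
pairing `⟨S, ψ_R⟩` is the value at `φ` of the convolution of `A` with the compactly supported
distribution `χ(·/R) S`. -/
def IsTruncatedTest (A : 𝓢'(Eu m, ℂ)) (χ : Eu m → ℝ) (φ : 𝓢(Eu m, ℂ))
    (ψ : ℝ → 𝓢(Eu m, ℂ)) : Prop :=
  ∀ R : ℝ, 0 < R → ∀ y : Eu m,
    ψ R y = (χ (R⁻¹ • y) : ℂ) * A (SchwartzMap.compSubConstCLM ℂ (-y) φ)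

/-- `a` is the Hadamard finite part of `g(R)` as `R → ∞`: after removal of a finite combination of
powers `R^z` with `Re z ≥ 0` and `z ≠ 0`, the function `g` converges to `a`. -/
def HasFinitePartAtTop (g : ℝ → ℂ) (a : ℂ) : Prop :=
  ∃ (s : Finset ℂ) (c : ℂ → ℂ), (∀ z ∈ s, 0 ≤ z.re ∧ z ≠ 0) ∧
    Tendsto (fun R : ℝ => g R - ∑ z ∈ s, c z * (R : ℂ) ^ z) atTop (𝓝 a)

/-- `W = A * S` for a Clifford-valued `A` and a scalar `S`: tested componentwise, the convolutions
`A * (χ(·/R) S)` converge to `W` as `R → ∞`, for every cutoff `χ`. -/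
def IsConvolution (A : 𝓢'(Eu m, Cl m)) (S : 𝓢'(Eu m, ℂ)) (W : 𝓢'(Eu m, Cl m)) : Prop :=
  ∀ (l : Module.Dual ℂ (Cl m)) (φ : 𝓢(Eu m, ℂ)) (χ : Eu m → ℝ), IsCutoff χ →
    ∃ ψ : ℝ → 𝓢(Eu m, ℂ), IsTruncatedTest (component l A) χ φ ψ ∧
      Tendsto (fun R : ℝ => S (ψ R)) atTop (𝓝 (component l W φ))

/-- `W = A * S` in the finite part sense: tested componentwise, `W` is the Hadamard finite part as
`R → ∞` of the convolutions `A * (χ(·/R) S)`, for every cutoff `χ`. -/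
def IsFinitePartConvolution (A : 𝓢'(Eu m, Cl m)) (S : 𝓢'(Eu m, ℂ))
    (W : 𝓢'(Eu m, Cl m)) : Prop :=
  ∀ (l : Module.Dual ℂ (Cl m)) (φ : 𝓢(Eu m, ℂ)) (χ : Eu m → ℝ), IsCutoff χ →
    ∃ ψ : ℝ → 𝓢(Eu m, ℂ), IsTruncatedTest (component l A) χ φ ψ ∧
      HasFinitePartAtTop (fun R : ℝ => S (ψ R)) (component l W φ)

/-- `W` is the Hilbert transform `H * S` of the scalar distribution `S`.  The convolution of two
tempered distributions need not exist in the ordinary sense (for `S = K_β` with large `Re β` it does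
not), so it is taken in the finite part sense, which extends the ordinary one. -/
def IsHilbertTransform (S : 𝓢'(Eu m, ℂ)) (W : 𝓢'(Eu m, Cl m)) : Prop :=
  IsFinitePartConvolution (hilbertKernel m) S W

end CliffordDist

end

noncomputable section

namespace CliffordDist

open MeasureTheory Set Filter Topology
open scoped SchwartzMap
open Laplacian LineDeriv

variable {m : ℕ}

/-! Write p_t for the heat kernel. The identity (-Δ)^(-β) = Γ(β)⁻¹ ∫ t^(β-1) e^(tΔ) dt presents K_β
as a superposition of the p_t with weight t^(β-1)/Γ(β). In the same way the j-th component of L_β is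
a superposition of the ∂_j p_u with weight u^(β-1/2)/Γ(β+1/2), so formally it is ∂_j (-Δ)^(-β-1/2)
δ. The Hilbert kernel is the case β = 0 of L_β. Convolving K_β with H therefore convolves t^(β-1)
with s^(-1/2) on the half line, by the semigroup property p_t * ∂_j p_s = ∂_j p_(s+t). The beta
integral gives B(β,1/2) u^(β-1/2), and B(β,1/2) is exactly the quotient of the Gamma factors
involved. This settles the strip 0 < Re β < m/2, where everything converges absolutely
(`coefK_mul_integral_pvConv`).

For the other β the truncated convolution is the pairing of K_β with χ(·/R)ψ, where ψ(y) = ⟨H, φ(· +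
y)⟩ is a combination of the functions `pvConv j φ`. These are smooth and have an expansion in the
homogeneous terms |y|^(-m-k) h_k(y/|y|) at infinity (`exists_pvConv_expansion`). By scaling, the
k-th term contributes a multiple of R^(2β-m-k) and a constant with denominator 2β-m-k
(`exists_tendsto_truncated`). What remains as R → ∞ is `regularPart`. It is holomorphic in β off the
real axis, as long as Re β is below a bound that grows with the number of terms used, and in the
strip it is the convergent integral.

Both sides are thus holomorphic off the real axis and agree on the nonreal part of the strip, so
they agree at all nonreal β (`regularPart_eq`). A real β that is not excluded is reached as a limit
through nonreal parameters. This requires K_β and L_β to be continuous there, also at the points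
where a pole of the finite part meets a zero of 1/Γ and the distribution becomes a derivative of δ.
These limits follow from the residue at β = 0 and from the relations L_β = ∂ K_(β+1/2) and K_β = -Δ
K_(β+1) (`tendsto_K`, `tendsto_Lcomp`).

The excluded β are those for which a Gamma factor of K_β or L_β has a pole or an exponent 2β-m-k
vanishes. If Re β < m/2, all exponents have negative real part and nothing has to be removed. -/

/-! ### Holomorphic dependence of the finite part on the exponent. -/

lemma setIntegral_eq_mellin (g : ℝ → ℂ) {s : Set ℝ} (hs : MeasurableSet s) (h0 : s ⊆ Ioi 0)
    (μ : ℂ) : ∫ r in s, (r : ℂ) ^ μ * g r = mellin (s.indicator g) (μ + 1) := by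
  have h : ∀ r : ℝ, (r : ℂ) ^ (μ + 1 - 1) • s.indicator g r =
      s.indicator (fun r : ℝ => (r : ℂ) ^ μ * g r) r := by
    intro r
    by_cases hr : r ∈ s <;> simp [hr]
  simp only [mellin, h]
  rw [setIntegral_indicator hs, inter_eq_self_of_subset_right h0]

/-- The integral is the Mellin transform of a truncated function, which is holomorphic in the strip
given by the growth rates at 0 and at infinity. -/
lemma differentiableAt_integral_Ioc {g : ℝ → ℂ} {C b : ℝ} (hg : ContinuousOn g (Ioc 0 1))
    (hb : ∀ r ∈ Ioc (0 : ℝ) 1, ‖g r‖ ≤ C * r ^ b) {μ : ℂ} (hμ : -1 < μ.re + b) :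
    DifferentiableAt ℂ (fun μ : ℂ => ∫ r in Ioc (0 : ℝ) 1, (r : ℂ) ^ μ * g r) μ := by
  have hmeas : AEStronglyMeasurable ((Ioc (0 : ℝ) 1).indicator g) volume :=
    (aestronglyMeasurable_indicator_iff measurableSet_Ioc).2
      (hg.aestronglyMeasurable measurableSet_Ioc)
  have hle : ∀ x : ℝ, ‖(Ioc (0 : ℝ) 1).indicator g x‖ ≤ ‖C * x ^ b‖ := by
    intro x
    by_cases hx : x ∈ Ioc (0 : ℝ) 1
    · rw [indicator_of_mem hx]
      exact (hb x hx).trans (le_abs_self _)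
    · rw [indicator_of_notMem hx, norm_zero]
      exact norm_nonneg _
  have hloc : LocallyIntegrableOn ((Ioc (0 : ℝ) 1).indicator g) (Ioi 0) := by
    have h1 : LocallyIntegrableOn (fun x : ℝ => C * x ^ b) (Ioi 0) := by
      refine ContinuousOn.locallyIntegrableOn (fun x hx => ?_) measurableSet_Ioi
      exact (continuousAt_const.mul
        (Real.continuousAt_rpow_const x b (Or.inl (ne_of_gt hx)))).continuousWithinAt
    exact h1.mono hmeas (Eventually.of_forall hle)
  have key : DifferentiableAt ℂ (mellin ((Ioc (0 : ℝ) 1).indicator g)) (μ + 1) := by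
    -- The truncated function vanishes beyond 1, so any decay exponent is available at infinity; one
    -- just above Re(μ + 1) is chosen.
    refine mellin_differentiableAt_of_isBigO_rpow (a := (μ + 1).re + 1) (b := -b) hloc ?_
      (by linarith) ?_ (by simp; linarith)
    · refine (Asymptotics.isBigO_zero _ _).congr' ?_ EventuallyEq.rfl
      filter_upwards [eventually_gt_atTop 1] with x hx
      rw [indicator_of_notMem (fun h => absurd h.2 (not_le.2 hx))]
    · simp only [neg_neg]
      refine Asymptotics.IsBigO.of_bound |C| (Eventually.of_forall fun x => ?_)
      refine (hle x).trans ?_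
      rw [norm_mul, Real.norm_eq_abs]
  simp only [setIntegral_eq_mellin g measurableSet_Ioc Ioc_subset_Ioi_self]
  exact DifferentiableAt.comp (g := mellin ((Ioc (0 : ℝ) 1).indicator g)) μ key (by fun_prop)

lemma differentiableAt_integral_Ioi {g : ℝ → ℂ} {C a : ℝ} (hg : ContinuousOn g (Ioi 1))
    (hb : ∀ r ∈ Ioi (1 : ℝ), ‖g r‖ ≤ C * r ^ (-a)) {μ : ℂ} (hμ : μ.re - a < -1) :
    DifferentiableAt ℂ (fun μ : ℂ => ∫ r in Ioi (1 : ℝ), (r : ℂ) ^ μ * g r) μ := by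
  have hmeas : AEStronglyMeasurable ((Ioi (1 : ℝ)).indicator g) volume :=
    (aestronglyMeasurable_indicator_iff measurableSet_Ioi).2
      (hg.aestronglyMeasurable measurableSet_Ioi)
  have hle : ∀ x : ℝ, ‖(Ioi (1 : ℝ)).indicator g x‖ ≤ ‖C * x ^ (-a)‖ := by
    intro x
    by_cases hx : x ∈ Ioi (1 : ℝ)
    · rw [indicator_of_mem hx]
      exact (hb x hx).trans (le_abs_self _)
    · rw [indicator_of_notMem hx, norm_zero]
      exact norm_nonneg _
  have hloc : LocallyIntegrableOn ((Ioi (1 : ℝ)).indicator g) (Ioi 0) := by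
    have h1 : LocallyIntegrableOn (fun x : ℝ => C * x ^ (-a)) (Ioi 0) := by
      refine ContinuousOn.locallyIntegrableOn (fun x hx => ?_) measurableSet_Ioi
      exact (continuousAt_const.mul
        (Real.continuousAt_rpow_const x (-a) (Or.inl (ne_of_gt hx)))).continuousWithinAt
    exact h1.mono hmeas (Eventually.of_forall hle)
  have key : DifferentiableAt ℂ (mellin ((Ioi (1 : ℝ)).indicator g)) (μ + 1) := by
    refine mellin_differentiableAt_of_isBigO_rpow (a := a) (b := (μ + 1).re - 1) hloc ?_
      (by simp; linarith) ?_ (by linarith)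
    · refine Asymptotics.IsBigO.of_bound |C| (Eventually.of_forall fun x => ?_)
      refine (hle x).trans ?_
      rw [norm_mul, Real.norm_eq_abs]
    · refine (Asymptotics.isBigO_zero _ _).congr' ?_ EventuallyEq.rfl
      filter_upwards [Ioo_mem_nhdsGT (zero_lt_one (α := ℝ))] with x hx
      rw [indicator_of_notMem (fun h => absurd (mem_Ioi.1 h) (not_lt.2 hx.2.le))]
  simp only [setIntegral_eq_mellin g measurableSet_Ioi (Ioi_subset_Ioi zero_le_one)]
  exact DifferentiableAt.comp (g := mellin ((Ioi (1 : ℝ)).indicator g)) μ key (by fun_prop)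

/-- The finite part computed by subtracting a Taylor polynomial with `N` terms. -/
def finitePartWith (N : ℕ) (μ : ℂ) (ψ : ℝ → ℂ) : ℂ :=
  (∫ r in Ioc (0 : ℝ) 1, (r : ℂ) ^ μ * (ψ r - taylorPoly N ψ r)) +
    (∑ k ∈ Finset.range N, iteratedDeriv k ψ 0 / (k.factorial : ℂ) / (μ + k + 1)) +
    ∫ r in Ioi (1 : ℝ), (r : ℂ) ^ μ * ψ r

lemma continuous_sphericalMean (w : C(USphere m, ℝ)) (φ : 𝓢(Eu m, ℂ)) :
    Continuous (sphericalMean w φ) := (contDiff_sphericalMean w φ 0).continuous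

lemma continuous_taylorPoly (N : ℕ) (ψ : ℝ → ℂ) : Continuous (taylorPoly N ψ) := by
  unfold taylorPoly; fun_prop

lemma integrableOn_sub_taylorPoly (w : C(USphere m, ℝ)) (φ : 𝓢(Eu m, ℂ)) {N : ℕ} {μ : ℂ}
    (h : -1 < μ.re + N) :
    IntegrableOn (fun r : ℝ => (r : ℂ) ^ μ *
      (sphericalMean w φ r - taylorPoly N (sphericalMean w φ) r)) (Ioc 0 1) := by
  refine Integrable.mono' ((integrableOn_rpow_Ioc h).const_mul
    (massBound w * SchwartzMap.seminorm ℂ 0 N φ)) ?_ ?_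
  · refine ContinuousOn.aestronglyMeasurable (fun r hr => ?_) measurableSet_Ioc
    have h1 := Complex.continuousAt_ofReal_cpow_const r μ (Or.inr hr.1.ne')
    exact (h1.mul ((continuous_sphericalMean w φ).sub
      (continuous_taylorPoly N _)).continuousAt).continuousWithinAt
  · refine (ae_restrict_iff' measurableSet_Ioc).2 (Filter.Eventually.of_forall fun r hr => ?_)
    rw [norm_mul, Complex.norm_cpow_eq_rpow_re_of_pos hr.1, Real.rpow_add_natCast hr.1.ne']
    have h := mul_le_mul_of_nonneg_left (norm_sub_taylorPoly_le w φ N hr)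
      (Real.rpow_nonneg hr.1.le μ.re)
    linarith

lemma integral_cpow_Ioc {s : ℂ} (hs : -1 < s.re) :
    ∫ r in Ioc (0 : ℝ) 1, (r : ℂ) ^ s = 1 / (s + 1) := by
  have hne : s + 1 ≠ 0 := fun h => by
    have := congrArg Complex.re h
    simp at this
    linarith
  rw [← intervalIntegral.integral_of_le zero_le_one, integral_cpow (Or.inl hs)]
  simp [Complex.zero_cpow hne]

/-- One more Taylor term leaves the integral and enters the sum: the integral of r^(μ+N) over (0,1]
converges and equals 1/(μ+N+1). -/
lemma finitePartWith_succ (w : C(USphere m, ℝ)) (φ : 𝓢(Eu m, ℂ)) {N : ℕ} {μ : ℂ}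
    (h : -1 < μ.re + N) :
    finitePartWith (N + 1) μ (sphericalMean w φ) = finitePartWith N μ (sphericalMean w φ) := by
  set S := sphericalMean w φ with hS
  have hint : IntegrableOn (fun r : ℝ => (r : ℂ) ^ (μ + N)) (Ioc 0 1) := by
    have := intervalIntegral.intervalIntegrable_cpow' (a := 0) (b := 1) (r := μ + N)
      (by simpa using h)
    rwa [intervalIntegrable_iff_integrableOn_Ioc_of_le zero_le_one] at this
  have h1 : (∫ r in Ioc (0 : ℝ) 1, (r : ℂ) ^ μ * (S r - taylorPoly (N + 1) S r)) =
      (∫ r in Ioc (0 : ℝ) 1, (r : ℂ) ^ μ * (S r - taylorPoly N S r)) -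
        iteratedDeriv N S 0 / (N.factorial : ℂ) / (μ + N + 1) := by
    have h2 : iteratedDeriv N S 0 / (N.factorial : ℂ) / (μ + N + 1) =
        ∫ r in Ioc (0 : ℝ) 1, (iteratedDeriv N S 0 / (N.factorial : ℂ)) * (r : ℂ) ^ (μ + N) := by
      rw [integral_const_mul, integral_cpow_Ioc (by simpa using h)]
      ring
    rw [h2, ← integral_sub (integrableOn_sub_taylorPoly w φ h) (hint.const_mul _)]
    refine setIntegral_congr_fun measurableSet_Ioc fun r hr => ?_
    have hr' : (r : ℂ) ≠ 0 := Complex.ofReal_ne_zero.2 hr.1.ne'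
    simp only [taylorPoly, Finset.sum_range_succ, Complex.cpow_add _ _ hr', Complex.cpow_natCast]
    ring
  rw [finitePartWith, finitePartWith, h1, Finset.sum_range_succ]
  ring

lemma finitePart_eq_finitePartWith (w : C(USphere m, ℝ)) (φ : 𝓢(Eu m, ℂ)) {N : ℕ} {μ : ℂ}
    (h : fpOrder μ ≤ N) :
    finitePart μ (sphericalMean w φ) = finitePartWith N μ (sphericalMean w φ) := by
  induction N, h using Nat.le_induction with
  | base => rfl
  | succ N hN ih =>
    rw [ih, finitePartWith_succ]
    have := fpOrder_spec μ
    have : (fpOrder μ : ℝ) ≤ N := by exact_mod_cast hN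
    linarith

/-- The number `fpOrder μ` jumps with μ. Every N with Re μ + N > -1 gives the same value, so one
fixed N serves a whole neighbourhood of a given exponent, and holomorphy can be read off term by
term. -/
lemma finitePart_eq_finitePartWith' (w : C(USphere m, ℝ)) (φ : 𝓢(Eu m, ℂ)) {N : ℕ} {μ : ℂ}
    (h : -1 < μ.re + N) :
    finitePart μ (sphericalMean w φ) = finitePartWith N μ (sphericalMean w φ) := by
  rcases le_total (fpOrder μ) N with h1 | h1
  · exact finitePart_eq_finitePartWith w φ h1
  · rw [finitePart_eq_finitePartWith w φ le_rfl]
    generalize fpOrder μ = M₀ at h1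
    induction M₀, h1 using Nat.le_induction with
    | base => rfl
    | succ M hM ih =>
      rw [finitePartWith_succ, ih]
      have : (N : ℝ) ≤ M := by exact_mod_cast hM
      linarith

lemma differentiableAt_inner (w : C(USphere m, ℝ)) (φ : 𝓢(Eu m, ℂ)) {N : ℕ} {μ : ℂ}
    (h : -1 < μ.re + N) :
    DifferentiableAt ℂ (fun μ : ℂ => ∫ r in Ioc (0 : ℝ) 1, (r : ℂ) ^ μ *
      (sphericalMean w φ r - taylorPoly N (sphericalMean w φ) r)) μ := by
  refine differentiableAt_integral_Ioc (C := massBound w * SchwartzMap.seminorm ℂ 0 N φ) (b := N)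
    ((continuous_sphericalMean w φ).sub (continuous_taylorPoly N _)).continuousOn ?_ h
  intro r hr
  rw [Real.rpow_natCast]
  exact norm_sub_taylorPoly_le w φ N hr

lemma differentiable_outer (w : C(USphere m, ℝ)) (φ : 𝓢(Eu m, ℂ)) :
    Differentiable ℂ (fun μ : ℂ => ∫ r in Ioi (1 : ℝ), (r : ℂ) ^ μ * sphericalMean w φ r) := by
  intro μ
  refine differentiableAt_integral_Ioi (a := fpDecay μ)
    (C := massBound w * SchwartzMap.seminorm ℂ (fpDecay μ) 0 φ)
    (continuous_sphericalMean w φ).continuousOn ?_ (fpDecay_spec μ)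
  intro r hr
  exact norm_sphericalMean_le w φ _ (zero_lt_one.trans (mem_Ioi.1 hr))

lemma eventually_re_add {μ₀ : ℂ} {N : ℕ} (h : -1 < μ₀.re + N) :
    ∀ᶠ μ : ℂ in 𝓝 μ₀, -1 < μ.re + N := by
  have : Continuous fun μ : ℂ => μ.re + N := by fun_prop
  exact this.continuousAt.eventually (lt_mem_nhds h)

/-- The finite part is holomorphic where no pole is met. -/
lemma differentiableAt_finitePart (w : C(USphere m, ℝ)) (φ : 𝓢(Eu m, ℂ)) {μ₀ : ℂ}
    (h : ∀ k : ℕ, μ₀ + k + 1 = 0 → iteratedDeriv k (sphericalMean w φ) 0 = 0) :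
    DifferentiableAt ℂ (fun μ => finitePart μ (sphericalMean w φ)) μ₀ := by
  have h0 := fpOrder_spec μ₀
  set N := fpOrder μ₀
  have h1 : DifferentiableAt ℂ (fun μ => finitePartWith N μ (sphericalMean w φ)) μ₀ := by
    unfold finitePartWith
    refine ((differentiableAt_inner w φ h0).add ?_).add (differentiable_outer w φ μ₀)
    refine DifferentiableAt.fun_sum fun k _ => ?_
    -- At a possible pole the Taylor coefficient vanishes, and the summand is zero for all μ.
    by_cases hk : μ₀ + k + 1 = 0
    · simp [h k hk]
    · exact DifferentiableAt.div (by fun_prop) (by fun_prop) hk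
  refine h1.congr_of_eventuallyEq ?_
  filter_upwards [eventually_re_add h0] with μ hμ
  exact finitePart_eq_finitePartWith' w φ hμ

/-- The polar part of the finite part at `μ = -1`. -/
lemma tendsto_finitePart_neg_one (w : C(USphere m, ℝ)) (φ : 𝓢(Eu m, ℂ)) :
    Tendsto (fun μ => (μ + 1) * finitePart μ (sphericalMean w φ)) (𝓝[≠] (-1))
      (𝓝 (sphericalMean w φ 0)) := by
  have h0 : -1 < (-1 : ℂ).re + (1 : ℕ) := by simp
  -- With one Taylor term subtracted both integrals are holomorphic near -1. After multiplication by
  -- μ + 1 only the summand S(0)/(μ+1), with S the spherical mean, survives in the limit.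
  have hA := ((differentiableAt_inner w φ h0).add (differentiable_outer w φ (-1))).continuousAt
  have hB : ContinuousAt (fun μ : ℂ => μ + 1) (-1) := by fun_prop
  have hC := (hB.mul hA).tendsto
  rw [Pi.mul_apply, neg_add_cancel, zero_mul] at hC
  have hD := (hC.add_const (sphericalMean w φ 0)).mono_left (nhdsWithin_le_nhds (s := {-1}ᶜ))
  rw [zero_add] at hD
  refine hD.congr' ?_
  filter_upwards [(eventually_re_add h0).filter_mono nhdsWithin_le_nhds,
    self_mem_nhdsWithin] with μ hμ hne
  have hne' : μ + 1 ≠ 0 := fun h => hne (eq_neg_of_add_eq_zero_left h)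
  rw [finitePart_eq_finitePartWith' w φ hμ, finitePartWith]

  simp
  field_simp
  ring

/-- In the convergent range the finite part is an integral. -/
lemma finitePart_eq_integral (w : C(USphere m, ℝ)) (φ : 𝓢(Eu m, ℂ)) {μ : ℂ} (h : -2 < μ.re)
    (h0 : -1 < μ.re ∨ sphericalMean w φ 0 = 0) :
    IntegrableOn (fun r : ℝ => (r : ℂ) ^ μ * sphericalMean w φ r) (Ioi 0) ∧
    finitePart μ (sphericalMean w φ) =
      ∫ r in Ioi (0 : ℝ), (r : ℂ) ^ μ * sphericalMean w φ r := by
  have key : IntegrableOn (fun r : ℝ => (r : ℂ) ^ μ * sphericalMean w φ r) (Ioc 0 1) ∧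
      finitePart μ (sphericalMean w φ) =
      (∫ r in Ioc (0 : ℝ) 1, (r : ℂ) ^ μ * sphericalMean w φ r) +
      ∫ r in Ioi (1 : ℝ), (r : ℂ) ^ μ * sphericalMean w φ r := by
    rcases h0 with h0 | h0
    · refine ⟨by simpa [taylorPoly] using
        integrableOn_sub_taylorPoly w φ (N := 0) (μ := μ) (by simpa using h0), ?_⟩
      rw [finitePart_eq_finitePartWith' w φ (N := 0) (by simpa using h0), finitePartWith]
      simp [taylorPoly]
    -- Since the value at 0 is zero, subtracting one Taylor term changes nothing, but its remainder
    -- bound gains the power of r needed for Re μ > -2.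
    · have h1 : -1 < μ.re + (1 : ℕ) := by push_cast; linarith
      refine ⟨by simpa [taylorPoly, h0] using integrableOn_sub_taylorPoly w φ h1, ?_⟩
      rw [finitePart_eq_finitePartWith' w φ h1, finitePartWith]
      simp [taylorPoly, h0]
  rw [key.2, ← Ioc_union_Ioi_eq_Ioi (zero_le_one (α := ℝ))]
  refine ⟨key.1.union (integrableOn_outer w φ μ), ?_⟩
  rw [setIntegral_union (Set.Ioc_disjoint_Ioi le_rfl) measurableSet_Ioi key.1
    (integrableOn_outer w φ μ)]

/-- If two test functions agree on the unit ball, then the difference of their finite parts is an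
integral over `(1, ∞)`. -/
lemma finitePart_sub_eq (w : C(USphere m, ℝ)) (f g : 𝓢(Eu m, ℂ)) (μ : ℂ)
    (h : ∀ x : Eu m, ‖x‖ ≤ 1 → f x = g x) (h' : f =ᶠ[𝓝 0] g) :
    finitePart μ (sphericalMean w f) - finitePart μ (sphericalMean w g) =
      ∫ r in Ioi (1 : ℝ), (r : ℂ) ^ μ * (sphericalMean w f r - sphericalMean w g r) := by
  have hS : ∀ r ∈ Ioc (0 : ℝ) 1, sphericalMean w f r = sphericalMean w g r := by
    intro r hr
    unfold sphericalMean
    congr 2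
    ext ω
    rw [h]
    simp [norm_smul, abs_of_pos hr.1, hr.2]
  have hD : ∀ k, iteratedDeriv k (sphericalMean w f) 0 = iteratedDeriv k (sphericalMean w g) 0 := by
    intro k
    rw [iteratedDeriv_sphericalMean, iteratedDeriv_sphericalMean, sphericalMeanDeriv,
      sphericalMeanDeriv]
    congr 2
    ext ω
    rw [zero_smul, (h'.iteratedFDeriv ℝ k).eq_of_nhds]
  have hT : ∀ N, taylorPoly N (sphericalMean w f) = taylorPoly N (sphericalMean w g) := by
    intro N
    ext r
    simp [taylorPoly, hD]
  have hI : (∫ r in Ioc (0 : ℝ) 1, (r : ℂ) ^ μ * (sphericalMean w f r -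
      taylorPoly (fpOrder μ) (sphericalMean w f) r)) =
      ∫ r in Ioc (0 : ℝ) 1, (r : ℂ) ^ μ * (sphericalMean w g r -
      taylorPoly (fpOrder μ) (sphericalMean w g) r) := by
    refine setIntegral_congr_fun measurableSet_Ioc fun r hr => ?_
    simp only [hS r hr, hT]
  rw [finitePart, finitePart, hI]
  simp only [hD, mul_sub]
  rw [integral_sub (integrableOn_outer w f μ) (integrableOn_outer w g μ)]
  ring

/-! ### The unit sphere: reflection, area, polar coordinates and parity. -/

open scoped Pointwise in
lemma measurePreserving_neg_toSphere :
    MeasurePreserving (fun ω : USphere m => -ω) (volume : Measure (Eu m)).toSphere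
      (volume : Measure (Eu m)).toSphere := by
  have hmeas : Measurable (fun ω : USphere m => -ω) := continuous_neg.measurable
  refine ⟨hmeas, Measure.ext fun s hs => ?_⟩
  rw [Measure.map_apply hmeas hs, Measure.toSphere_apply' _ (hmeas hs),
    Measure.toSphere_apply' _ hs]
  congr 1
  -- The sphere measure of a set is a multiple of the volume of the cone over it, and the cone over
  -- the reflected set is the reflected cone.
  have h : Ioo (0 : ℝ) 1 • ((↑) '' ((fun ω : USphere m => -ω) ⁻¹' s) : Set (Eu m)) =
      -(Ioo (0 : ℝ) 1 • ((↑) '' s : Set (Eu m))) := by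
    ext x
    simp only [Set.mem_smul, mem_image, mem_preimage, Set.mem_neg]
    constructor
    · rintro ⟨r, hr, _, ⟨ω, hω, rfl⟩, rfl⟩
      exact ⟨r, hr, _, ⟨-ω, hω, rfl⟩, by simp⟩
    · rintro ⟨r, hr, _, ⟨ω, hω, rfl⟩, h⟩
      refine ⟨r, hr, _, ⟨-ω, by simpa using hω, rfl⟩, ?_⟩
      rw [← neg_neg x, ← h]
      simp
  rw [h, Measure.measure_neg]

lemma integral_sphere_neg {F : Type*} [NormedAddCommGroup F] [NormedSpace ℝ F]
    (g : USphere m → F) :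
    ∫ ω, g (-ω) ∂(volume : Measure (Eu m)).toSphere =
      ∫ ω, g ω ∂(volume : Measure (Eu m)).toSphere :=
  measurePreserving_neg_toSphere.integral_comp
    (Homeomorph.neg (USphere m)).measurableEmbedding g

lemma nontrivial_Eu (hm : 1 ≤ m) : Nontrivial (Eu m) := by
  have : Nonempty (Fin m) := ⟨⟨0, hm⟩⟩
  infer_instance

lemma sphereArea_pos (hm : 1 ≤ m) : 0 < sphereArea m := by
  unfold sphereArea
  have : 0 < Real.Gamma ((m : ℝ) / 2) := Real.Gamma_pos_of_pos (by positivity)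
  positivity

lemma sphereArea_ne_zero (hm : 1 ≤ m) : (sphereArea m : ℂ) ≠ 0 :=
  Complex.ofReal_ne_zero.2 (sphereArea_pos hm).ne'

lemma toSphere_real_univ (hm : 1 ≤ m) :
    (volume : Measure (Eu m)).toSphere.real univ = sphereArea m := by
  have : Nonempty (Fin m) := ⟨⟨0, hm⟩⟩
  have hm' : (0 : ℝ) < m / 2 := by positivity
  have hG : 0 < Real.Gamma ((m : ℝ) / 2) := Real.Gamma_pos_of_pos hm'
  rw [Measure.toSphere_real_apply_univ, Measure.real, EuclideanSpace.volume_ball]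
  simp only [ENNReal.ofReal_one, one_pow, one_mul, Fintype.card_fin, finrank_euclideanSpace]
  rw [ENNReal.toReal_ofReal (by rw [Real.Gamma_add_one hm'.ne']; positivity),
    Real.Gamma_add_one hm'.ne', sphereArea, ← Real.rpow_natCast, Real.sqrt_eq_rpow,
    ← Real.rpow_mul Real.pi_pos.le]
  have : (m : ℝ) ≠ 0 := by positivity
  rw [show (1 / 2 * (m : ℝ)) = m / 2 by ring]
  field_simp

lemma finrank_Eu : Module.finrank ℝ (Eu m) = m := by simp

section Polar

variable {F : Type*} [NormedAddCommGroup F] [NormedSpace ℝ F]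

/-- Integration in polar coordinates. -/
lemma integral_polar (hm : 1 ≤ m) {f : Eu m → F} (hf : Integrable f) :
    ∫ x, f x = ∫ r in Ioi (0 : ℝ), r ^ (m - 1) •
      ∫ ω : USphere m, f (r • (ω : Eu m)) ∂(volume : Measure (Eu m)).toSphere := by
  have := nontrivial_Eu hm
  set μ : Measure (Eu m) := volume
  have hmp := μ.measurePreserving_homeomorphUnitSphereProd
  have hemb := (homeomorphUnitSphereProd (Eu m)).measurableEmbedding
  set g : USphere m × Ioi (0 : ℝ) → F := fun p => f ((p.2 : ℝ) • (p.1 : Eu m)) with hg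
  have hgf : ∀ x : ({0}ᶜ : Set (Eu m)), g (homeomorphUnitSphereProd (Eu m) x) = f x := by
    intro x
    have hx : ‖(x : Eu m)‖ ≠ 0 := norm_ne_zero_iff.2 x.2
    simp only [hg, homeomorphUnitSphereProd_apply_snd_coe, homeomorphUnitSphereProd_apply_fst_coe]
    rw [smul_smul, mul_inv_cancel₀ hx, one_smul]
  have hgi : Integrable g (μ.toSphere.prod (.volumeIoiPow (Module.finrank ℝ (Eu m) - 1))) := by
    rw [← hmp.integrable_comp_emb hemb]
    have h1 : IntegrableOn f ({0}ᶜ : Set (Eu m)) μ := hf.integrableOn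
    rw [integrableOn_iff_comap_subtypeVal (by measurability)] at h1
    exact h1.congr (Eventually.of_forall fun x => (hgf x).symm)
  calc
    ∫ x, f x ∂μ = ∫ x : ({0}ᶜ : Set (Eu m)), f x ∂(μ.comap (↑)) := by
      rw [integral_subtype_comap (measurableSet_singleton _).compl f, restrict_compl_singleton]
    _ = ∫ x : ({0}ᶜ : Set (Eu m)), g (homeomorphUnitSphereProd (Eu m) x) ∂(μ.comap (↑)) := by
      simp only [hgf]
    _ = ∫ p, g p ∂μ.toSphere.prod (.volumeIoiPow (Module.finrank ℝ (Eu m) - 1)) :=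
      hmp.integral_comp hemb g
    _ = ∫ r, ∫ ω, g (ω, r) ∂μ.toSphere ∂(.volumeIoiPow (Module.finrank ℝ (Eu m) - 1)) :=
      integral_prod_symm g hgi
    _ = _ := by
      rw [finrank_Eu]
      simp only [Measure.volumeIoiPow, ENNReal.ofReal]
      rw [integral_withDensity_eq_integral_smul
        ((measurable_subtype_coe.pow_const _).real_toNNReal)]
      rw [integral_subtype_comap measurableSet_Ioi
        (fun a : ℝ => Real.toNNReal (a ^ (m - 1)) • ∫ ω : USphere m, f (a • (ω : Eu m)) ∂μ.toSphere)]
      refine setIntegral_congr_fun measurableSet_Ioi fun x hx => ?_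
      simp only [NNReal.smul_def, Real.coe_toNNReal _ (pow_nonneg (mem_Ioi.1 hx).le _)]

end Polar

/-- The integral `∫_{S^{m-1}} w(ω) g(r ω) dS(ω)`. -/
def sphereInt (w : C(USphere m, ℝ)) (g : Eu m → ℂ) (r : ℝ) : ℂ :=
  ∫ ω : USphere m, (w ω : ℂ) * g (r • (ω : Eu m)) ∂(volume : Measure (Eu m)).toSphere

lemma sphereArea_mul_sphericalMean (hm : 1 ≤ m) (w : C(USphere m, ℝ)) (g : Eu m → ℂ) (r : ℝ) :
    sphereArea m * sphericalMean w g r = sphereInt w g r := by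
  have := sphereArea_ne_zero hm
  rw [sphericalMean, sphereInt]
  push_cast
  field_simp

lemma sphericalMean_one_zero (hm : 1 ≤ m) (f : Eu m → ℂ) :
    sphericalMean (1 : C(USphere m, ℝ)) f 0 = f 0 := by
  rw [sphericalMean]
  simp only [ContinuousMap.one_apply, Complex.ofReal_one, one_mul, zero_smul, integral_const,
    toSphere_real_univ hm, Complex.real_smul]
  have := sphereArea_ne_zero hm
  push_cast
  field_simp

/-- The k-th derivative at 0 integrates w(ω) against a form of degree k in ω. If w has the opposite
parity, the integrand is odd under ω ↦ -ω. Hence half of the possible poles are absent: for the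
weight 1 only even k, and for the weights ω_j only odd k, can contribute. -/
lemma iteratedDeriv_sphericalMean_eq_zero (w : C(USphere m, ℝ)) (φ : 𝓢(Eu m, ℂ)) (k : ℕ)
    (h : ∀ ω, w (-ω) = (-1) ^ (k + 1) * w ω) :
    iteratedDeriv k (sphericalMean w φ) 0 = 0 := by
  rw [iteratedDeriv_sphericalMean, sphericalMeanDeriv]
  set g : USphere m → ℂ := fun ω =>
    (w ω : ℂ) * iteratedFDeriv ℝ k φ ((0 : ℝ) • (ω : Eu m)) (fun _ => (ω : Eu m)) with hg
  have h1 : ∀ ω, g (-ω) = -g ω := by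
    intro ω
    have h2 : (fun _ : Fin k => ((-ω : USphere m) : Eu m)) =
        fun i : Fin k => (fun _ : Fin k => (-1 : ℝ)) i • (fun _ : Fin k => (ω : Eu m)) i := by
      ext i
      simp
    simp only [hg, zero_smul]
    rw [h2, (iteratedFDeriv ℝ k φ 0).map_smul_univ, h]
    simp only [Finset.prod_const, Finset.card_univ, Fintype.card_fin, Complex.real_smul]
    push_cast
    have h3 : ((-1 : ℂ) ^ k) * (-1) ^ k = 1 := by
      rw [← mul_pow]
      norm_num
    rw [pow_succ]
    linear_combination (-(w ω : ℂ) * iteratedFDeriv ℝ k φ 0 (fun _ => (ω : Eu m))) * h3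
  have h2 := integral_sphere_neg g
  simp only [h1, integral_neg] at h2
  have h3 : ∫ ω, g ω ∂(volume : Measure (Eu m)).toSphere = 0 := by
    linear_combination (-1 / 2 : ℂ) * h2
  rw [h3, mul_zero]

lemma coordWeight_neg (j : Fin m) (ω : USphere m) :
    coordWeight m j (-ω) = -coordWeight m j ω := by
  simp [coordWeight]

lemma sphericalMean_coord_zero (j : Fin m) (φ : 𝓢(Eu m, ℂ)) :
    sphericalMean (coordWeight m j) φ 0 = 0 := by
  have := iteratedDeriv_sphericalMean_eq_zero (coordWeight m j) φ 0
    (fun ω => by simp [coordWeight_neg])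
  simpa using this

lemma differentiableAt_fp_one (φ : 𝓢(Eu m, ℂ)) {μ : ℂ} (h : ∀ l : ℕ, μ + 2 * l + 1 ≠ 0) :
    DifferentiableAt ℂ (fun μ => finitePart μ (sphericalMean (1 : C(USphere m, ℝ)) φ)) μ := by
  refine differentiableAt_finitePart _ _ fun k hk => ?_
  rcases Nat.even_or_odd k with ⟨l, rfl⟩ | ho
  · exact absurd (by rw [← hk]; push_cast; ring) (h l)
  · refine iteratedDeriv_sphericalMean_eq_zero _ _ _ fun ω => ?_
    simp [ho.add_one.neg_one_pow]

lemma differentiableAt_fp_coord (j : Fin m) (φ : 𝓢(Eu m, ℂ)) {μ : ℂ}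
    (h : ∀ l : ℕ, μ + 2 * l + 2 ≠ 0) :
    DifferentiableAt ℂ (fun μ => finitePart μ (sphericalMean (coordWeight m j) φ)) μ := by
  refine differentiableAt_finitePart _ _ fun k hk => ?_
  rcases Nat.even_or_odd k with he | ⟨l, rfl⟩
  · refine iteratedDeriv_sphericalMean_eq_zero _ _ _ fun ω => ?_
    rw [he.add_one.neg_one_pow, coordWeight_neg]
    ring
  · exact absurd (by rw [← hk]; push_cast; ring) (h l)

/-! ### Radial integrability -/

/-- In polar coordinates the exponents are b + m - 1 > -1 at the origin and b + m - 1 - N < -1 at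
infinity. This function is the majorant in most of the integrability proofs below. -/
lemma integrable_rpow_mul (hm : 1 ≤ m) {b : ℝ} (hb : -m < b) {N : ℕ} (hN : b + m < N) :
    Integrable (fun x : Eu m => ‖x‖ ^ b * ((1 + ‖x‖) ^ N)⁻¹) := by
  have := nontrivial_Eu hm
  rw [integrable_fun_norm_addHaar (volume : Measure (Eu m))
    (f := fun r : ℝ => r ^ b * ((1 + r) ^ N)⁻¹), finrank_Eu,
    ← Ioc_union_Ioi_eq_Ioi (zero_le_one (α := ℝ))]
  have hmr : ((m - 1 : ℕ) : ℝ) = m - 1 := by push_cast [hm]; ring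
  have hc : ContinuousOn (fun r : ℝ => r ^ (m - 1) • (r ^ b * ((1 + r) ^ N)⁻¹)) (Ioi 0) := by
    intro r hr
    have hr' : (1 + r) ^ N ≠ 0 := (pow_pos (by linarith [mem_Ioi.1 hr]) N).ne'
    have h1 := Real.continuousAt_rpow_const r b (Or.inl (ne_of_gt hr))
    have h2 : ContinuousAt (fun r : ℝ => ((1 + r) ^ N)⁻¹) r :=
      ContinuousAt.inv₀ (by fun_prop) hr'
    exact ((continuousAt_id.pow _).smul (h1.mul h2)).continuousWithinAt
  refine IntegrableOn.union ?_ ?_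
  · refine Integrable.mono' (integrableOn_rpow_Ioc (s := b + m - 1) (by linarith)) ?_ ?_
    · exact (hc.mono Ioc_subset_Ioi_self).aestronglyMeasurable measurableSet_Ioc
    · refine (ae_restrict_iff' measurableSet_Ioc).2 (Eventually.of_forall fun r hr => ?_)
      have hr0 := hr.1
      rw [norm_smul, norm_mul, norm_pow, norm_inv, norm_pow, Real.norm_of_nonneg hr0.le,
        Real.norm_of_nonneg (Real.rpow_nonneg hr0.le _), Real.norm_of_nonneg (by linarith : 0 ≤ 1 + r),
        show b + m - 1 = ((m - 1 : ℕ) : ℝ) + b by rw [hmr]; ring, Real.rpow_add hr0,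
        Real.rpow_natCast, ← mul_assoc]
      refine mul_le_of_le_one_right (by positivity) (inv_le_one_of_one_le₀ ?_)
      exact one_le_pow₀ (by linarith)
  · refine Integrable.mono' (integrableOn_Ioi_rpow_of_lt (a := b + m - 1 - N) (by linarith)
      zero_lt_one) ?_ ?_
    · exact (hc.mono (Ioi_subset_Ioi zero_le_one)).aestronglyMeasurable measurableSet_Ioi
    · refine (ae_restrict_iff' measurableSet_Ioi).2 (Eventually.of_forall fun r hr => ?_)
      have hr0 : 0 < r := zero_lt_one.trans (mem_Ioi.1 hr)
      rw [norm_smul, norm_mul, norm_pow, norm_inv, norm_pow, Real.norm_of_nonneg hr0.le,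
        Real.norm_of_nonneg (Real.rpow_nonneg hr0.le _), Real.norm_of_nonneg (by linarith : 0 ≤ 1 + r),
        show b + m - 1 - N = ((m - 1 : ℕ) : ℝ) + b + (-(N : ℝ)) by rw [hmr]; ring,
        Real.rpow_add hr0, Real.rpow_add hr0, Real.rpow_natCast, ← mul_assoc, Real.rpow_neg hr0.le,
        Real.rpow_natCast]
      gcongr
      linarith

/-- Schwartz functions decay, locally uniformly under translations. -/
lemma exists_schwartz_decay {F : Type*} [NormedAddCommGroup F] [NormedSpace ℝ F]
    (f : 𝓢(Eu m, F)) (N : ℕ) :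
    ∃ C : ℝ, 0 ≤ C ∧ (∀ x, ‖f x‖ * (1 + ‖x‖) ^ N ≤ C) ∧
      (∀ x, ‖fderiv ℝ f x‖ * (1 + ‖x‖) ^ N ≤ C) := by
  set C0 := 2 ^ N * ((Finset.Iic ((N, 1) : ℕ × ℕ)).sup fun p => SchwartzMap.seminorm ℝ p.1 p.2) f
  have h0 : ∀ x, ‖f x‖ * (1 + ‖x‖) ^ N ≤ C0 := fun x => by
    have := SchwartzMap.one_add_le_sup_seminorm_apply (𝕜 := ℝ) (m := (N, 1)) (k := N) (n := 0)
      le_rfl (by simp) f x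
    rw [norm_iteratedFDeriv_zero] at this
    linarith
  have h1 : ∀ x, ‖fderiv ℝ f x‖ * (1 + ‖x‖) ^ N ≤ C0 := fun x => by
    have := SchwartzMap.one_add_le_sup_seminorm_apply (𝕜 := ℝ) (m := (N, 1)) (k := N) (n := 1)
      le_rfl (by simp) f x
    rw [norm_iteratedFDeriv_one] at this
    linarith
  exact ⟨C0, le_trans (by positivity) (h0 0), h0, h1⟩

lemma norm_sub_le_of_fderiv {F : Type*} [NormedAddCommGroup F] [NormedSpace ℝ F]
    (f : 𝓢(Eu m, F)) {C ρ : ℝ} {y x : Eu m} (hx : ‖x‖ ≤ ρ)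
    (h : ∀ z, ‖z - y‖ ≤ ρ → ‖fderiv ℝ f z‖ ≤ C) : ‖f (y + x) - f (y - x)‖ ≤ 2 * C * ‖x‖ := by
  have h1 := (convex_closedBall y ρ).norm_image_sub_le_of_norm_fderiv_le (𝕜 := ℝ) (f := f)
    (C := C) (x := y - x) (y := y + x) (fun z _ => f.differentiableAt)
    (fun z hz => h z (by simpa [dist_eq_norm] using hz)) (by simpa [dist_eq_norm] using hx)
    (by simpa [dist_eq_norm] using hx)
  refine h1.trans (le_of_eq ?_)
  rw [show y + x - (y - x) = (2 : ℝ) • x by rw [two_smul]; abel, norm_smul]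
  norm_num
  ring

/-- For |x| ≤ 1 the mean value inequality gives the factor |x|. For |x| ≥ 1 each of the two values
decays rapidly, because 1 + |x| ≤ (1 + |y|)(1 + |y ± x|), at the cost of a polynomial factor in y.
The factor |x| is what makes odd kernels of order -m integrable at the origin. -/
lemma exists_schwartz_odd_bound {F : Type*} [NormedAddCommGroup F] [NormedSpace ℝ F]
    (f : 𝓢(Eu m, F)) (N : ℕ) :
    ∃ C : ℝ, 0 ≤ C ∧ ∀ y x, ‖f (y + x) - f (y - x)‖ ≤
      C * (1 + ‖y‖) ^ N * (‖x‖ * ((1 + ‖x‖) ^ N)⁻¹) := by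
  obtain ⟨C, hC, h0, h1⟩ := exists_schwartz_decay f N
  refine ⟨2 * C * 2 ^ N, by positivity, fun y x => ?_⟩
  have hy : 1 ≤ (1 + ‖y‖) ^ N := one_le_pow₀ (by linarith [norm_nonneg y])
  rcases le_total ‖x‖ 1 with hx | hx
  · have h2 : ∀ z, ‖z - y‖ ≤ ‖x‖ → ‖fderiv ℝ f z‖ ≤ C := fun z _ => by
      refine le_trans ?_ (h1 z)
      exact le_mul_of_one_le_right (norm_nonneg _) (one_le_pow₀ (by linarith [norm_nonneg z]))
    refine (norm_sub_le_of_fderiv f le_rfl h2).trans ?_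
    have h3 : 1 ≤ 2 ^ N * ((1 + ‖x‖) ^ N)⁻¹ := by
      rw [← div_eq_mul_inv, le_div_iff₀ (by positivity), one_mul]
      gcongr
      linarith
    calc 2 * C * ‖x‖ = 2 * C * ‖x‖ * (1 * 1) := by ring
      _ ≤ 2 * C * ‖x‖ * ((1 + ‖y‖) ^ N * (2 ^ N * ((1 + ‖x‖) ^ N)⁻¹)) := by gcongr
      _ = _ := by ring
  · have h2 : ∀ z, ‖x‖ ≤ ‖y‖ + ‖z‖ → ‖f z‖ ≤ C * (1 + ‖y‖) ^ N * ((1 + ‖x‖) ^ N)⁻¹ := by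
      intro z hz
      rw [← div_eq_mul_inv, le_div_iff₀ (by positivity)]
      calc ‖f z‖ * (1 + ‖x‖) ^ N ≤ ‖f z‖ * ((1 + ‖y‖) * (1 + ‖z‖)) ^ N := by
            gcongr
            nlinarith [norm_nonneg y, norm_nonneg z]
        _ = (‖f z‖ * (1 + ‖z‖) ^ N) * (1 + ‖y‖) ^ N := by rw [mul_pow]; ring
        _ ≤ _ := by gcongr; exact h0 z
    have h3 := h2 (y + x) (by
      have := norm_sub_le (y + x) y
      rw [add_sub_cancel_left] at this
      linarith)
    have h4 := h2 (y - x) (by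
      have := norm_sub_le y (y - x)
      rw [sub_sub_cancel] at this
      linarith)
    have hA : 0 ≤ C * (1 + ‖y‖) ^ N * ((1 + ‖x‖) ^ N)⁻¹ := by positivity
    have h5 : (1 : ℝ) ≤ 2 ^ N := one_le_pow₀ (by norm_num)
    calc ‖f (y + x) - f (y - x)‖ ≤ 2 * (C * (1 + ‖y‖) ^ N * ((1 + ‖x‖) ^ N)⁻¹) * (1 * 1) := by
          refine (norm_sub_le _ _).trans ?_; linarith
      _ ≤ 2 * (C * (1 + ‖y‖) ^ N * ((1 + ‖x‖) ^ N)⁻¹) * (2 ^ N * ‖x‖) := by gcongr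
      _ = _ := by ring

lemma ae_ne_zero (hm : 1 ≤ m) : ∀ᵐ x : Eu m, x ≠ 0 := by
  have := nontrivial_Eu hm
  exact compl_mem_ae_iff.2 (measure_singleton 0)

/-! ### Homogeneous distributions as absolutely convergent integrals. -/

lemma integral_homogeneous (hm : 1 ≤ m) (w : C(USphere m, ℝ)) {lam : ℂ} {A g : Eu m → ℂ}
    (hA : ∀ r : ℝ, 0 < r → ∀ ω : USphere m, A (r • (ω : Eu m)) = (r : ℂ) ^ lam * w ω)
    (hi : Integrable fun x => A x * g x) :
    ∫ x, A x * g x = ∫ r in Ioi (0 : ℝ), (r : ℂ) ^ (lam + m - 1) * sphereInt w g r := by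
  rw [integral_polar hm hi]
  refine setIntegral_congr_fun measurableSet_Ioi fun r hr => ?_
  have hr0 : 0 < r := hr
  have hr' : (r : ℂ) ≠ 0 := Complex.ofReal_ne_zero.2 hr0.ne'
  simp only [hA r hr0, mul_assoc, integral_const_mul, sphereInt, Complex.real_smul]
  rw [← mul_assoc, show lam + m - 1 = ((m - 1 : ℕ) : ℂ) + lam by push_cast [hm]; ring,
    Complex.cpow_add _ _ hr', Complex.cpow_natCast]
  push_cast
  ring

lemma continuous_sphereInt (w : C(USphere m, ℝ)) {g : Eu m → ℂ} (hg : Continuous g) :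
    Continuous (sphereInt w g) := by
  have h := continuous_parametric_integral_of_continuous (s := univ)
    (μ := (volume : Measure (Eu m)).toSphere)
    (f := fun (r : ℝ) (ω : USphere m) => (w ω : ℂ) * g (r • (ω : Eu m)))
    (((Complex.continuous_ofReal.comp w.continuous).comp continuous_snd).mul
      (hg.comp (by fun_prop))) isCompact_univ
  simpa only [Measure.restrict_univ] using! h

lemma norm_cpow_norm_le (lam : ℂ) {x : Eu m} (hx : x ≠ 0) :
    ‖(‖x‖ : ℂ) ^ lam‖ = ‖x‖ ^ lam.re :=
  Complex.norm_cpow_eq_rpow_re_of_pos (norm_pos_iff.2 hx) _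

lemma measurable_norm_cpow (lam : ℂ) : Measurable fun x : Eu m => (‖x‖ : ℂ) ^ lam := by
  fun_prop

lemma norm_coord_le (x : Eu m) (j : Fin m) : ‖(x j : ℂ)‖ ≤ ‖x‖ := by
  rw [Complex.norm_real]
  exact PiLp.norm_apply_le x j

lemma integrable_norm_cpow_mul (hm : 1 ≤ m) {lam : ℂ} (h : -m < lam.re) (f : 𝓢(Eu m, ℂ)) :
    Integrable fun x : Eu m => (‖x‖ : ℂ) ^ lam * f x := by
  obtain ⟨N, hN⟩ := exists_nat_gt (lam.re + m)
  obtain ⟨C, hC, h0, -⟩ := exists_schwartz_decay f N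
  refine Integrable.mono' ((integrable_rpow_mul hm h hN).const_mul C) ?_ ?_
  · exact (measurable_norm_cpow lam).aestronglyMeasurable.mul f.continuous.aestronglyMeasurable
  · filter_upwards [ae_ne_zero hm] with x hx
    rw [norm_mul, norm_cpow_norm_le lam hx]
    have : ‖f x‖ ≤ C * ((1 + ‖x‖) ^ N)⁻¹ := by
      rw [← div_eq_mul_inv, le_div_iff₀ (by positivity)]
      exact h0 x
    calc ‖x‖ ^ lam.re * ‖f x‖ ≤ ‖x‖ ^ lam.re * (C * ((1 + ‖x‖) ^ N)⁻¹) := by gcongr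
      _ = _ := by ring

lemma norm_smul_sphere {r : ℝ} (hr : 0 < r) (ω : USphere m) : ‖r • (ω : Eu m)‖ = r := by
  rw [norm_smul, Real.norm_of_nonneg hr.le]
  simp

lemma T_eq_integral (hm : 1 ≤ m) {lam : ℂ} (h : -m < lam.re) (f : 𝓢(Eu m, ℂ)) :
    T m lam f = ∫ x, (‖x‖ : ℂ) ^ lam * f x := by
  rw [integral_homogeneous hm 1 (lam := lam) (fun r hr ω => by
    rw [norm_smul_sphere hr]; simp) (integrable_norm_cpow_mul hm h f)]
  have h1 : -1 < (lam + m - 1).re := by simp; linarith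
  have hT : T m lam f = sphereArea m * fpRadial 1 lam f := rfl
  rw [hT, fpRadial_apply,
    (finitePart_eq_integral 1 f (by linarith) (Or.inl h1)).2, ← integral_const_mul]
  refine setIntegral_congr_fun measurableSet_Ioi fun r _ => ?_
  rw [← sphereArea_mul_sphericalMean hm]
  ring

/-- The components of `U_lam`. -/
def Ucomp (m : ℕ) (j : Fin m) (lam : ℂ) : 𝓢'(Eu m, ℂ) :=
  (sphereArea m : ℂ) • fpRadial (coordWeight m j) lam

lemma Ucomp_apply (j : Fin m) (lam : ℂ) (f : 𝓢(Eu m, ℂ)) :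
    Ucomp m j lam f = sphereArea m * finitePart (lam + m - 1) (sphericalMean (coordWeight m j) f) :=
  rfl

lemma T_apply (lam : ℂ) (f : 𝓢(Eu m, ℂ)) :
    T m lam f = sphereArea m * finitePart (lam + m - 1) (sphericalMean 1 f) := rfl

/-- The kernel has size at most |x|^(Re λ), and the symmetric difference adds one power of |x| at
the origin. One unit is thereby gained over Re λ > -m, so that λ = -m, the case of the Hilbert
kernel, is included. -/
lemma integrable_coord_mul_odd (hm : 1 ≤ m) (j : Fin m) {lam : ℂ} (h : -m - 1 < lam.re)
    (f : 𝓢(Eu m, ℂ)) (y : Eu m) :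
    Integrable fun x : Eu m => (‖x‖ : ℂ) ^ (lam - 1) * x j * (f (y + x) - f (y - x)) := by
  obtain ⟨N, hN⟩ := exists_nat_gt (lam.re + 1 + m)
  obtain ⟨C, hC, h0⟩ := exists_schwartz_odd_bound f N
  refine Integrable.mono' ((integrable_rpow_mul hm (b := lam.re + 1) (by linarith)
    hN).const_mul (C * (1 + ‖y‖) ^ N)) ?_ ?_
  · refine AEStronglyMeasurable.mul (((measurable_norm_cpow _).mul
      (by fun_prop)).aestronglyMeasurable) ?_
    exact (((f.continuous.comp (by fun_prop)).sub
      (f.continuous.comp (by fun_prop))) : Continuous fun x => f (y + x) - f (y - x)).aestronglyMeasurable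
  · filter_upwards [ae_ne_zero hm] with x hx
    have hx' : 0 < ‖x‖ := norm_pos_iff.2 hx
    rw [norm_mul, norm_mul, norm_cpow_norm_le _ hx]
    calc ‖x‖ ^ (lam - 1).re * ‖(x j : ℂ)‖ * ‖f (y + x) - f (y - x)‖
        ≤ ‖x‖ ^ (lam - 1).re * ‖x‖ * (C * (1 + ‖y‖) ^ N * (‖x‖ * ((1 + ‖x‖) ^ N)⁻¹)) := by
          gcongr
          · exact norm_coord_le x j
          · exact h0 y x
      _ = _ := by
          rw [show lam.re + 1 = (lam - 1).re + 1 + 1 by simp, Real.rpow_add hx',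
            Real.rpow_add hx', Real.rpow_one]
          ring

/-- Since ω_j is odd, the spherical integral of f(x) - f(-x) is twice that of f. The symmetrized
form replaces the principal value by an absolutely convergent integral. -/
lemma Ucomp_eq_integral (hm : 1 ≤ m) (j : Fin m) {lam : ℂ} (h : -m - 1 < lam.re)
    (f : 𝓢(Eu m, ℂ)) :
    Ucomp m j lam f = 1 / 2 * ∫ x : Eu m, (‖x‖ : ℂ) ^ (lam - 1) * x j * (f x - f (-x)) := by
  have hi := integrable_coord_mul_odd hm j h f 0
  simp only [zero_add, zero_sub] at hi
  rw [integral_homogeneous hm (coordWeight m j) (lam := lam) (fun r hr ω => by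
    have hr' : (r : ℂ) ≠ 0 := Complex.ofReal_ne_zero.2 hr.ne'
    rw [norm_smul_sphere hr, Complex.cpow_sub _ _ hr', Complex.cpow_one]
    simp only [PiLp.smul_apply, smul_eq_mul, coordWeight, ContinuousMap.coe_mk]
    push_cast
    field_simp) hi]
  have h1 : -2 < (lam + m - 1).re := by simp; linarith
  rw [Ucomp_apply, (finitePart_eq_integral _ f h1 (Or.inr (sphericalMean_coord_zero j f))).2,
    ← integral_const_mul, ← integral_const_mul]
  refine setIntegral_congr_fun measurableSet_Ioi fun r _ => ?_
  have h2 : sphereInt (coordWeight m j) (fun x => f x - f (-x)) r =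
      2 * sphereInt (coordWeight m j) f r := by
    have hA := integrable_integrand (coordWeight m j) f 0 r
    simp only [iteratedFDeriv_zero_apply] at hA
    have h4 := integral_sphere_neg
      (fun ω : USphere m => (coordWeight m j ω : ℂ) * f (r • (ω : Eu m)))
    have h5 : (fun ω : USphere m => (coordWeight m j (-ω) : ℂ) *
        f (r • ((-ω : USphere m) : Eu m))) =
        fun ω => -((coordWeight m j ω : ℂ) * f (-(r • (ω : Eu m)))) := by
      ext ω
      simp [coordWeight_neg]
    have hB := (measurePreserving_neg_toSphere (m := m)).integrable_comp_emb
      (Homeomorph.neg (USphere m)).measurableEmbedding |>.2 hA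
    simp only [Function.comp_def] at hB
    rw [h5] at hB
    have hB' := hB.neg
    simp only [Pi.neg_def, neg_neg] at hB'
    rw [h5, integral_neg] at h4
    simp only [sphereInt, mul_sub]
    rw [integral_sub hA hB', ← h4]
    ring
  rw [h2, ← sphereArea_mul_sphericalMean hm]
  ring

/-! ### The normalizing constants -/

/-- The factor in `K_β = coefK β • T_(2β-m)`. -/
def coefK (m : ℕ) (β : ℂ) : ℂ :=
  (2 : ℂ) ^ (-2 * β) * Complex.Gamma (m / 2 - β) / (Real.pi : ℂ) ^ ((m : ℂ) / 2) *
    (Complex.Gamma β)⁻¹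

/-- The factor in `L_β = coefL β • U_(2β-m)`. -/
def coefL (m : ℕ) (β : ℂ) : ℂ :=
  -((2 : ℂ) ^ (-2 * β) * Complex.Gamma ((m + 1) / 2 - β) / (Real.pi : ℂ) ^ ((m : ℂ) / 2) *
    (Complex.Gamma (β + 1 / 2))⁻¹)

lemma pi_ne_zero' : (Real.pi : ℂ) ≠ 0 := Complex.ofReal_ne_zero.2 Real.pi_ne_zero

lemma K_eq_coefK (m : ℕ) {β : ℂ} (h : ∀ l : ℕ, β ≠ -l) :
    K m β = coefK m β • T m (-m + 2 * β) := by
  have h1 : ¬ ∃ l : ℕ, (-m + 2 * β : ℂ) = -m - 2 * l := by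
    rintro ⟨l, hl⟩
    exact h l (by linear_combination hl / 2)
  rw [K, Tstar, dif_neg h1, smul_smul, coefK]
  congr 1
  have hpi : (Real.pi : ℂ) ^ ((m + 2 * β) / 2) ≠ 0 := by simp [Complex.cpow_eq_zero_iff]
  have hpi2 : (Real.pi : ℂ) ^ ((m : ℂ) / 2) ≠ 0 := by simp [Complex.cpow_eq_zero_iff]
  rw [show (-m + 2 * β + m : ℂ) / 2 = β by ring, show ((m : ℂ) - 2 * β) / 2 = m / 2 - β by ring,
    show ((m : ℂ) + 2 * β) / 2 = m / 2 + β by ring, Complex.cpow_add _ _ pi_ne_zero']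
  have hpi3 : (Real.pi : ℂ) ^ β ≠ 0 := by simp [Complex.cpow_eq_zero_iff]
  field_simp

lemma gamma_ne_zero_of_pos {x : ℝ} (hx : 0 < x) {z : ℂ} (h : z = x) : Complex.Gamma z ≠ 0 := by
  rw [h]
  exact Complex.Gamma_ne_zero_of_re_pos (by simpa using hx)

lemma K_neg_nat (hm : 1 ≤ m) (l : ℕ) :
    K m (-l) = negLaplacian^[l] (TemperedDistribution.delta 0) := by
  have h1 : ∃ k : ℕ, (-m + 2 * (-l : ℂ)) = -m - 2 * k := ⟨l, by ring⟩
  have hl : h1.choose = l := by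
    have := h1.choose_spec
    have h2 : (h1.choose : ℂ) = l := by linear_combination this / 2
    exact_mod_cast h2
  rw [K, Tstar, dif_pos h1, hl, smul_smul]
  convert one_smul ℂ _ using 2
  have hG : Complex.Gamma ((m : ℂ) / 2 + l) ≠ 0 :=
    gamma_ne_zero_of_pos (x := (m : ℝ) / 2 + l) (by positivity) (by push_cast; rfl)
  rw [show ((m : ℂ) - 2 * (-l)) / 2 = m / 2 + l by ring,
    show ((m : ℂ) + 2 * (-l)) / 2 = m / 2 - l by ring,
    show (-2 * (-l) : ℂ) = ((2 * l : ℕ) : ℂ) by push_cast; ring, Complex.cpow_natCast]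
  have hpi : (Real.pi : ℂ) ^ ((m : ℂ) / 2 - l) ≠ 0 := by simp [Complex.cpow_eq_zero_iff]
  generalize Complex.Gamma ((m : ℂ) / 2 + l) = G at hG
  field_simp

open Classical in
/-- The components of `L_β`. -/
def Lcomp (m : ℕ) (j : Fin m) (β : ℂ) (f : 𝓢(Eu m, ℂ)) : ℂ :=
  -- At these points a pole of the finite part meets a zero of 1/Γ(β + 1/2). The value is that of
  -- the distribution derivative ∂_j of K_(β+1/2), which is a derivative of δ.
  if ∃ l : ℕ, β = -l - 1 / 2 then -K m (β + 1 / 2) (∂_{(EuclideanSpace.single j 1 : Eu m)} f)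
  else coefL m β * Ucomp m j (-m + 2 * β) f

/-! ### The Clifford relations, the Dirac operator and the scalar components of L_β. -/

lemma e_mul_e_add (i j : Fin m) (h : i ≠ j) : e m i * e m j + e m j * e m i = 0 := by
  rw [e, e, CliffordAlgebra.ι_mul_ι_add_swap]
  have : QuadraticMap.polar (cliffordForm m) (Pi.single i 1) (Pi.single j 1) = 0 := by
    simp only [QuadraticMap.polar, cliffordForm, QuadraticMap.weightedSumSquares_apply,
      ← Finset.sum_sub_distrib]
    refine Finset.sum_eq_zero fun k _ => ?_
    by_cases hk : k = i <;> by_cases hk' : k = j <;> simp_all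
  rw [this, map_zero]

lemma dirac_apply (W : 𝓢'(Eu m, Cl m)) (f : 𝓢(Eu m, ℂ)) :
    dirac W f = -∑ j, e m j * W (∂_{(EuclideanSpace.single j 1 : Eu m)} f) := by
  have : dirac W f = ∑ j, eMul j (∂_{(EuclideanSpace.single j 1 : Eu m)} W) f := by
    unfold dirac
    simp
  rw [this, ← Finset.sum_neg_distrib]
  refine Finset.sum_congr rfl fun j _ => ?_
  rw [eMul_apply, TemperedDistribution.lineDerivOp_apply_apply]
  simp

lemma laplacian_eq_sum_coord (f : 𝓢(Eu m, ℂ)) :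
    Δ f = ∑ j, ∂_{(EuclideanSpace.single j 1 : Eu m)} (∂_{(EuclideanSpace.single j 1 : Eu m)} f) := by
  rw [SchwartzMap.laplacian_eq_sum (EuclideanSpace.basisFun (Fin m) ℝ)]
  simp

lemma negLaplacian_apply (S : 𝓢'(Eu m, ℂ)) (f : 𝓢(Eu m, ℂ)) :
    negLaplacian S f = -S (Δ f) := by
  rw [← TemperedDistribution.laplacian_apply_apply]
  rfl

lemma lineDerivOp_comm (f : 𝓢(Eu m, ℂ)) (v w : Eu m) : ∂_{v} (∂_{w} f) = ∂_{w} (∂_{v} f) := by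
  have key : ∀ a b x, (∂_{a} (∂_{b} f)) x = fderiv ℝ (fderiv ℝ f) x a b := by
    intro a b x
    have h1 : ⇑(∂_{b} f : 𝓢(Eu m, ℂ)) = fun z => fderiv ℝ f z b := by
      ext z
      exact SchwartzMap.lineDerivOp_apply_eq_fderiv b f z
    have hd : DifferentiableAt ℝ (fderiv ℝ f) x :=
      ((f.smooth 2).fderiv_right (m := 1) (by norm_num)).differentiable (by norm_num) x
    rw [SchwartzMap.lineDerivOp_apply_eq_fderiv, h1, fderiv_clm_apply hd (by fun_prop)]
    simp
  ext x
  rw [key, key]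
  have := (f.smooth 2).contDiffAt (x := x) |>.isSymmSndFDerivAt (by simp)
  exact this v w

/-- Second derivatives commute, so adding the double sum to its transpose replaces e_i e_j by the
anticommutator. The off-diagonal terms cancel, and the diagonal ones carry e_i² = -1. -/
lemma dirac_dirac_ofScalar (S : 𝓢'(Eu m, ℂ)) :
    dirac (dirac (ofScalar S)) = ofScalar (negLaplacian S) := by
  ext f
  simp only [dirac_apply, ofScalar_apply, negLaplacian_apply, laplacian_eq_sum_coord, map_sum,
    map_neg, Finset.mul_sum, mul_neg, Finset.sum_neg_distrib, neg_neg]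
  set a : Fin m → Fin m → Cl m := fun i j => algebraMap ℂ (Cl m)
    (S (∂_{(EuclideanSpace.single i 1 : Eu m)} (∂_{(EuclideanSpace.single j 1 : Eu m)} f))) with ha
  have hsymm : ∀ i j, a i j = a j i := fun i j => by simp only [ha]; rw [lineDerivOp_comm]
  change ∑ i, ∑ j, e m i * (e m j * a j i) = -∑ i, a i i
  set X := ∑ i, ∑ j, e m i * (e m j * a j i) with hX
  have h1 : X = ∑ i, ∑ j, e m j * (e m i * a j i) := by
    rw [hX, Finset.sum_comm]
    refine Finset.sum_congr rfl fun i _ => Finset.sum_congr rfl fun j _ => ?_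
    rw [hsymm]
  have h2 : X + X = -∑ i, a i i + -∑ i, a i i := by
    nth_rw 2 [h1]
    rw [hX, ← Finset.sum_add_distrib, ← Finset.sum_neg_distrib, ← Finset.sum_add_distrib]
    refine Finset.sum_congr rfl fun i _ => ?_
    rw [← Finset.sum_add_distrib, Finset.sum_eq_single i]
    · rw [← mul_assoc, e_mul_self]
      simp
    · intro j _ hj
      rw [← mul_assoc, ← mul_assoc, ← add_mul, e_mul_e_add i j hj.symm, zero_mul]
    · simp
  have h3 : (2 : ℂ) • X = (2 : ℂ) • (-∑ i, a i i) := by rw [two_smul, two_smul, h2]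
  exact smul_right_injective _ (two_ne_zero (α := ℂ)) h3

lemma dirac_iterate_ofScalar (S : 𝓢'(Eu m, ℂ)) (l : ℕ) :
    dirac^[2 * l + 1] (ofScalar S) = dirac (ofScalar (negLaplacian^[l] S)) := by
  induction l generalizing S with
  | zero => rfl
  | succ l ih =>
    rw [show 2 * (l + 1) + 1 = (2 * l + 1) + 1 + 1 by ring, Function.iterate_succ_apply,
      Function.iterate_succ_apply, dirac_dirac_ofScalar, ih, Function.iterate_succ_apply]

lemma U_apply (lam : ℂ) (f : 𝓢(Eu m, ℂ)) :
    U m lam f = ∑ j, e m j * algebraMap ℂ (Cl m) (Ucomp m j lam f) := by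
  have : U m lam f = ∑ j, eMul j (ofScalar (Ucomp m j lam)) f := by
    unfold U Ucomp
    simp
  rw [this]
  rfl

lemma Ustar_apply_of_ne {lam : ℂ} (h : ∀ l : ℕ, lam ≠ -m - 2 * l - 1) :
    Ustar m lam = ((Real.pi : ℂ) ^ ((lam + m + 1) / 2) /
      Complex.Gamma ((lam + m + 1) / 2)) • U m lam := by
  rw [Ustar, dif_neg (by push Not; exact h)]

/-- This reduces the proposition to scalar distributions. At the exceptional points ∂^(2l+1) δ = ∂
(-Δ)^l δ = ∂ K_(-l), with all constants cancelling; elsewhere only powers of π have to be combined.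
-/
lemma L_apply (hm : 1 ≤ m) (β : ℂ) (f : 𝓢(Eu m, ℂ)) :
    L m β f = ∑ j, e m j * algebraMap ℂ (Cl m) (Lcomp m j β f) := by
  by_cases hβ : ∃ l : ℕ, β = -l - 1 / 2
  · obtain ⟨l, hl⟩ := id hβ
    have h1 : ∃ k : ℕ, (-m + 2 * β) = -m - 2 * k - 1 := ⟨l, by rw [hl]; ring⟩
    have hl' : h1.choose = l := by
      have := h1.choose_spec
      have h2 : (h1.choose : ℂ) = l := by linear_combination this / 2 - hl
      exact_mod_cast h2
    have h2 : L m β = dirac (ofScalar (K m (-l))) := by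
      rw [L, Ustar, dif_pos h1, hl', smul_smul, dirac_iterate_ofScalar, ← K_neg_nat hm]
      convert one_smul ℂ _ using 2
      have hG : Complex.Gamma ((m : ℂ) / 2 + l + 1) ≠ 0 :=
        gamma_ne_zero_of_pos (x := (m : ℝ) / 2 + l + 1) (by positivity) (by push_cast; rfl)
      rw [hl, show ((m : ℂ) - 2 * (-l - 1 / 2) + 1) / 2 = m / 2 + l + 1 by ring,
        show ((m : ℂ) + 2 * (-l - 1 / 2) + 1) / 2 = m / 2 - l by ring,
        show (-2 * (-l - 1 / 2) : ℂ) = ((2 * l + 1 : ℕ) : ℂ) by push_cast; ring,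
        Complex.cpow_natCast]
      have hpi : (Real.pi : ℂ) ^ ((m : ℂ) / 2 - l) ≠ 0 := by simp [Complex.cpow_eq_zero_iff]
      generalize Complex.Gamma ((m : ℂ) / 2 + l + 1) = G at hG
      field_simp
    simp only [h2, dirac_apply, Lcomp, if_pos hβ, ofScalar_apply]
    rw [hl, ← Finset.sum_neg_distrib]
    refine Finset.sum_congr rfl fun j _ => ?_
    simp
  · have h1 : ∀ l : ℕ, (-m + 2 * β) ≠ -m - 2 * l - 1 := fun l h =>
      hβ ⟨l, by linear_combination h / 2⟩
    have h2 : L m β = coefL m β • U m (-m + 2 * β) := by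
      rw [L, Ustar_apply_of_ne h1, smul_smul, coefL]
      congr 1
      have hpi2 : (Real.pi : ℂ) ^ ((m : ℂ) / 2) ≠ 0 := by simp [Complex.cpow_eq_zero_iff]
      have hpi3 : (Real.pi : ℂ) ^ (β + 1 / 2) ≠ 0 := by simp [Complex.cpow_eq_zero_iff]
      rw [show (-m + 2 * β + m + 1 : ℂ) / 2 = β + 1 / 2 by ring,
        show ((m : ℂ) - 2 * β + 1) / 2 = (m + 1) / 2 - β by ring,
        show ((m : ℂ) + 2 * β + 1) / 2 = m / 2 + (β + 1 / 2) by ring,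
        Complex.cpow_add _ _ pi_ne_zero']
      field_simp
    have h3 : L m β f = coefL m β • U m (-m + 2 * β) f := by rw [h2]; rfl
    rw [h3, U_apply, Finset.smul_sum]
    refine Finset.sum_congr rfl fun j _ => ?_
    rw [Lcomp, if_neg hβ, map_mul, Algebra.smul_def, ← mul_assoc, ← mul_assoc,
      Algebra.commutes (coefL m β) (e m j)]

/-- Because 2/σ_(m+1) = Γ((m+1)/2)/π^((m+1)/2), the Hilbert kernel is a member of the family L_β and
has the same heat kernel representation. -/
lemma hilbertKernel_eq (hm : 1 ≤ m) : hilbertKernel m = L m 0 := by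
  rw [hilbertKernel, L, show (-m + 2 * (0 : ℂ)) = -m by ring]
  congr 2
  rw [sphereArea]
  have hG : Real.Gamma (((m + 1 : ℕ) : ℝ) / 2) ≠ 0 :=
    (Real.Gamma_pos_of_pos (by positivity)).ne'
  have h1 : Complex.Gamma (((m : ℂ) + 1) / 2) = (Real.Gamma (((m + 1 : ℕ) : ℝ) / 2) : ℂ) := by
    rw [← Complex.Gamma_ofReal]
    push_cast
    rfl
  have h2 : (Real.pi : ℂ) ^ (((m : ℂ) + 1) / 2) =
      ((Real.pi ^ (((m + 1 : ℕ) : ℝ) / 2) : ℝ) : ℂ) := by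
    rw [Complex.ofReal_cpow Real.pi_pos.le]
    push_cast
    rfl
  simp only [mul_zero, sub_zero, add_zero, Complex.cpow_zero, one_mul, h1, h2]
  have h3 : Real.pi ^ (((m + 1 : ℕ) : ℝ) / 2) ≠ 0 := (Real.rpow_pos_of_pos Real.pi_pos _).ne'
  push_cast
  field_simp

/-! ### Superposition of Gaussians -/

/-- Euler's integral for c^(-a) Γ(a) after the substitution u = 1/t. -/
lemma mellin_exp_inv {a : ℂ} (ha : 0 < a.re) {c : ℝ} (hc : 0 < c) :
    IntegrableOn (fun u : ℝ => (u : ℂ) ^ (-a - 1) * (Real.exp (-(c / u)) : ℂ)) (Ioi 0) ∧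
    ∫ u in Ioi (0 : ℝ), (u : ℂ) ^ (-a - 1) * (Real.exp (-(c / u)) : ℂ) =
      (c : ℂ) ^ (-a) * Complex.Gamma a := by
  set f : ℝ → ℂ := fun t => (Real.exp (-(c * t)) : ℂ) with hf
  have hconv : MellinConvergent f a := by
    have h1 : MellinConvergent (fun t : ℝ => (Real.exp (-t) : ℂ)) a := by
      have := Complex.GammaIntegral_convergent ha
      refine this.congr_fun (fun x _ => ?_) measurableSet_Ioi
      simp only [smul_eq_mul]
      ring
    have h2 := (MellinConvergent.comp_mul_left (f := fun t : ℝ => (Real.exp (-t) : ℂ))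
      (s := a) hc).2 h1
    simpa [hf] using h2
  have hval : mellin f a = (c : ℂ) ^ (-a) * Complex.Gamma a := by
    have := Complex.integral_cpow_mul_exp_neg_mul_Ioi ha hc
    have e1 : mellin f a = ∫ t in Ioi (0 : ℝ), (t : ℂ) ^ (a - 1) * Complex.exp (-(c * t)) := by
      simp [mellin, hf]
    rw [e1, this, one_div, Complex.inv_cpow _ _ (by
      rw [Complex.arg_ofReal_of_nonneg hc.le]; exact Real.pi_pos.ne), Complex.cpow_neg]
  have hinv : MellinConvergent (fun t => f t⁻¹) (-a) := by
    have := MellinConvergent.comp_rpow (f := f) (s := -a) (a := -1) (by norm_num)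
    simp only [Real.rpow_neg_one, Complex.ofReal_neg, Complex.ofReal_one, div_neg, div_one,
      neg_neg] at this
    exact this.2 hconv
  constructor
  · refine IntegrableOn.congr_fun hinv (fun x _ => ?_) measurableSet_Ioi
    simp [hf, div_eq_mul_inv]
  · rw [← hval, ← neg_neg a, ← mellin_comp_inv f (-a), mellin]
    simp [hf, div_eq_mul_inv]

lemma mellin_gauss {a : ℂ} (ha : 0 < a.re) {x : Eu m} (hx : x ≠ 0) :
    IntegrableOn (fun u : ℝ => (u : ℂ) ^ (-a - 1) * (Real.exp (-(‖x‖ ^ 2 / (4 * u))) : ℂ)) (Ioi 0) ∧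
    ∫ u in Ioi (0 : ℝ), (u : ℂ) ^ (-a - 1) * (Real.exp (-(‖x‖ ^ 2 / (4 * u))) : ℂ) =
      (4 : ℂ) ^ a * Complex.Gamma a * (‖x‖ : ℂ) ^ (-2 * a) := by
  have hx' : 0 < ‖x‖ := norm_pos_iff.2 hx
  have hc : 0 < ‖x‖ ^ 2 / 4 := by positivity
  have h := mellin_exp_inv ha hc
  simp only [div_div] at h
  refine ⟨h.1, h.2.trans ?_⟩
  have h1 : ((‖x‖ ^ 2 / 4 : ℝ) : ℂ) ^ (-a) = (4 : ℂ) ^ a * (‖x‖ : ℂ) ^ (-2 * a) := by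
    rw [div_eq_mul_inv, Complex.ofReal_mul, Complex.mul_cpow_ofReal_nonneg (by positivity)
      (by norm_num), pow_two, Complex.ofReal_mul, Complex.mul_cpow_ofReal_nonneg hx'.le hx'.le,
      ← Complex.cpow_add _ _ (Complex.ofReal_ne_zero.2 hx'.ne')]
    push_cast
    rw [show ((4 : ℂ)⁻¹) ^ (-a) = (4 : ℂ) ^ a by
      rw [Complex.inv_cpow _ _ (by
        rw [show (4 : ℂ) = ((4 : ℝ) : ℂ) by norm_num, Complex.arg_ofReal_of_nonneg (by norm_num)]
        exact Real.pi_pos.ne), Complex.cpow_neg, inv_inv]]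
    rw [show -a + -a = -2 * a by ring]
    ring
  rw [h1]
  ring

/-- Fubini applied to `mellin_gauss`. Absolute convergence of the double integral is the same
formula with a replaced by Re a and g by |g|. -/
lemma gauss_superposition (hm : 1 ≤ m) {a : ℂ} (ha : 0 < a.re) {g : Eu m → ℂ}
    (hg : AEStronglyMeasurable g) (hi : Integrable fun x => ‖x‖ ^ (-2 * a.re) * ‖g x‖) :
    IntegrableOn (fun u : ℝ => (u : ℂ) ^ (-a - 1) *
      ∫ x, (Real.exp (-(‖x‖ ^ 2 / (4 * u))) : ℂ) * g x) (Ioi 0) ∧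
    ∫ u in Ioi (0 : ℝ), (u : ℂ) ^ (-a - 1) * ∫ x, (Real.exp (-(‖x‖ ^ 2 / (4 * u))) : ℂ) * g x =
      (4 : ℂ) ^ a * Complex.Gamma a * ∫ x, (‖x‖ : ℂ) ^ (-2 * a) * g x := by
  set F : ℝ × Eu m → ℂ := fun p =>
    (p.1 : ℂ) ^ (-a - 1) * (Real.exp (-(‖p.2‖ ^ 2 / (4 * p.1))) : ℂ) * g p.2 with hF
  have hmeas : AEStronglyMeasurable F ((volume.restrict (Ioi (0 : ℝ))).prod volume) := by
    have h1 : Measurable fun p : ℝ × Eu m =>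
        (p.1 : ℂ) ^ (-a - 1) * (Real.exp (-(‖p.2‖ ^ 2 / (4 * p.1))) : ℂ) := by fun_prop
    exact h1.aestronglyMeasurable.mul hg.comp_snd
  have har : (0 : ℝ) < (a.re : ℂ).re := by simpa using ha
  have hnorm : ∀ x : Eu m, x ≠ 0 → ∫ u in Ioi (0 : ℝ), ‖F (u, x)‖ =
      (4 ^ a.re * Real.Gamma a.re) * (‖x‖ ^ (-2 * a.re) * ‖g x‖) := by
    intro x hx
    have h1 := (mellin_gauss har hx).2
    have h2 : ∀ u ∈ Ioi (0 : ℝ), ‖F (u, x)‖ =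
        (u ^ (-a.re - 1) * Real.exp (-(‖x‖ ^ 2 / (4 * u)))) * ‖g x‖ := by
      intro u hu
      simp only [hF, norm_mul]
      rw [Complex.norm_cpow_eq_rpow_re_of_pos hu, Complex.norm_real,
        Real.norm_of_nonneg (Real.exp_pos _).le]
      simp
    rw [setIntegral_congr_fun measurableSet_Ioi h2, integral_mul_const, ← mul_assoc]
    congr 1
    rw [← Complex.ofReal_inj, ← integral_complex_ofReal]
    have h3 : ∀ u ∈ Ioi (0 : ℝ), ((u ^ (-a.re - 1) * Real.exp (-(‖x‖ ^ 2 / (4 * u))) : ℝ) : ℂ) =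
        (u : ℂ) ^ (-(a.re : ℂ) - 1) * (Real.exp (-(‖x‖ ^ 2 / (4 * u))) : ℂ) := by
      intro u hu
      rw [Complex.ofReal_mul, Complex.ofReal_cpow (le_of_lt hu)]
      push_cast
      rfl
    rw [setIntegral_congr_fun measurableSet_Ioi h3, h1, Complex.Gamma_ofReal]
    push_cast [Complex.ofReal_cpow (norm_nonneg x),
      Complex.ofReal_cpow (show (0 : ℝ) ≤ 4 by norm_num)]
    rfl
  have hint : Integrable F ((volume.restrict (Ioi (0 : ℝ))).prod volume) := by
    rw [integrable_prod_iff' hmeas]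
    constructor
    · filter_upwards [ae_ne_zero hm] with x hx
      exact (mellin_gauss ha hx).1.mul_const (g x)
    · refine (hi.const_mul (4 ^ a.re * Real.Gamma a.re)).congr ?_
      filter_upwards [ae_ne_zero hm] with x hx
      exact (hnorm x hx).symm
  have h1 : ∀ u : ℝ, ∫ x, F (u, x) = (u : ℂ) ^ (-a - 1) *
      ∫ x, (Real.exp (-(‖x‖ ^ 2 / (4 * u))) : ℂ) * g x := by
    intro u
    simp only [hF, mul_assoc, integral_const_mul]
  have h2 := hint.integral_prod_left
  simp only [h1] at h2
  refine ⟨h2, ?_⟩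
  calc _ = ∫ u in Ioi (0 : ℝ), ∫ x, F (u, x) := by simp only [h1]
    _ = ∫ x, ∫ u in Ioi (0 : ℝ), F (u, x) :=
      integral_integral_swap (f := fun u x => F (u, x)) hint
    _ = ∫ x, (4 : ℂ) ^ a * Complex.Gamma a * ((‖x‖ : ℂ) ^ (-2 * a) * g x) := by
      refine integral_congr_ae ?_
      filter_upwards [ae_ne_zero hm] with x hx
      simp only [hF]
      rw [integral_mul_const, (mellin_gauss ha hx).2]
      ring
    _ = _ := integral_const_mul _ _

/-! ### The heat kernel -/

/-- The heat kernel. -/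
def heat (t : ℝ) (x : Eu m) : ℝ :=
  (4 * Real.pi * t) ^ (-(m : ℝ) / 2) * Real.exp (-(‖x‖ ^ 2 / (4 * t)))

/-- The partial derivative `∂_j` of the heat kernel. -/
def heatDeriv (j : Fin m) (t : ℝ) (x : Eu m) : ℝ := -(x j / (2 * t)) * heat t x

lemma continuous_heat (t : ℝ) : Continuous (heat t : Eu m → ℝ) := by
  unfold heat; fun_prop

lemma continuous_heatDeriv (j : Fin m) (t : ℝ) : Continuous (heatDeriv j t) := by
  unfold heatDeriv
  exact (by fun_prop : Continuous fun x : Eu m => -(x j / (2 * t))).mul (continuous_heat t)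

lemma heat_nonneg {t : ℝ} (ht : 0 < t) (x : Eu m) : 0 ≤ heat t x := by
  unfold heat; positivity

lemma heat_neg (t : ℝ) (x : Eu m) : heat t (-x) = heat t x := by simp [heat]

lemma heatDeriv_neg (j : Fin m) (t : ℝ) (x : Eu m) : heatDeriv j t (-x) = -heatDeriv j t x := by
  simp [heatDeriv, heat_neg]
  ring

lemma integrable_norm_pow_mul_heat (hm : 1 ≤ m) {t : ℝ} (ht : 0 < t) (k : ℕ) :
    Integrable fun x : Eu m => ‖x‖ ^ k * heat t x := by
  have := nontrivial_Eu hm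
  have h1 : Integrable fun x : Eu m => ‖x‖ ^ k * Real.exp (-(1 / (4 * t)) * ‖x‖ ^ 2) := by
    rw [integrable_fun_norm_addHaar (volume : Measure (Eu m))
      (f := fun r : ℝ => r ^ k * Real.exp (-(1 / (4 * t)) * r ^ 2)), finrank_Eu]
    have h2 := integrableOn_rpow_mul_exp_neg_mul_sq (b := 1 / (4 * t)) (by positivity)
      (s := ((m - 1 + k : ℕ) : ℝ)) (by
        have : (0 : ℝ) ≤ ((m - 1 + k : ℕ) : ℝ) := by positivity
        linarith)
    refine h2.congr_fun (fun r _ => ?_) measurableSet_Ioi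
    simp only [Real.rpow_natCast, smul_eq_mul, pow_add]
    ring
  refine (h1.const_mul ((4 * Real.pi * t) ^ (-(m : ℝ) / 2))).congr (Eventually.of_forall fun x => ?_)
  simp only [heat]
  rw [show -(1 / (4 * t)) * ‖x‖ ^ 2 = -(‖x‖ ^ 2 / (4 * t)) by ring]
  ring

lemma integrable_heat (hm : 1 ≤ m) {t : ℝ} (ht : 0 < t) : Integrable (heat t : Eu m → ℝ) := by
  simpa using integrable_norm_pow_mul_heat hm ht 0

lemma norm_heatDeriv_le (j : Fin m) {t : ℝ} (ht : 0 < t) (x : Eu m) :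
    ‖heatDeriv j t x‖ ≤ (2 * t)⁻¹ * (‖x‖ * heat t x) := by
  rw [heatDeriv, norm_mul, norm_neg, norm_div, Real.norm_of_nonneg (heat_nonneg ht x),
    Real.norm_of_nonneg (by positivity : 0 ≤ 2 * t)]
  have := PiLp.norm_apply_le x j
  have h0 := heat_nonneg ht x
  rw [div_mul_eq_mul_div, div_eq_inv_mul]
  gcongr

lemma integrable_heatDeriv (hm : 1 ≤ m) (j : Fin m) {t : ℝ} (ht : 0 < t) :
    Integrable (heatDeriv j t) := by
  have h := integrable_norm_pow_mul_heat hm ht 1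
  simp only [pow_one] at h
  exact Integrable.mono' (h.const_mul (2 * t)⁻¹) (continuous_heatDeriv j t).aestronglyMeasurable
    (Eventually.of_forall fun x => norm_heatDeriv_le j ht x)

lemma integral_heat {t : ℝ} (ht : 0 < t) : ∫ x : Eu m, heat t x = 1 := by
  have h := GaussianFourier.integral_rexp_neg_mul_sq_norm (V := Eu m) (b := 1 / (4 * t))
    (by positivity)
  simp only [heat, integral_const_mul]
  simp only [show ∀ x : Eu m, -(‖x‖ ^ 2 / (4 * t)) = -(1 / (4 * t)) * ‖x‖ ^ 2 from
    fun x => by ring, h, finrank_Eu]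
  rw [show Real.pi / (1 / (4 * t)) = 4 * Real.pi * t by field_simp,
    ← Real.rpow_add (by positivity), show -(m : ℝ) / 2 + m / 2 = 0 by ring, Real.rpow_zero]

lemma integral_eq_zero_of_odd {F : Type*} [NormedAddCommGroup F] [NormedSpace ℝ F] {f : Eu m → F}
    (h : ∀ x, f (-x) = -f x) : ∫ x, f x = 0 := by
  have h1 := integral_neg_eq_self f (volume : Measure (Eu m))
  simp only [h, integral_neg] at h1
  have h2 : (2 : ℝ) • ∫ x, f x = 0 := by
    rw [two_smul]
    nth_rw 1 [← h1]
    simp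
  simpa using h2

/-- The semigroup property of the heat kernel, differentiated once. -/
lemma integral_heat_mul_heatDeriv (hm : 1 ≤ m) (j : Fin m) {s t : ℝ} (hs : 0 < s) (ht : 0 < t)
    (z : Eu m) : ∫ y, heat t y * heatDeriv j s (z - y) = heatDeriv j (s + t) z := by
  -- Completing the square: the product of the two Gaussians in y is `heat (s + t) z` times a
  -- Gaussian of time τ centred at (t/(s+t)) z. After translation to that centre the linear factor
  -- splits into a constant, which produces `heatDeriv j (s + t) z`, and an odd part with integral
  -- zero.
  set τ : ℝ := s * t / (s + t) with hτ
  have hst : 0 < s + t := by positivity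
  have hτ0 : 0 < τ := by positivity
  have key : ∀ w : Eu m, heat t (w + (t / (s + t)) • z) *
      heatDeriv j s (z - (w + (t / (s + t)) • z)) =
      heatDeriv j (s + t) z * heat τ w +
        (heat (s + t) z / (2 * s)) * (w j * heat τ w) := by
    intro w
    have hz : z - (w + (t / (s + t)) • z) = (s / (s + t)) • z - w := by
      have : z = (s / (s + t)) • z + (t / (s + t)) • z := by
        rw [← add_smul, ← add_div, div_self hst.ne', one_smul]
      nth_rw 1 [this]
      abel
    have h1 : ‖w + (t / (s + t)) • z‖ ^ 2 = ‖w‖ ^ 2 + 2 * (t / (s + t)) * inner ℝ w z +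
        (t / (s + t)) ^ 2 * ‖z‖ ^ 2 := by
      rw [norm_add_sq_real, inner_smul_right, norm_smul, mul_pow, Real.norm_eq_abs, sq_abs]
      ring
    have h2 : ‖(s / (s + t)) • z - w‖ ^ 2 = ‖w‖ ^ 2 - 2 * (s / (s + t)) * inner ℝ w z +
        (s / (s + t)) ^ 2 * ‖z‖ ^ 2 := by
      rw [norm_sub_sq_real, inner_smul_left, norm_smul, mul_pow, Real.norm_eq_abs, sq_abs,
        real_inner_comm]
      simp
      ring
    have h3 : heat t (w + (t / (s + t)) • z) * heat s ((s / (s + t)) • z - w) =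
        heat (s + t) z * heat τ w := by
      simp only [heat, h1, h2]
      rw [mul_mul_mul_comm, ← Real.exp_add, ← Real.mul_rpow (by positivity) (by positivity)]
      symm
      rw [mul_mul_mul_comm, ← Real.exp_add, ← Real.mul_rpow (by positivity) (by positivity)]
      congr 2
      · rw [hτ]
        field_simp
      · rw [hτ]
        field_simp
        ring
    rw [hz, heatDeriv, heatDeriv]
    have h4 : ((s / (s + t)) • z - w) j = s / (s + t) * z j - w j := by simp
    rw [h4]
    calc _ = -((s / (s + t) * z j - w j) / (2 * s)) *
          (heat t (w + (t / (s + t)) • z) * heat s ((s / (s + t)) • z - w)) := by ring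
      _ = _ := by
          rw [h3]
          field_simp
          ring
  rw [← integral_add_right_eq_self _ ((t / (s + t)) • z)]
  simp only [key]
  have hodd : ∫ w : Eu m, w j * heat τ w = 0 :=
    integral_eq_zero_of_odd fun w => by simp [heat_neg]
  have hint : Integrable fun w : Eu m => w j * heat τ w := by
    have h := integrable_norm_pow_mul_heat hm hτ0 1
    simp only [pow_one] at h
    refine Integrable.mono' h ?_ (Eventually.of_forall fun w => ?_)
    · exact ((by fun_prop : Continuous fun w : Eu m => w j).mul
        (continuous_heat τ)).aestronglyMeasurable
    · rw [norm_mul, Real.norm_of_nonneg (heat_nonneg hτ0 w)]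
      exact mul_le_mul_of_nonneg_right (PiLp.norm_apply_le w j) (heat_nonneg hτ0 w)
  rw [integral_add ((integrable_heat hm hτ0).const_mul _) (hint.const_mul _), integral_const_mul,
    integral_const_mul, integral_heat hτ0, hodd]
  ring

/-- The pairing of `f` with `∂_j` of the heat kernel at time `u`. -/
def heatPair (j : Fin m) (u : ℝ) (f : Eu m → ℂ) : ℂ := ∫ x, (heatDeriv j u x : ℂ) * f x

lemma ofReal_heat {t : ℝ} (ht : 0 < t) (x : Eu m) : (heat t x : ℂ) =
    (4 * Real.pi : ℂ) ^ (-(m : ℂ) / 2) * (t : ℂ) ^ (-(m : ℂ) / 2) *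
      (Real.exp (-(‖x‖ ^ 2 / (4 * t))) : ℂ) := by
  rw [heat, Complex.ofReal_mul, Complex.ofReal_cpow (by positivity), Complex.ofReal_mul,
    Complex.mul_cpow_ofReal_nonneg (by positivity) ht.le]
  push_cast
  rfl

/-- The Gamma-free part of `coefK`. -/
def heatCoefK (m : ℕ) (β : ℂ) : ℂ :=
  (2 : ℂ) ^ (-2 * β) * Complex.Gamma (m / 2 - β) / (Real.pi : ℂ) ^ ((m : ℂ) / 2)

/-- The Gamma-free part of `coefL`. -/
def heatCoefL (m : ℕ) (β : ℂ) : ℂ :=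
  -((2 : ℂ) ^ (-2 * β) * Complex.Gamma ((m + 1) / 2 - β) / (Real.pi : ℂ) ^ ((m : ℂ) / 2))

lemma four_cpow (s : ℂ) : (4 : ℂ) ^ s = (2 : ℂ) ^ (2 * s) := by
  rw [two_mul, Complex.cpow_add _ _ two_ne_zero]
  have := Complex.mul_cpow_ofReal_nonneg (a := 2) (b := 2) (by norm_num) (by norm_num) s
  push_cast at this
  rw [← this]
  norm_num

lemma four_pi_cpow (s : ℂ) : (4 * Real.pi : ℂ) ^ s = (2 : ℂ) ^ (2 * s) * (Real.pi : ℂ) ^ s := by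
  have := Complex.mul_cpow_ofReal_nonneg (a := 4) (b := Real.pi) (by norm_num) Real.pi_pos.le s
  push_cast at this
  rw [this, four_cpow]

/-- The case a = m/2 - β of `gauss_superposition`; the factor t^(-m/2) of the heat kernel accounts
for the shift. Divided by Γ(β), it expresses K_β as Γ(β)⁻¹ ∫ t^(β-1) p_t dt. -/
lemma heat_superposition (hm : 1 ≤ m) {β : ℂ} (hβ : β.re < m / 2) {f : Eu m → ℂ}
    (hf : AEStronglyMeasurable f) (hi : Integrable fun x => ‖x‖ ^ (-m + 2 * β.re) * ‖f x‖) :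
    IntegrableOn (fun t : ℝ => (t : ℂ) ^ (β - 1) * ∫ x, (heat t x : ℂ) * f x) (Ioi 0) ∧
    ∫ t in Ioi (0 : ℝ), (t : ℂ) ^ (β - 1) * ∫ x, (heat t x : ℂ) * f x =
      heatCoefK m β * ∫ x, (‖x‖ : ℂ) ^ (-m + 2 * β) * f x := by
  have ha : 0 < ((m : ℂ) / 2 - β).re := by simp; linarith
  have hre : -2 * ((m : ℂ) / 2 - β).re = -m + 2 * β.re := by simp; ring
  have h := gauss_superposition hm ha hf (by rw [hre]; exact hi)
  have h1 : ∀ t ∈ Ioi (0 : ℝ), (t : ℂ) ^ (β - 1) * ∫ x, (heat t x : ℂ) * f x =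
      (4 * Real.pi : ℂ) ^ (-(m : ℂ) / 2) * ((t : ℂ) ^ (-((m : ℂ) / 2 - β) - 1) *
        ∫ x, (Real.exp (-(‖x‖ ^ 2 / (4 * t))) : ℂ) * f x) := by
    intro t ht
    have ht' : (t : ℂ) ≠ 0 := Complex.ofReal_ne_zero.2 (ne_of_gt ht)
    simp only [ofReal_heat ht, mul_assoc, integral_const_mul]
    rw [show -((m : ℂ) / 2 - β) - 1 = -(m : ℂ) / 2 + (β - 1) by ring, Complex.cpow_add _ _ ht']
    ring
  constructor
  · exact IntegrableOn.congr_fun (h.1.const_mul _) (fun t ht => (h1 t ht).symm) measurableSet_Ioi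
  · rw [setIntegral_congr_fun measurableSet_Ioi h1, integral_const_mul, h.2, four_pi_cpow,
      four_cpow, heatCoefK, show -2 * ((m : ℂ) / 2 - β) = -m + 2 * β by ring,
      show 2 * (-(m : ℂ) / 2) = -m by ring, show 2 * ((m : ℂ) / 2 - β) = m + -2 * β by ring,
      Complex.cpow_add _ _ two_ne_zero, show -(m : ℂ) / 2 = -((m : ℂ) / 2) by ring,
      Complex.cpow_neg, Complex.cpow_neg]
    have : (2 : ℂ) ^ (m : ℂ) ≠ 0 := by simp
    field_simp

lemma heatPair_eq_odd (hm : 1 ≤ m) (j : Fin m) {u : ℝ} (hu : 0 < u) {f : Eu m → ℂ}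
    (hf : AEStronglyMeasurable f) {C : ℝ} (hC : ∀ x, ‖f x‖ ≤ C) :
    heatPair j u f = 1 / 2 * ∫ x, (heatDeriv j u x : ℂ) * (f x - f (-x)) := by
  have h1 : Integrable fun x => (heatDeriv j u x : ℂ) * f x :=
    (integrable_heatDeriv hm j hu).ofReal.mul_bdd hf (Eventually.of_forall hC)
  have h2 := integral_neg_eq_self (fun x => (heatDeriv j u x : ℂ) * f x) (volume : Measure (Eu m))
  have h3 := h1.comp_neg
  simp only [heatDeriv_neg] at h2 h3
  push_cast at h2 h3
  simp only [neg_mul, integral_neg] at h2 h3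
  have h4 := h3.neg
  simp only [Pi.neg_def, neg_neg] at h4
  simp only [mul_sub]
  rw [integral_sub h1 h4, heatPair]
  linear_combination (-1 / 2 : ℂ) * h2

/-- The derivative of the heat kernel brings the factor -x_j/(2u), so now a = (m+1)/2 - β. As
u^(β-1/2) = u^((β+1/2)-1), division by Γ(β+1/2) gives ∂_j (-Δ)^(-β-1/2). The function f need only be
bounded and measurable, since the lemma is also applied to a heat flow. -/
lemma heatPair_superposition (hm : 1 ≤ m) (j : Fin m) {β : ℂ} (hβ : β.re < (m + 1) / 2)
    {f : Eu m → ℂ} (hf : AEStronglyMeasurable f) {C : ℝ} (hC : ∀ x, ‖f x‖ ≤ C)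
    (hi : Integrable fun x : Eu m => (‖x‖ : ℂ) ^ (-m + 2 * β - 1) * x j * (f x - f (-x))) :
    IntegrableOn (fun u : ℝ => (u : ℂ) ^ (β - 1 / 2) * heatPair j u f) (Ioi 0) ∧
    ∫ u in Ioi (0 : ℝ), (u : ℂ) ^ (β - 1 / 2) * heatPair j u f =
      heatCoefL m β * (1 / 2 * ∫ x : Eu m, (‖x‖ : ℂ) ^ (-m + 2 * β - 1) * x j * (f x - f (-x))) := by
  have ha : 0 < (((m : ℂ) + 1) / 2 - β).re := by simp; linarith
  have hre : -2 * (((m : ℂ) + 1) / 2 - β).re = (-m + 2 * β - 1 : ℂ).re := by simp; ring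
  set g : Eu m → ℂ := fun x => (x j : ℂ) * (f x - f (-x)) with hg
  have hgm : AEStronglyMeasurable g :=
    (by fun_prop : Continuous fun x : Eu m => (x j : ℂ)).aestronglyMeasurable.mul
      (hf.sub (hf.comp_quasiMeasurePreserving
        (Measure.measurePreserving_neg (volume : Measure (Eu m))).quasiMeasurePreserving))
  have h := gauss_superposition hm ha hgm (by
    refine hi.norm.congr ?_
    filter_upwards [ae_ne_zero hm] with x hx
    rw [hre, hg, mul_assoc, norm_mul, norm_cpow_norm_le _ hx])
  have h1 : ∀ u ∈ Ioi (0 : ℝ), (u : ℂ) ^ (β - 1 / 2) * heatPair j u f =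
      (-(1 / 4) * (4 * Real.pi : ℂ) ^ (-(m : ℂ) / 2)) *
        ((u : ℂ) ^ (-(((m : ℂ) + 1) / 2 - β) - 1) *
        ∫ x, (Real.exp (-(‖x‖ ^ 2 / (4 * u))) : ℂ) * g x) := by
    intro u hu
    have hu' : (u : ℂ) ≠ 0 := Complex.ofReal_ne_zero.2 (ne_of_gt hu)
    rw [heatPair_eq_odd hm j hu hf hC]
    have h2 : ∀ x : Eu m, (heatDeriv j u x : ℂ) * (f x - f (-x)) =
        (-(1 / 2) * (u : ℂ)⁻¹ * (4 * Real.pi : ℂ) ^ (-(m : ℂ) / 2) * (u : ℂ) ^ (-(m : ℂ) / 2)) *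
          ((Real.exp (-(‖x‖ ^ 2 / (4 * u))) : ℂ) * g x) := by
      intro x
      rw [heatDeriv, Complex.ofReal_mul, ofReal_heat hu]
      push_cast
      ring
    simp only [h2, integral_const_mul]
    rw [show -(((m : ℂ) + 1) / 2 - β) - 1 = -(m : ℂ) / 2 + (β - 1 / 2) - 1 by ring]
    generalize β - 1 / 2 = γ
    rw [Complex.cpow_sub _ _ hu', Complex.cpow_add _ _ hu', Complex.cpow_one]
    ring
  constructor
  · exact IntegrableOn.congr_fun (h.1.const_mul _) (fun t ht => (h1 t ht).symm) measurableSet_Ioi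
  · rw [setIntegral_congr_fun measurableSet_Ioi h1, integral_const_mul, h.2, four_pi_cpow,
      four_cpow, heatCoefL, show -2 * (((m : ℂ) + 1) / 2 - β) = -m + 2 * β - 1 by ring,
      show 2 * (-(m : ℂ) / 2) = -m by ring,
      show 2 * (((m : ℂ) + 1) / 2 - β) = m + -2 * β + 1 by ring,
      Complex.cpow_add _ _ two_ne_zero, Complex.cpow_add _ _ two_ne_zero, Complex.cpow_one,
      show -(m : ℂ) / 2 = -((m : ℂ) / 2) by ring,
      Complex.cpow_neg, Complex.cpow_neg]
    have : (2 : ℂ) ^ (m : ℂ) ≠ 0 := by simp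
    simp only [hg, mul_assoc]
    field_simp
    ring

/-- The kernel `x_j / |x|^(m+1)`. -/
def rieszKernel (j : Fin m) (x : Eu m) : ℝ := ‖x‖ ^ (-(m : ℝ) - 1) * x j

lemma measurable_rieszKernel (j : Fin m) : Measurable (rieszKernel j) := by
  unfold rieszKernel; fun_prop

lemma norm_rieszKernel_le (j : Fin m) {x : Eu m} (hx : x ≠ 0) :
    ‖rieszKernel j x‖ ≤ ‖x‖ ^ (-(m : ℝ)) := by
  have hx' : 0 < ‖x‖ := norm_pos_iff.2 hx
  rw [rieszKernel, norm_mul, Real.norm_of_nonneg (by positivity)]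
  calc _ ≤ ‖x‖ ^ (-(m : ℝ) - 1) * ‖x‖ ^ (1 : ℝ) := by
        rw [Real.rpow_one]
        gcongr
        exact PiLp.norm_apply_le x j
    _ = _ := by rw [← Real.rpow_add hx']; ring_nf

lemma rieszKernel_neg (j : Fin m) (x : Eu m) : rieszKernel j (-x) = -rieszKernel j x := by
  simp [rieszKernel]

lemma ofReal_rieszKernel (j : Fin m) (x : Eu m) :
    (rieszKernel j x : ℂ) = (‖x‖ : ℂ) ^ (-(m : ℂ) - 1) * x j := by
  rw [rieszKernel, Complex.ofReal_mul, Complex.ofReal_cpow (norm_nonneg x)]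
  push_cast
  rfl

/-! ### Principal value convolution of a Schwartz function with x_j/|x|^(m+1). -/

section PV

variable {F : Type} [NormedAddCommGroup F] [NormedSpace ℝ F]

lemma exists_rieszKernel_bound (hm : 1 ≤ m) (j : Fin m) (φ : 𝓢(Eu m, F)) :
    ∃ B : Eu m → ℝ, Integrable B ∧ (∀ x, 0 ≤ B x) ∧ ∀ y, ∀ᵐ x, ‖rieszKernel j x •
      (φ (y + x) - φ (y - x))‖ ≤ (1 + ‖y‖) ^ 2 * B x := by
  obtain ⟨C, hC, h⟩ := exists_schwartz_odd_bound φ 2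
  refine ⟨fun x => C * (‖x‖ ^ (1 - (m : ℝ)) * ((1 + ‖x‖) ^ 2)⁻¹),
    (integrable_rpow_mul hm (by linarith) (by push_cast; linarith)).const_mul C,
    fun x => by positivity, fun y => ?_⟩
  filter_upwards [ae_ne_zero hm] with x hx
  have hx' : 0 < ‖x‖ := norm_pos_iff.2 hx
  rw [norm_smul]
  calc _ ≤ ‖x‖ ^ (-(m : ℝ)) * (C * (1 + ‖y‖) ^ 2 * (‖x‖ * ((1 + ‖x‖) ^ 2)⁻¹)) := by
        gcongr
        · exact norm_rieszKernel_le j hx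
        · exact h y x
    _ = _ := by
        rw [show 1 - (m : ℝ) = -(m : ℝ) + 1 by ring, Real.rpow_add hx', Real.rpow_one]
        ring

lemma aestronglyMeasurable_rieszKernel_smul (j : Fin m) (φ : 𝓢(Eu m, F)) (y : Eu m) :
    AEStronglyMeasurable (fun x => rieszKernel j x • (φ (y + x) - φ (y - x))) := by
  refine (measurable_rieszKernel j).aestronglyMeasurable.smul ?_
  have h : Continuous fun x => φ (y + x) - φ (y - x) :=
    (φ.continuous.comp (by fun_prop)).sub (φ.continuous.comp (by fun_prop))
  exact h.aestronglyMeasurable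

lemma integrable_rieszKernel_smul (hm : 1 ≤ m) (j : Fin m) (φ : 𝓢(Eu m, F)) (y : Eu m) :
    Integrable fun x => rieszKernel j x • (φ (y + x) - φ (y - x)) := by
  obtain ⟨B, hB, -, h⟩ := exists_rieszKernel_bound hm j φ
  exact Integrable.mono' (hB.const_mul _) (aestronglyMeasurable_rieszKernel_smul j φ y) (h y)

/-- The convolution of the principal value distribution `x_j / |x|^(m+1)` with a Schwartz function,
up to reflection: `y ↦ Pv ∫ x_j / |x|^(m+1) φ(x + y) dx`. -/
def pvConv (j : Fin m) (φ : 𝓢(Eu m, F)) (y : Eu m) : F :=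
  (1 / 2 : ℝ) • ∫ x, rieszKernel j x • (φ (y + x) - φ (y - x))

/-- The derivative falls on φ and yields the same operator applied to the Schwartz function φ',
whose values are linear maps. For this reason `pvConv` allows vector values; smoothness of every
order then follows by induction over all target spaces at once. -/
lemma hasFDerivAt_pvConv (hm : 1 ≤ m) (j : Fin m) (φ : 𝓢(Eu m, F)) (y₀ : Eu m) :
    HasFDerivAt (pvConv j φ) (pvConv j (SchwartzMap.fderivCLM ℝ (Eu m) F φ) y₀) y₀ := by
  obtain ⟨B, hB, hB0⟩ := exists_schwartz_odd_bound (SchwartzMap.fderivCLM ℝ (Eu m) F φ) 2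
  set ψ := SchwartzMap.fderivCLM ℝ (Eu m) F φ with hψ
  unfold pvConv
  refine HasFDerivAt.const_smul ?_ _
  refine hasFDerivAt_integral_of_dominated_of_fderiv_le (s := Metric.ball y₀ 1)
    (F := fun y x => rieszKernel j x • (φ (y + x) - φ (y - x)))
    (F' := fun y x => rieszKernel j x • (ψ (y + x) - ψ (y - x)))
    (bound := fun x => (2 + ‖y₀‖) ^ 2 * (B * (‖x‖ ^ (1 - (m : ℝ)) * ((1 + ‖x‖) ^ 2)⁻¹)))
    (Metric.ball_mem_nhds y₀ one_pos)
    (Eventually.of_forall fun y => aestronglyMeasurable_rieszKernel_smul j φ y)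
    (integrable_rieszKernel_smul hm j φ y₀) (aestronglyMeasurable_rieszKernel_smul j ψ y₀) ?_
    (((integrable_rpow_mul hm (by linarith) (by push_cast; linarith)).const_mul B).const_mul _) ?_
  · filter_upwards [ae_ne_zero hm] with x hx y hy
    have hx' : 0 < ‖x‖ := norm_pos_iff.2 hx
    have hy' : ‖y‖ ≤ 1 + ‖y₀‖ := by
      have h1 := norm_sub_norm_le y y₀
      rw [Metric.mem_ball, dist_eq_norm] at hy
      linarith
    rw [norm_smul]
    calc _ ≤ ‖x‖ ^ (-(m : ℝ)) * (B * (2 + ‖y₀‖) ^ 2 * (‖x‖ * ((1 + ‖x‖) ^ 2)⁻¹)) := by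
          gcongr
          · exact norm_rieszKernel_le j hx
          · have hy2 : (1 + ‖y‖) ^ 2 ≤ (2 + ‖y₀‖) ^ 2 :=
              pow_le_pow_left₀ (by positivity) (by linarith) 2
            exact (hB0 y x).trans
              (mul_le_mul_of_nonneg_right (mul_le_mul_of_nonneg_left hy2 hB) (by positivity))
      _ = _ := by
          rw [show 1 - (m : ℝ) = -(m : ℝ) + 1 by ring, Real.rpow_add hx', Real.rpow_one]
          ring
  · refine Eventually.of_forall fun x y _ => ?_
    refine HasFDerivAt.const_smul ?_ _
    have h1 : HasFDerivAt (fun y => φ (y + x)) (ψ (y + x)) y := by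
      have := (φ.hasFDerivAt (y + x)).comp y ((hasFDerivAt_id y).add_const x)
      simpa [Function.comp_def, hψ] using! this
    have h2 : HasFDerivAt (fun y => φ (y - x)) (ψ (y - x)) y := by
      have := (φ.hasFDerivAt (y - x)).comp y ((hasFDerivAt_id y).sub_const x)
      simpa [Function.comp_def, hψ] using! this
    exact h1.sub h2

end PV

lemma contDiff_pvConv_nat (hm : 1 ≤ m) (j : Fin m) (n : ℕ) :
    ∀ {F : Type} [NormedAddCommGroup F] [NormedSpace ℝ F] (φ : 𝓢(Eu m, F)),
      ContDiff ℝ n (pvConv j φ) := by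
  induction n with
  | zero =>
    intro F _ _ φ
    refine contDiff_zero.2 (continuous_iff_continuousAt.2 fun y => ?_)
    exact (hasFDerivAt_pvConv hm j φ y).continuousAt
  | succ n ih =>
    intro F _ _ φ
    rw [Nat.cast_succ, contDiff_succ_iff_hasFDerivAt]
    exact ⟨pvConv j (SchwartzMap.fderivCLM ℝ (Eu m) F φ), ih _, hasFDerivAt_pvConv hm j φ⟩

lemma contDiff_pvConv (hm : 1 ≤ m) (j : Fin m) (φ : 𝓢(Eu m, ℂ)) :
    ContDiff ℝ ((⊤ : ℕ∞) : WithTop ℕ∞) (pvConv j φ) :=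
  contDiff_infty.2 fun n => contDiff_pvConv_nat hm j n φ

lemma continuous_pvConv (hm : 1 ≤ m) (j : Fin m) (φ : 𝓢(Eu m, ℂ)) : Continuous (pvConv j φ) :=
  (contDiff_pvConv hm j φ).continuous

lemma pvConv_eq_Ucomp (hm : 1 ≤ m) (j : Fin m) (φ : 𝓢(Eu m, ℂ)) (y : Eu m) :
    Ucomp m j (-m) (SchwartzMap.compSubConstCLM ℂ (-y) φ) = pvConv j φ y := by
  rw [Ucomp_eq_integral hm j (by simp), pvConv, Complex.real_smul]
  congr 1
  · norm_num
  · refine integral_congr_ae (Eventually.of_forall fun x => ?_)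
    simp only [SchwartzMap.compSubConstCLM_apply, sub_neg_eq_add, Complex.real_smul,
      ofReal_rieszKernel]
    rw [add_comm x y, neg_add_eq_sub]

/-! ### The identity in the convergent range -/

/-- The beta integral as a convolution identity on the half line. -/
lemma integral_shift_beta {β : ℂ} (hβ : 0 < β.re) {f : ℝ → ℂ}
    (hf : IntegrableOn (fun u : ℝ => (u : ℂ) ^ (β - 1 / 2) * f u) (Ioi 0)) :
    ∫ t in Ioi (0 : ℝ), (t : ℂ) ^ (β - 1) *
      ∫ s in Ioi (0 : ℝ), (s : ℂ) ^ (-(1 / 2) : ℂ) * f (s + t) =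
    Complex.betaIntegral β (1 / 2) * ∫ u in Ioi (0 : ℝ), (u : ℂ) ^ (β - 1 / 2) * f u := by
  -- Measurability of f itself is recovered by multiplying with the inverse power, which is finite
  -- and nonzero for u > 0.
  have hfm : AEStronglyMeasurable f (volume.restrict (Ioi (0 : ℝ))) := by
    have h1 : AEStronglyMeasurable (fun u : ℝ => (u : ℂ) ^ (-(β - 1 / 2)) *
        ((u : ℂ) ^ (β - 1 / 2) * f u)) (volume.restrict (Ioi (0 : ℝ))) :=
      (by fun_prop : Measurable fun u : ℝ => (u : ℂ) ^ (-(β - 1 / 2))).aestronglyMeasurable.mul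
        hf.aestronglyMeasurable
    refine h1.congr ((ae_restrict_iff' measurableSet_Ioi).2 (Eventually.of_forall fun u hu => ?_))
    have hu' : (u : ℂ) ≠ 0 := Complex.ofReal_ne_zero.2 (ne_of_gt hu)
    simp only
    rw [← mul_assoc, ← Complex.cpow_add _ _ hu', neg_add_cancel, Complex.cpow_zero, one_mul]
  -- The kernel of the double integral after the substitution u = s + t: it lives on 0 < t < u, and
  -- its integral over t is a scaled beta integral.
  set κ : ℂ → ℝ → ℝ → ℂ := fun b u t => (Ioo 0 u).indicator
    (fun t : ℝ => (t : ℂ) ^ (b - 1) * ((u : ℂ) - t) ^ ((1 / 2 : ℂ) - 1)) t with hκ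
  have hκint : ∀ b : ℂ, 0 < b.re → ∀ u : ℝ, 0 < u → Integrable (κ b u) := by
    intro b hb u hu
    have h1 := (Complex.betaIntegral_convergent (u := b) (v := 1 / 2) hb (by norm_num)).comp_mul_left
      (c := u⁻¹)
    have hu' : (u : ℂ) ≠ 0 := Complex.ofReal_ne_zero.2 hu.ne'
    simp only [zero_div, one_div, inv_inv] at h1
    rw [intervalIntegrable_iff_integrableOn_Ioo_of_le hu.le] at h1
    simp only [hκ]
    rw [integrable_indicator_iff measurableSet_Ioo]
    refine IntegrableOn.congr_fun (h1.const_mul ((u : ℂ) ^ (b - 1) * (u : ℂ) ^ ((1 / 2 : ℂ) - 1)))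
      (fun t ht => ?_) measurableSet_Ioo
    have ha : (t : ℂ) = u * ((u⁻¹ * t : ℝ) : ℂ) := by
      push_cast; field_simp
    have hb' : (u : ℂ) - t = u * ((1 - u⁻¹ * t : ℝ) : ℂ) := by
      push_cast; field_simp
    have hpos : 0 ≤ u⁻¹ * t := mul_nonneg (inv_nonneg.2 hu.le) ht.1.le
    have hpos2 : 0 ≤ 1 - u⁻¹ * t := by
      rw [sub_nonneg, inv_mul_le_iff₀ hu, mul_one]
      exact ht.2.le
    rw [hb', show (t : ℂ) ^ (b - 1) = ((u : ℂ) * ((u⁻¹ * t : ℝ) : ℂ)) ^ (b - 1) by rw [← ha],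
      Complex.mul_cpow_ofReal_nonneg hu.le hpos, Complex.mul_cpow_ofReal_nonneg hu.le hpos2]
    push_cast
    norm_num
    ring
  have hκval : ∀ b : ℂ, ∀ u : ℝ, 0 < u →
      ∫ t, κ b u t = (u : ℂ) ^ (b - 1 / 2) * Complex.betaIntegral b (1 / 2) := by
    intro b u hu
    have := Complex.betaIntegral_scaled b (1 / 2) hu
    simp only [hκ]
    rw [integral_indicator measurableSet_Ioo, ← integral_Ioc_eq_integral_Ioo,
      ← intervalIntegral.integral_of_le hu.le, this]
    congr 2
    ring
  have hκnorm : ∀ u : ℝ, 0 < u → ∫ t, ‖κ β u t‖ =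
      u ^ (β.re - 1 / 2) * ‖Complex.betaIntegral (β.re : ℂ) (1 / 2)‖ := by
    intro u hu
    -- Taking norms replaces β by Re β, so absolute convergence is again governed by a beta
    -- integral.
    have h1 : ∀ t, (‖κ β u t‖ : ℂ) = κ β.re u t := by
      intro t
      simp only [hκ]
      by_cases ht : t ∈ Ioo 0 u
      · rw [indicator_of_mem ht, indicator_of_mem ht, norm_mul,
          Complex.norm_cpow_eq_rpow_re_of_pos ht.1, ← Complex.ofReal_sub,
          Complex.norm_cpow_eq_rpow_re_of_pos (sub_pos.2 ht.2), Complex.ofReal_mul,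
          Complex.ofReal_cpow ht.1.le, Complex.ofReal_cpow (sub_pos.2 ht.2).le]
        norm_num
      · rw [indicator_of_notMem ht, indicator_of_notMem ht]
        simp
    have h2 : ((∫ t, ‖κ β u t‖ : ℝ) : ℂ) = (u : ℂ) ^ ((β.re : ℂ) - 1 / 2) *
        Complex.betaIntegral β.re (1 / 2) := by
      rw [← integral_complex_ofReal, ← hκval _ u hu]
      simp only [h1]
    have h3 : ‖((∫ t, ‖κ β u t‖ : ℝ) : ℂ)‖ = ∫ t, ‖κ β u t‖ := by
      rw [Complex.norm_real, Real.norm_of_nonneg (integral_nonneg fun t => norm_nonneg _)]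
    rw [← h3, h2, norm_mul, Complex.norm_cpow_eq_rpow_re_of_pos hu]
    norm_num
  set G : ℝ × ℝ → ℂ := fun p => κ β p.1 p.2 * f p.1 with hG
  have hGm : AEStronglyMeasurable G ((volume.restrict (Ioi (0 : ℝ))).prod volume) := by
    refine AEStronglyMeasurable.mul ?_ hfm.comp_fst
    have h1 : Measurable fun p : ℝ × ℝ => {q : ℝ × ℝ | 0 < q.2 ∧ q.2 < q.1}.indicator
        (fun q : ℝ × ℝ => (q.2 : ℂ) ^ (β - 1) * ((q.1 : ℂ) - q.2) ^ ((1 / 2 : ℂ) - 1)) p := by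
      refine Measurable.indicator (by fun_prop) ?_
      exact (measurableSet_lt measurable_const measurable_snd).inter
        (measurableSet_lt measurable_snd measurable_fst)
    exact h1.aestronglyMeasurable
  have hGi : Integrable G ((volume.restrict (Ioi (0 : ℝ))).prod volume) := by
    rw [integrable_prod_iff hGm]
    constructor
    · refine (ae_restrict_iff' measurableSet_Ioi).2 (Eventually.of_forall fun u hu => ?_)
      exact (hκint β hβ u hu).mul_const (f u)
    · refine IntegrableOn.congr_fun
        (hf.norm.const_mul ‖Complex.betaIntegral (β.re : ℂ) (1 / 2)‖) (fun u hu => ?_)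
        measurableSet_Ioi
      simp only [hG, norm_mul]
      rw [integral_mul_const, hκnorm u hu, Complex.norm_cpow_eq_rpow_re_of_pos hu]
      norm_num
      ring
  have hL : ∫ u in Ioi (0 : ℝ), ∫ t, G (u, t) =
      Complex.betaIntegral β (1 / 2) * ∫ u in Ioi (0 : ℝ), (u : ℂ) ^ (β - 1 / 2) * f u := by
    rw [← integral_const_mul]
    refine setIntegral_congr_fun measurableSet_Ioi fun u hu => ?_
    simp only [hG]
    rw [integral_mul_const, hκval β u hu]
    ring
  have hR : ∀ t : ℝ, ∫ u in Ioi (0 : ℝ), G (u, t) = (Ioi (0 : ℝ)).indicator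
      (fun t : ℝ => (t : ℂ) ^ (β - 1) *
        ∫ s in Ioi (0 : ℝ), (s : ℂ) ^ (-(1 / 2) : ℂ) * f (s + t)) t := by
    intro t
    by_cases ht : 0 < t
    · rw [indicator_of_mem (show t ∈ Ioi (0 : ℝ) from ht), ← integral_const_mul,
        ← integral_indicator measurableSet_Ioi, ← integral_indicator measurableSet_Ioi,
        ← integral_add_right_eq_self _ t]
      congr 1
      ext s
      by_cases hs : 0 < s
      · rw [indicator_of_mem (show s + t ∈ Ioi (0 : ℝ) by simp; linarith),
          indicator_of_mem (show s ∈ Ioi (0 : ℝ) from hs)]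
        simp only [hG, hκ]
        rw [indicator_of_mem (show t ∈ Ioo 0 (s + t) from ⟨ht, by linarith⟩)]
        push_cast
        rw [add_sub_cancel_right, show (1 / 2 : ℂ) - 1 = -(1 / 2) by norm_num, mul_assoc]
      · rw [indicator_of_notMem (show s ∉ Ioi (0 : ℝ) from hs)]
        by_cases hst : s + t ∈ Ioi (0 : ℝ)
        · rw [indicator_of_mem hst]
          simp only [hG, hκ]
          rw [indicator_of_notMem (fun h : t ∈ Ioo 0 (s + t) => by
            have := h.2
            linarith), zero_mul]
        · rw [indicator_of_notMem hst]
    · rw [indicator_of_notMem (show t ∉ Ioi (0 : ℝ) from ht)]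
      simp only [hG, hκ]
      rw [← integral_zero ℝ ℂ (μ := volume.restrict (Ioi (0 : ℝ)))]
      congr 1
      ext u
      rw [indicator_of_notMem (fun h : t ∈ Ioo 0 u => ht h.1), zero_mul]
  rw [← hL, integral_integral_swap (f := fun u t => G (u, t)) hGi]
  simp only [hR]
  rw [integral_indicator measurableSet_Ioi]

lemma exists_norm_le_of_schwartz (φ : 𝓢(Eu m, ℂ)) : ∃ C : ℝ, 0 ≤ C ∧ ∀ x, ‖φ x‖ ≤ C := by
  obtain ⟨C, hC, h, -⟩ := exists_schwartz_decay φ 0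
  exact ⟨C, hC, fun x => by simpa using h x⟩

/-- The solution of the heat equation with initial value `φ`. -/
def heatFlow (t : ℝ) (φ : Eu m → ℂ) (x : Eu m) : ℂ := ∫ y, (heat t y : ℂ) * φ (x + y)

lemma integrable_heat_mul (hm : 1 ≤ m) {t : ℝ} (ht : 0 < t) (φ : 𝓢(Eu m, ℂ)) (x : Eu m) :
    Integrable fun y => (heat t y : ℂ) * φ (x + y) := by
  obtain ⟨C, -, hC⟩ := exists_norm_le_of_schwartz φ
  exact (integrable_heat hm ht).ofReal.mul_bdd
    (φ.continuous.comp (continuous_const.add continuous_id)).aestronglyMeasurable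
    (Eventually.of_forall fun y => hC _)

lemma norm_heatFlow_le (hm : 1 ≤ m) {t : ℝ} (ht : 0 < t) {φ : 𝓢(Eu m, ℂ)} {C : ℝ}
    (hC : ∀ x, ‖φ x‖ ≤ C) (x : Eu m) : ‖heatFlow t φ x‖ ≤ C := by
  have h : ‖heatFlow t φ x‖ ≤ ∫ y : Eu m, heat t y * C := by
    refine norm_integral_le_of_norm_le ((integrable_heat hm ht).mul_const C)
      (Eventually.of_forall fun y => ?_)
    rw [norm_mul, Complex.norm_real, Real.norm_of_nonneg (heat_nonneg ht y)]
    exact mul_le_mul_of_nonneg_left (hC _) (heat_nonneg ht y)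
  rwa [integral_mul_const, integral_heat ht, one_mul] at h

lemma aestronglyMeasurable_heatFlow (t : ℝ) (φ : 𝓢(Eu m, ℂ)) :
    AEStronglyMeasurable (heatFlow t φ) := by
  have h : Continuous (Function.uncurry fun x y : Eu m => (heat t y : ℂ) * φ (x + y)) :=
    (Complex.continuous_ofReal.comp ((continuous_heat t).comp continuous_snd)).mul
      (φ.continuous.comp (continuous_fst.add continuous_snd))
  exact (h.stronglyMeasurable.integral_prod_right).aestronglyMeasurable

/-- Fubini moves the heat flow from φ to the kernel, where the differentiated semigroup identity
applies. -/
lemma heatPair_heatFlow (hm : 1 ≤ m) (j : Fin m) {s t : ℝ} (hs : 0 < s) (ht : 0 < t)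
    (φ : 𝓢(Eu m, ℂ)) : heatPair j s (heatFlow t φ) = heatPair j (s + t) φ := by
  obtain ⟨C, -, hC⟩ := exists_norm_le_of_schwartz φ
  have h1 : Integrable (fun p : Eu m × Eu m =>
      ((heatDeriv j s p.1 : ℂ) * heat t p.2) * φ (p.1 + p.2)) (volume.prod volume) :=
    (Integrable.mul_prod (integrable_heatDeriv hm j hs).ofReal
      (integrable_heat hm ht).ofReal).mul_bdd
      (φ.continuous.comp (continuous_fst.add continuous_snd)).aestronglyMeasurable
      (Eventually.of_forall fun y => hC _)
  have h2 : Integrable (fun p : Eu m × Eu m =>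
      ((heat t p.2 : ℂ) * heatDeriv j s (p.1 - p.2)) * φ p.1) (volume.prod volume) :=
    ((integrable_heat hm ht).ofReal.convolution_integrand (ContinuousLinearMap.mul ℂ ℂ)
      (integrable_heatDeriv hm j hs).ofReal).mul_bdd
      (φ.continuous.comp continuous_fst).aestronglyMeasurable
      (Eventually.of_forall fun y => hC _)
  calc heatPair j s (heatFlow t φ)
      = ∫ x, ∫ y, ((heatDeriv j s x : ℂ) * heat t y) * φ (x + y) := by
        unfold heatPair heatFlow
        simp only [← integral_const_mul, mul_assoc]
    _ = ∫ y, ∫ x, ((heatDeriv j s x : ℂ) * heat t y) * φ (x + y) := integral_integral_swap h1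
    _ = ∫ y, ∫ x, ((heat t y : ℂ) * heatDeriv j s (x - y)) * φ x := by
        refine integral_congr_ae (Eventually.of_forall fun y => ?_)
        dsimp only
        rw [← integral_sub_right_eq_self _ y]
        refine integral_congr_ae (Eventually.of_forall fun x => ?_)
        simp only [sub_add_cancel]
        ring
    _ = ∫ x, ∫ y, ((heat t y : ℂ) * heatDeriv j s (x - y)) * φ x :=
        (integral_integral_swap h2).symm
    _ = _ := by
        unfold heatPair
        refine integral_congr_ae (Eventually.of_forall fun x => ?_)
        dsimp only
        rw [integral_mul_const, ← integral_heat_mul_heatDeriv hm j hs ht x, ← integral_complex_ofReal]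
        push_cast
        rfl

/-- The bound for the singular integrand grows only like (1 + |y|)² in y, which the Gaussian
absorbs. -/
lemma integrable_heat_mul_pvConv_integrand (hm : 1 ≤ m) (j : Fin m) {t : ℝ} (ht : 0 < t)
    (φ : 𝓢(Eu m, ℂ)) :
    Integrable (fun p : Eu m × Eu m => (heat t p.1 : ℂ) *
      ((rieszKernel j p.2 : ℂ) * (φ (p.1 + p.2) - φ (p.1 - p.2)))) (volume.prod volume) := by
  obtain ⟨B, hB, hB0, h⟩ := exists_rieszKernel_bound hm j φ
  have hh : Integrable fun y : Eu m => (1 + ‖y‖) ^ 2 * heat t y := by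
    have h0 := integrable_norm_pow_mul_heat hm ht (m := m) 0
    have h1 := (integrable_norm_pow_mul_heat hm ht (m := m) 1).const_mul 2
    have h2 := integrable_norm_pow_mul_heat hm ht (m := m) 2
    refine ((h0.add h1).add h2).congr (Eventually.of_forall fun y => ?_)
    simp only [Pi.add_apply]
    ring
  have hmeas : AEStronglyMeasurable (fun p : Eu m × Eu m => (heat t p.1 : ℂ) *
      ((rieszKernel j p.2 : ℂ) * (φ (p.1 + p.2) - φ (p.1 - p.2)))) (volume.prod volume) := by
    refine AEStronglyMeasurable.mul ?_ (AEStronglyMeasurable.mul ?_ ?_)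
    · exact (Complex.continuous_ofReal.comp
        ((continuous_heat t).comp continuous_fst)).aestronglyMeasurable
    · exact (Complex.measurable_ofReal.comp
        ((measurable_rieszKernel j).comp measurable_snd)).aestronglyMeasurable
    · exact ((φ.continuous.comp (continuous_fst.add continuous_snd)).sub
        (φ.continuous.comp (continuous_fst.sub continuous_snd))).aestronglyMeasurable
  have hb : ∀ y, ∀ᵐ x, ‖(heat t y : ℂ) * ((rieszKernel j x : ℂ) * (φ (y + x) - φ (y - x)))‖ ≤
      (1 + ‖y‖) ^ 2 * heat t y * B x := by
    intro y
    filter_upwards [h y] with x hx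
    rw [norm_mul, Complex.norm_real, Real.norm_of_nonneg (heat_nonneg ht y)]
    rw [Complex.real_smul] at hx
    calc _ ≤ heat t y * ((1 + ‖y‖) ^ 2 * B x) := mul_le_mul_of_nonneg_left hx (heat_nonneg ht y)
      _ = _ := by ring
  refine (integrable_prod_iff hmeas).2 ⟨Eventually.of_forall fun y => ?_, ?_⟩
  · have := (integrable_rieszKernel_smul hm j φ y).const_mul (heat t y : ℂ)
    simpa only [Complex.real_smul] using this
  · refine (hh.mul_const (∫ x, B x)).mono' hmeas.norm.integral_prod_right'
      (Eventually.of_forall fun y => ?_)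
    rw [Real.norm_of_nonneg (integral_nonneg fun x => norm_nonneg _), ← integral_const_mul]
    exact integral_mono_of_nonneg (Eventually.of_forall fun x => norm_nonneg _)
      (hB.const_mul _) (hb y)

lemma heatFlow_sub (hm : 1 ≤ m) {t : ℝ} (ht : 0 < t) (φ : 𝓢(Eu m, ℂ)) (x : Eu m) :
    ∫ y, (heat t y : ℂ) * (φ (y + x) - φ (y - x)) = heatFlow t φ x - heatFlow t φ (-x) := by
  unfold heatFlow
  rw [← integral_sub (integrable_heat_mul hm ht φ x) (integrable_heat_mul hm ht φ (-x))]
  refine integral_congr_ae (Eventually.of_forall fun y => ?_)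
  dsimp only
  rw [mul_sub, add_comm x, neg_add_eq_sub]

/-- Fubini lets the heat kernel act on φ before the singular kernel does: pairing p_t with `pvConv j
φ` is the principal value pairing with the heat flow of φ. -/
lemma integral_heat_mul_pvConv (hm : 1 ≤ m) (j : Fin m) {t : ℝ} (ht : 0 < t) (φ : 𝓢(Eu m, ℂ)) :
    (Integrable fun x => (rieszKernel j x : ℂ) * (heatFlow t φ x - heatFlow t φ (-x))) ∧
    ∫ y, (heat t y : ℂ) * pvConv j φ y =
      1 / 2 * ∫ x, (rieszKernel j x : ℂ) * (heatFlow t φ x - heatFlow t φ (-x)) := by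
  have hi := integrable_heat_mul_pvConv_integrand hm j ht φ
  have he : ∀ x, ∫ y, (heat t y : ℂ) * ((rieszKernel j x : ℂ) * (φ (y + x) - φ (y - x))) =
      (rieszKernel j x : ℂ) * (heatFlow t φ x - heatFlow t φ (-x)) := by
    intro x
    rw [← heatFlow_sub hm ht, ← integral_const_mul]
    refine integral_congr_ae (Eventually.of_forall fun y => ?_)
    dsimp only
    ring
  constructor
  · exact hi.integral_prod_right.congr (Eventually.of_forall he)
  · calc ∫ y, (heat t y : ℂ) * pvConv j φ y
        = ∫ y, 1 / 2 * ∫ x, (heat t y : ℂ) *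
            ((rieszKernel j x : ℂ) * (φ (y + x) - φ (y - x))) := by
          refine integral_congr_ae (Eventually.of_forall fun y => ?_)
          simp only [pvConv, Complex.real_smul, integral_const_mul]
          push_cast
          ring
      _ = _ := by
          rw [integral_const_mul, integral_integral_swap hi]
          simp only [he]

/-- The principal value kernel is itself a superposition of ∂_j p_s, by `heatPair_superposition` at
β = 0. Applied to the heat flow at time t, the semigroup property shifts s to s + t. -/
lemma heatCoefL_mul_integral_heat (hm : 1 ≤ m) (j : Fin m) {t : ℝ} (ht : 0 < t)
    (φ : 𝓢(Eu m, ℂ)) :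
    heatCoefL m 0 * ∫ y, (heat t y : ℂ) * pvConv j φ y =
      ∫ s in Ioi (0 : ℝ), (s : ℂ) ^ (-(1 / 2) : ℂ) * heatPair j (s + t) φ := by
  obtain ⟨C, -, hC⟩ := exists_norm_le_of_schwartz φ
  obtain ⟨h1, h2⟩ := integral_heat_mul_pvConv hm j ht φ
  have he : (fun x : Eu m => (rieszKernel j x : ℂ) * (heatFlow t φ x - heatFlow t φ (-x))) =
      fun x => (‖x‖ : ℂ) ^ (-m + 2 * (0 : ℂ) - 1) * x j *
        (heatFlow t φ x - heatFlow t φ (-x)) := by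
    ext x
    rw [ofReal_rieszKernel]
    simp
  have hβ : (0 : ℂ).re < ((m : ℝ) + 1) / 2 := by
    rw [Complex.zero_re]; positivity
  rw [he] at h1 h2
  rw [h2, ← (heatPair_superposition hm j hβ (aestronglyMeasurable_heatFlow t φ)
    (norm_heatFlow_le hm ht hC) h1).2]
  refine setIntegral_congr_fun measurableSet_Ioi fun s hs => ?_
  rw [heatPair_heatFlow hm j hs ht, zero_sub]

/-- The semigroup identity behind the Hilbert pair, in the strip where all integrals converge. -/
lemma coefK_mul_integral_pvConv (hm : 1 ≤ m) (j : Fin m) {β : ℂ} (h0 : 0 < β.re)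
    (h1 : β.re < m / 2) (φ : 𝓢(Eu m, ℂ))
    (hi : Integrable fun y => ‖y‖ ^ (-m + 2 * β.re) * ‖pvConv j φ y‖) :
    coefK m β * ∫ y, (‖y‖ : ℂ) ^ (-m + 2 * β) * (coefL m 0 * pvConv j φ y) =
      coefL m β * Ucomp m j (-m + 2 * β) φ := by
  obtain ⟨C, -, hC⟩ := exists_norm_le_of_schwartz φ
  have hK := (heat_superposition hm h1 (continuous_pvConv hm j φ).aestronglyMeasurable hi).2
  have hre : -(m : ℝ) - 1 < (-m + 2 * β : ℂ).re := by simp; linarith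
  have hU := integrable_coord_mul_odd hm j hre φ 0
  simp only [zero_add, zero_sub] at hU
  obtain ⟨hV1, hV2⟩ := heatPair_superposition hm j (β := β) (by linarith)
    φ.continuous.aestronglyMeasurable hC hU
  -- The weights t^(β-1) from K_β and s^(-1/2) from H multiply a function of s + t only, so their
  -- convolution on the half line is all that matters.
  have hb := integral_shift_beta h0 hV1
  rw [hV2, ← Ucomp_eq_integral hm j hre] at hb
  have hmain : heatCoefL m 0 * (heatCoefK m β * ∫ y, (‖y‖ : ℂ) ^ (-m + 2 * β) * pvConv j φ y) =
      Complex.betaIntegral β (1 / 2) * (heatCoefL m β * Ucomp m j (-m + 2 * β) φ) := by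
    rw [← hb, ← hK, ← integral_const_mul]
    refine setIntegral_congr_fun measurableSet_Ioi fun t ht => ?_
    rw [← heatCoefL_mul_integral_heat hm j ht]
    ring
  -- The beta factor is Γ(β)Γ(1/2)/Γ(β+1/2), which matches the reciprocal Gamma factors in `coefK m
  -- β`, `coefL m 0` and `coefL m β`.
  have hG := Complex.Gamma_mul_Gamma_eq_betaIntegral (s := β) (t := 1 / 2) h0 (by norm_num)
  have hg0 : Complex.Gamma β ≠ 0 := Complex.Gamma_ne_zero_of_re_pos h0
  have hg1 : Complex.Gamma (1 / 2) ≠ 0 := Complex.Gamma_ne_zero_of_re_pos (by norm_num)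
  have hg2 : Complex.Gamma (β + 1 / 2) ≠ 0 :=
    Complex.Gamma_ne_zero_of_re_pos (by simp; linarith)
  have e1 : coefK m β = heatCoefK m β * (Complex.Gamma β)⁻¹ := rfl
  have e2 : ∀ β, coefL m β = heatCoefL m β * (Complex.Gamma (β + 1 / 2))⁻¹ := fun β => by
    unfold coefL heatCoefL; ring
  have e3 : ∫ y, (‖y‖ : ℂ) ^ (-m + 2 * β) * (coefL m 0 * pvConv j φ y) =
      coefL m 0 * ∫ y, (‖y‖ : ℂ) ^ (-m + 2 * β) * pvConv j φ y := by
    rw [← integral_const_mul]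
    congr 1 with y
    ring
  rw [e3, e1, e2, e2, zero_add]
  generalize Complex.Gamma (β + 1 / 2) = g2 at *
  generalize Complex.Gamma (1 / 2) = g1 at *
  field_simp
  linear_combination g2 * hmain -
    heatCoefL m β * Ucomp m j (-m + 2 * β) φ * hG

/-! ### Analytic continuation in β off the real axis. -/

/-- Two functions that are holomorphic off the real axis in a convex open set and agree near a real
point of it agree in the whole set off the real axis. -/
lemma eq_off_real_of_eventually {V : Set ℂ} (hV : IsOpen V) (hc : Convex ℝ V) {F G : ℂ → ℂ}
    (hF : ∀ β ∈ V, β.im ≠ 0 → DifferentiableAt ℂ F β)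
    (hG : ∀ β ∈ V, β.im ≠ 0 → DifferentiableAt ℂ G β) {a : ℝ} (ha : (a : ℂ) ∈ V)
    (h : ∀ᶠ β in 𝓝 (a : ℂ), β.im ≠ 0 → F β = G β) {β : ℂ} (hβ : β ∈ V) (hi : β.im ≠ 0) :
    F β = G β := by
  -- H is the open upper or lower half plane and z = ±i. The set V ∩ H is convex, hence connected,
  -- and it contains points a + tz arbitrarily close to a, so the two functions agree near some
  -- point of it.
  have key : ∀ (H : Set ℂ) (z : ℂ), IsOpen H → Convex ℝ H → (∀ w ∈ H, w.im ≠ 0) →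
      (∀ t : ℝ, 0 < t → (a : ℂ) + t * z ∈ H) → β ∈ H → F β = G β := by
    intro H z hH hHc hHi hz hβH
    have ht : Tendsto (fun t : ℝ => (a : ℂ) + t * z) (𝓝[>] 0) (𝓝 (a : ℂ)) := by
      have : Continuous fun t : ℝ => (a : ℂ) + t * z := by fun_prop
      simpa using (this.tendsto 0).mono_left nhdsWithin_le_nhds
    obtain ⟨t, ⟨h1, h2⟩, h3⟩ := ((ht.eventually (h.eventually_nhds.and (hV.mem_nhds ha))).and
      self_mem_nhdsWithin).exists
    have hp : (a : ℂ) + t * z ∈ H := hz t h3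
    have hpre : IsPreconnected (V ∩ H) := (hc.inter hHc).isPreconnected
    have ho : IsOpen (V ∩ H) := hV.inter hH
    have hFa : AnalyticOnNhd ℂ F (V ∩ H) := DifferentiableOn.analyticOnNhd
      (fun w hw => (hF w hw.1 (hHi w hw.2)).differentiableWithinAt) ho
    have hGa : AnalyticOnNhd ℂ G (V ∩ H) := DifferentiableOn.analyticOnNhd
      (fun w hw => (hG w hw.1 (hHi w hw.2)).differentiableWithinAt) ho
    refine hFa.eqOn_of_preconnected_of_eventuallyEq hGa hpre ⟨h2, hp⟩ ?_ ⟨hβ, hβH⟩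
    filter_upwards [h1, hH.mem_nhds hp] with w hw hw'
    exact hw (hHi w hw')
  rcases hi.lt_or_gt with hi | hi
  · refine key {w | w.im < 0} (-Complex.I) (isOpen_lt Complex.continuous_im continuous_const)
      (convex_halfSpace_im_lt 0) (fun w hw => (Set.mem_ofPred.1 hw).ne) (fun t ht => ?_) hi
    simpa using ht
  · refine key {w | 0 < w.im} Complex.I (isOpen_lt continuous_const Complex.continuous_im)
      (convex_halfSpace_im_gt 0) (fun w hw => (Set.mem_ofPred.1 hw).ne') (fun t ht => ?_) hi
    simpa using ht

lemma eventually_strip {a b c : ℝ} (h1 : a < c) (h2 : c < b) :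
    ∀ᶠ β : ℂ in 𝓝 (c : ℂ), a < β.re ∧ β.re < b := by
  have hc : Tendsto Complex.re (𝓝 (c : ℂ)) (𝓝 c) := Complex.continuous_re.tendsto _
  exact (hc.eventually (lt_mem_nhds h1)).and (hc.eventually (gt_mem_nhds h2))

/-- The poles of the Gamma factors, the poles of the finite parts and the special cases in the
definitions all occur at real parameters. A nonreal β avoids them all. -/
lemma ne_natCast_of_im {β : ℂ} (h : β.im ≠ 0) (x : ℝ) : β ≠ x := by
  rintro rfl
  simp at h

lemma differentiableAt_coefK {β : ℂ} (h : ∀ n : ℕ, β ≠ m / 2 + n) :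
    DifferentiableAt ℂ (coefK m) β := by
  have h1 : DifferentiableAt ℂ (fun β : ℂ => Complex.Gamma (m / 2 - β)) β := by
    refine (Complex.differentiableAt_Gamma _ fun n hn => h n ?_).comp β (by fun_prop)
    linear_combination -hn
  have h2 : DifferentiableAt ℂ (fun β : ℂ => (2 : ℂ) ^ (-2 * β)) β :=
    DifferentiableAt.const_cpow (by fun_prop) (Or.inl two_ne_zero)
  have h3 := Complex.differentiable_one_div_Gamma β
  unfold coefK
  exact ((h2.mul h1).div_const _).mul h3

lemma differentiableAt_coefL {β : ℂ} (h : ∀ n : ℕ, β ≠ (m + 1) / 2 + n) :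
    DifferentiableAt ℂ (coefL m) β := by
  have h1 : DifferentiableAt ℂ (fun β : ℂ => Complex.Gamma ((m + 1) / 2 - β)) β := by
    refine (Complex.differentiableAt_Gamma _ fun n hn => h n ?_).comp β (by fun_prop)
    linear_combination -hn
  have h2 : DifferentiableAt ℂ (fun β : ℂ => (2 : ℂ) ^ (-2 * β)) β :=
    DifferentiableAt.const_cpow (by fun_prop) (Or.inl two_ne_zero)
  have h3 : DifferentiableAt ℂ (fun β : ℂ => (Complex.Gamma (β + 1 / 2))⁻¹) β :=
    (Complex.differentiable_one_div_Gamma.comp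
      (by fun_prop : Differentiable ℂ fun β : ℂ => β + 1 / 2)) β
  unfold coefL
  exact (((h2.mul h1).div_const _).mul h3).neg

lemma differentiableAt_T (f : 𝓢(Eu m, ℂ)) {β : ℂ} (h : ∀ l : ℕ, β ≠ -l) :
    DifferentiableAt ℂ (fun β : ℂ => T m (-m + 2 * β) f) β := by
  simp only [T_apply]
  refine DifferentiableAt.const_mul (DifferentiableAt.comp β
    (g := fun μ => finitePart μ (sphericalMean 1 f)) (f := fun β : ℂ => -m + 2 * β + m - 1)
    (differentiableAt_fp_one f fun l hl => h l ?_) (by fun_prop)) _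
  linear_combination hl / 2

lemma differentiableAt_Ucomp (j : Fin m) (f : 𝓢(Eu m, ℂ)) {β : ℂ} (h : ∀ l : ℕ, β ≠ -l - 1 / 2) :
    DifferentiableAt ℂ (fun β : ℂ => Ucomp m j (-m + 2 * β) f) β := by
  simp only [Ucomp_apply]
  refine DifferentiableAt.const_mul (DifferentiableAt.comp β
    (g := fun μ => finitePart μ (sphericalMean (coordWeight m j) f))
    (f := fun β : ℂ => -m + 2 * β + m - 1)
    (differentiableAt_fp_coord j f fun l hl => h l ?_) (by fun_prop)) _
  linear_combination hl / 2

lemma differentiableAt_coefK_of_im {β : ℂ} (h : β.im ≠ 0) : DifferentiableAt ℂ (coefK m) β :=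
  differentiableAt_coefK fun n => by
    have := ne_natCast_of_im h (m / 2 + n)
    push_cast at this
    exact this

lemma differentiableAt_coefL_of_im {β : ℂ} (h : β.im ≠ 0) : DifferentiableAt ℂ (coefL m) β :=
  differentiableAt_coefL fun n => by
    have := ne_natCast_of_im h ((m + 1) / 2 + n)
    push_cast at this
    exact this

lemma differentiableAt_T_of_im (f : 𝓢(Eu m, ℂ)) {β : ℂ} (h : β.im ≠ 0) :
    DifferentiableAt ℂ (fun β : ℂ => T m (-m + 2 * β) f) β :=
  differentiableAt_T f fun l => by
    have := ne_natCast_of_im h (-l)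
    push_cast at this
    exact this

lemma differentiableAt_Ucomp_of_im (j : Fin m) (f : 𝓢(Eu m, ℂ)) {β : ℂ} (h : β.im ≠ 0) :
    DifferentiableAt ℂ (fun β : ℂ => Ucomp m j (-m + 2 * β) f) β :=
  differentiableAt_Ucomp j f fun l => by
    have := ne_natCast_of_im h (-l - 1 / 2)
    push_cast at this
    exact this

lemma K_of_im {β : ℂ} (h : β.im ≠ 0) (f : 𝓢(Eu m, ℂ)) :
    K m β f = coefK m β * T m (-m + 2 * β) f := by
  rw [K_eq_coefK m fun l => by
    have := ne_natCast_of_im h (-l)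
    push_cast at this
    exact this]
  rfl

lemma Lcomp_of_im {β : ℂ} (h : β.im ≠ 0) (j : Fin m) (f : 𝓢(Eu m, ℂ)) :
    Lcomp m j β f = coefL m β * Ucomp m j (-m + 2 * β) f := by
  rw [Lcomp, if_neg]
  rintro ⟨l, hl⟩
  have := ne_natCast_of_im h (-l - 1 / 2)
  push_cast at this
  exact this hl

/-! ### `U_λ` as a derivative of `T_(λ+1)` -/

lemma hasFDerivAt_heat {t : ℝ} (ht : 0 < t) (x : Eu m) :
    HasFDerivAt (fun x => (heat t x : ℂ))
      (Complex.ofRealCLM.comp (-(heat t x / (2 * t)) • innerSL ℝ x)) x := by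
  refine Complex.ofRealCLM.hasFDerivAt.comp x ?_
  have h1 : HasFDerivAt (fun x : Eu m => ‖x‖ ^ 2) ((2 : ℕ) • innerSL ℝ x) x :=
    (hasStrictFDerivAt_norm_sq x).hasFDerivAt
  have h2 : HasFDerivAt (fun y : Eu m => Real.exp (-(‖y‖ ^ 2 * (4 * t)⁻¹)))
      (Real.exp (-(‖x‖ ^ 2 * (4 * t)⁻¹)) • -((4 * t)⁻¹ • ((2 : ℕ) • innerSL ℝ x : Eu m →L[ℝ] ℝ))) x :=
    (h1.mul_const (4 * t)⁻¹).neg.exp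
  have h3 : (heat t : Eu m → ℝ) = fun y =>
      (4 * Real.pi * t) ^ (-(m : ℝ) / 2) * Real.exp (-(‖y‖ ^ 2 * (4 * t)⁻¹)) := rfl
  rw [h3]
  refine (h2.const_mul _).congr_fderiv ?_
  ext v
  simp only [smul_apply, neg_apply, smul_eq_mul, nsmul_eq_mul, mul_inv]
  field_simp
  push_cast
  ring

lemma fderiv_heat {t : ℝ} (ht : 0 < t) (j : Fin m) (x : Eu m) :
    fderiv ℝ (fun x => (heat t x : ℂ)) x (EuclideanSpace.single j 1) = heatDeriv j t x := by
  rw [(hasFDerivAt_heat ht x).fderiv]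
  simp [heatDeriv, EuclideanSpace.inner_single_right]
  ring

lemma heatPair_eq_neg (hm : 1 ≤ m) (j : Fin m) {u : ℝ} (hu : 0 < u) (f : 𝓢(Eu m, ℂ)) :
    heatPair j u f =
      -∫ x, (heat u x : ℂ) * (∂_{(EuclideanSpace.single j 1 : Eu m)} f : 𝓢(Eu m, ℂ)) x := by
  obtain ⟨C, -, hC⟩ := exists_norm_le_of_schwartz f
  have hb := integrable_heat_mul hm hu (∂_{(EuclideanSpace.single j 1 : Eu m)} f) 0
  have hb' := integrable_heat_mul hm hu f 0
  simp only [zero_add, SchwartzMap.lineDerivOp_apply_eq_fderiv] at hb hb'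
  have h := integral_mul_fderiv_eq_neg_fderiv_mul_of_integrable (μ := (volume : Measure (Eu m)))
    (f := fun x => (heat u x : ℂ)) (g := f) (v := EuclideanSpace.single j 1) ?_ hb hb'
    (fun x _ => (hasFDerivAt_heat hu x).differentiableAt) (fun x _ => f.differentiableAt)
  · simp only [fderiv_heat hu] at h
    simp only [SchwartzMap.lineDerivOp_apply_eq_fderiv]
    rw [h, neg_neg, heatPair]
  · simp only [fderiv_heat hu]
    exact (integrable_heatDeriv hm j hu).ofReal.mul_bdd f.continuous.aestronglyMeasurable
      (Eventually.of_forall hC)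

/-- The relation L_β = ∂ K_(β+1/2) in components. In the strip -1/2 < Re β < (m-1)/2 both sides are
heat superpositions with the same weight u^(β-1/2)/Γ(β+1/2), and integration by parts moves ∂_j from
the heat kernel to f. The rest is continuation. -/
lemma coefL_mul_Ucomp_eq (hm : 1 ≤ m) (j : Fin m) (f : 𝓢(Eu m, ℂ)) {β : ℂ} (hβ : β.im ≠ 0) :
    coefL m β * Ucomp m j (-m + 2 * β) f = -(coefK m (β + 1 / 2) *
      T m (-m + 2 * (β + 1 / 2)) (∂_{(EuclideanSpace.single j 1 : Eu m)} f)) := by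
  obtain ⟨C, -, hC⟩ := exists_norm_le_of_schwartz f
  have him : ∀ {β : ℂ}, β.im ≠ 0 → (β + 1 / 2).im ≠ 0 := fun h => by simpa using h
  have hbase : ∀ β : ℂ, -(1 / 2) < β.re → β.re < (m - 1) / 2 →
      coefL m β * Ucomp m j (-m + 2 * β) f = -(coefK m (β + 1 / 2) *
      T m (-m + 2 * (β + 1 / 2)) (∂_{(EuclideanSpace.single j 1 : Eu m)} f)) := by
    intro β h1 h2
    have hre : -(m : ℝ) - 1 < (-m + 2 * β : ℂ).re := by simp; linarith
    have hre' : -(m : ℝ) < (-m + 2 * (β + 1 / 2) : ℂ).re := by simp; linarith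
    have hU := integrable_coord_mul_odd hm j hre f 0
    simp only [zero_add, zero_sub] at hU
    have hV := (heatPair_superposition hm j (β := β) (by linarith)
      f.continuous.aestronglyMeasurable hC hU).2
    rw [← Ucomp_eq_integral hm j hre] at hV
    have hi := (integrable_norm_cpow_mul hm hre' (∂_{(EuclideanSpace.single j 1 : Eu m)} f)).norm
    have hi' : Integrable fun x => ‖x‖ ^ (-m + 2 * (β + 1 / 2).re) *
        ‖(∂_{(EuclideanSpace.single j 1 : Eu m)} f) x‖ := by
      refine hi.congr ?_
      filter_upwards [ae_ne_zero hm] with x hx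
      rw [norm_mul, norm_cpow_norm_le _ hx]
      simp
    have hH := (heat_superposition hm (β := β + 1 / 2) (by simp; linarith)
      (SchwartzMap.continuous _).aestronglyMeasurable hi').2
    rw [← T_eq_integral hm hre'] at hH
    have hm' : heatCoefL m β * Ucomp m j (-m + 2 * β) f = -(heatCoefK m (β + 1 / 2) *
        T m (-m + 2 * (β + 1 / 2)) (∂_{(EuclideanSpace.single j 1 : Eu m)} f)) := by
      rw [← hV, ← hH, ← integral_neg]
      refine setIntegral_congr_fun measurableSet_Ioi fun u hu => ?_
      rw [heatPair_eq_neg hm j hu, show β + 1 / 2 - 1 = β - 1 / 2 by ring]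
      ring
    have e1 : coefK m (β + 1 / 2) = heatCoefK m (β + 1 / 2) * (Complex.Gamma (β + 1 / 2))⁻¹ := rfl
    have e2 : coefL m β = heatCoefL m β * (Complex.Gamma (β + 1 / 2))⁻¹ := by
      unfold coefL heatCoefL; ring
    rw [e1, e2]
    linear_combination (Complex.Gamma (β + 1 / 2))⁻¹ * hm'
  have hmr : (1 : ℝ) ≤ m := by exact_mod_cast hm
  -- The base point -1/4 lies in the strip for every m ≥ 1, including m = 1, where the strip is
  -- (-1/2, 0).
  refine eq_off_real_of_eventually (V := univ)
    (F := fun β => coefL m β * Ucomp m j (-m + 2 * β) f)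
    (G := fun β => -(coefK m (β + 1 / 2) *
      T m (-m + 2 * (β + 1 / 2)) (∂_{(EuclideanSpace.single j 1 : Eu m)} f)))
    isOpen_univ convex_univ
    (fun β _ h => (differentiableAt_coefL_of_im h).mul (differentiableAt_Ucomp_of_im j f h))
    (fun β _ h => ?_) (a := -(1 / 4)) (mem_univ _) ?_ (mem_univ _) hβ
  · have hd : DifferentiableAt ℂ (fun β : ℂ => β + 1 / 2) β := by fun_prop
    exact (((differentiableAt_coefK_of_im (him h)).comp β hd).mul
      ((differentiableAt_T_of_im (∂_{(EuclideanSpace.single j 1 : Eu m)} f)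
        (him h)).comp β hd)).neg
  · filter_upwards [eventually_strip (a := -(1 / 2)) (b := (m - 1) / 2) (c := -(1 / 4))
      (by norm_num) (by linarith)] with β hs _
    exact hbase β hs.1 hs.2

/-- On the sphere of radius r, ∑_j ω_j ∂_j f is the radial derivative of f. -/
lemma sum_sphericalMean_coord (f : 𝓢(Eu m, ℂ)) (r : ℝ) :
    ∑ j, sphericalMean (coordWeight m j)
        (∂_{(EuclideanSpace.single j 1 : Eu m)} f : 𝓢(Eu m, ℂ)) r =
      sphericalMeanDeriv 1 f 1 r := by
  have hi := fun j => integrable_integrand (coordWeight m j)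
    (∂_{(EuclideanSpace.single j 1 : Eu m)} f) 0 r
  simp only [iteratedFDeriv_zero_apply] at hi
  simp only [sphericalMean, sphericalMeanDeriv, ← Finset.mul_sum]
  rw [← integral_finsetSum _ fun j _ => hi j]
  congr 2 with ω
  rw [iteratedFDeriv_one_apply]
  have hω : (ω : Eu m) = ∑ j, (ω : Eu m) j • EuclideanSpace.single j (1 : ℝ) := by
    ext i
    simp [Finset.sum_apply, Pi.single_apply]
  have h2 : fderiv ℝ f (r • (ω : Eu m)) (ω : Eu m) = ∑ j, (ω : Eu m) j •
      fderiv ℝ f (r • (ω : Eu m)) (EuclideanSpace.single j (1 : ℝ)) := by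
    conv_lhs => rw [hω]
    simp only [map_sum, map_smul]
    rw [← hω]
  rw [h2]
  simp [SchwartzMap.lineDerivOp_apply_eq_fderiv, coordWeight]

/-- For Re β > 0 the left side is σ_m ∫ r^(2β) S'(r) dr, with S the spherical mean of f. Integration
by parts in r gives the factor -2β, and both boundary terms vanish. Continuation covers the other
nonreal β. -/
lemma sum_Ucomp_lineDeriv (f : 𝓢(Eu m, ℂ)) {β : ℂ} (hβ : β.im ≠ 0) :
    ∑ j, Ucomp m j (-m + 2 * (β + 1 / 2)) (∂_{(EuclideanSpace.single j 1 : Eu m)} f) =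
      -(2 * β * T m (-m + 2 * β) f) := by
  have him : ∀ {β : ℂ}, β.im ≠ 0 → (β + 1 / 2).im ≠ 0 := fun h => by simpa using h
  have hbase : ∀ β : ℂ, 0 < β.re →
      ∑ j, Ucomp m j (-m + 2 * (β + 1 / 2)) (∂_{(EuclideanSpace.single j 1 : Eu m)} f) =
      -(2 * β * T m (-m + 2 * β) f) := by
    intro β h
    have hre1 : -1 < (2 * β : ℂ).re := by simp; linarith
    have hre2 : -1 < (2 * β - 1 : ℂ).re := by simp; linarith
    have e1 : -(m : ℂ) + 2 * (β + 1 / 2) + m - 1 = 2 * β := by ring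
    have e2 : -(m : ℂ) + 2 * β + m - 1 = 2 * β - 1 := by ring
    simp only [Ucomp_apply, T_apply, e1, e2]
    have hj := fun j => finitePart_eq_integral (coordWeight m j)
      (∂_{(EuclideanSpace.single j 1 : Eu m)} f) (by linarith) (Or.inl hre1)
    obtain ⟨h1, h2⟩ := finitePart_eq_integral 1 f (by linarith) (Or.inl hre2)
    have hsum : ∑ j, finitePart (2 * β) (sphericalMean (coordWeight m j)
        (∂_{(EuclideanSpace.single j 1 : Eu m)} f : 𝓢(Eu m, ℂ))) =
        ∫ r in Ioi (0 : ℝ), (r : ℂ) ^ (2 * β) * sphericalMeanDeriv 1 f 1 r := by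
      simp only [(hj _).2]
      rw [← integral_finsetSum _ fun j _ => (hj j).1]
      simp only [← sum_sphericalMean_coord, Finset.mul_sum]
    have hint : IntegrableOn (fun r : ℝ => (r : ℂ) ^ (2 * β) * sphericalMeanDeriv 1 f 1 r)
        (Ioi 0) := by
      simp only [← sum_sphericalMean_coord, Finset.mul_sum]
      exact integrable_finsetSum _ fun j _ => (hj j).1
    have hder : ∀ r ∈ Ioi (0 : ℝ), HasDerivAt
        (fun r : ℝ => (r : ℂ) ^ (2 * β) * sphericalMean 1 f r)
        (2 * β * ((r : ℂ) ^ (2 * β - 1) * sphericalMean 1 f r) +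
          (r : ℂ) ^ (2 * β) * sphericalMeanDeriv 1 f 1 r) r := by
      intro r hr
      have d1 : HasDerivAt (fun r : ℝ => (r : ℂ) ^ (2 * β)) (2 * β * (r : ℂ) ^ (2 * β - 1) * 1) r :=
        ((hasDerivAt_id (r : ℂ)).cpow_const (Complex.ofReal_mem_slitPlane.2 hr)).comp_ofReal
      have d2 := hasDerivAt_sphericalMeanDeriv 1 f 0 r
      rw [sphericalMeanDeriv_zero] at d2
      refine (d1.mul d2).congr_deriv ?_
      simp only [zero_add]
      ring
    have hib := integral_Ioi_of_hasDerivAt_of_tendsto (a := 0) (m := 0)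
      (f := fun r : ℝ => (r : ℂ) ^ (2 * β) * sphericalMean 1 f r) ?_ hder
      ((h1.const_mul _).add hint) ?_
    · rw [integral_add (h1.const_mul _) hint, integral_const_mul, ← hsum, ← h2] at hib
      rw [← Finset.mul_sum]
      have h0 : 2 * β ≠ 0 := mul_ne_zero two_ne_zero fun h' => by simp [h'] at h
      simp only [Complex.ofReal_zero, Complex.zero_cpow h0, zero_mul, sub_zero] at hib
      linear_combination (sphereArea m : ℂ) * hib
    · exact ((Complex.continuousAt_ofReal_cpow_const 0 (2 * β) (Or.inl (by simpa using h))).mul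
        (continuous_sphericalMean 1 f).continuousAt).continuousWithinAt
    · have hlim : Tendsto (fun r : ℝ => massBound (1 : C(USphere m, ℝ)) *
          SchwartzMap.seminorm ℂ (fpDecay (2 * β)) 0 f *
          r ^ (-(-((2 * β).re - fpDecay (2 * β))))) atTop (𝓝 (massBound (1 : C(USphere m, ℝ)) *
          SchwartzMap.seminorm ℂ (fpDecay (2 * β)) 0 f * 0)) :=
        (tendsto_rpow_neg_atTop (by have := fpDecay_spec (2 * β); linarith)).const_mul _
      rw [mul_zero] at hlim
      refine squeeze_zero_norm' ?_ hlim
      filter_upwards [eventually_gt_atTop 0] with r hr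
      rw [neg_neg]
      exact norm_outer_le 1 f (2 * β) hr
  refine eq_off_real_of_eventually (V := univ)
    (F := fun β => ∑ j, Ucomp m j (-m + 2 * (β + 1 / 2))
      (∂_{(EuclideanSpace.single j 1 : Eu m)} f))
    (G := fun β => -(2 * β * T m (-m + 2 * β) f))
    isOpen_univ convex_univ (fun β _ h => ?_)
    (fun β _ h => ?_) (a := 1) (mem_univ _) ?_ (mem_univ _) hβ
  · have hd : DifferentiableAt ℂ (fun β : ℂ => β + 1 / 2) β := by fun_prop
    exact DifferentiableAt.fun_sum fun j _ => DifferentiableAt.comp β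
      (g := fun β => Ucomp m j (-m + 2 * β) (∂_{(EuclideanSpace.single j 1 : Eu m)} f))
      (differentiableAt_Ucomp_of_im j (∂_{(EuclideanSpace.single j 1 : Eu m)} f) (him h)) hd
  · have hd : DifferentiableAt ℂ (fun β : ℂ => 2 * β) β := by fun_prop
    exact (hd.mul (differentiableAt_T_of_im f h)).neg
  · filter_upwards [eventually_strip (a := 0) (b := 2) (c := 1)
      (by norm_num) (by norm_num)] with β hs _
    exact hbase β hs.1

lemma coefL_add_half (β : ℂ) : coefL m (β + 1 / 2) * (2 * β) = -coefK m β := by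
  have h1 := Complex.one_div_Gamma_eq_self_mul_one_div_Gamma_add_one β
  have h2 : (2 : ℂ) ^ (-2 * (β + 1 / 2)) = (2 : ℂ) ^ (-2 * β) / 2 := by
    rw [show -2 * (β + 1 / 2) = -2 * β - 1 by ring, Complex.cpow_sub _ _ two_ne_zero,
      Complex.cpow_one]
  rw [coefL, coefK, h1, h2, show β + 1 / 2 + 1 / 2 = β + 1 by ring,
    show ((m : ℂ) + 1) / 2 - (β + 1 / 2) = m / 2 - β by ring]
  ring

/-- Two first-order relations are composed: each ∂_j K_(β+1) is a component of L_(β+1/2), and the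
divergence of these components is a multiple of T_(2β-m). The recursion carries the limit at β = 0
to -1, -2, .... -/
lemma K_eq_neg_K_laplacian (hm : 1 ≤ m) (f : 𝓢(Eu m, ℂ)) {β : ℂ} (hβ : β.im ≠ 0) :
    K m β f = -K m (β + 1) (Δ f) := by
  have hi : (β + 1 / 2).im ≠ 0 := by simpa using hβ
  have hi1 : (β + 1).im ≠ 0 := by simpa using hβ
  rw [K_of_im hβ, K_of_im hi1, laplacian_eq_sum_coord, map_sum, Finset.mul_sum,
    ← Finset.sum_neg_distrib]
  have h1 := fun j => coefL_mul_Ucomp_eq hm j (∂_{(EuclideanSpace.single j 1 : Eu m)} f) hi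
  have e : β + 1 / 2 + 1 / 2 = β + 1 := by ring
  simp only [e] at h1
  simp only [← h1]
  rw [← Finset.mul_sum, sum_Ucomp_lineDeriv f hβ]
  linear_combination T m (-m + 2 * β) f * coefL_add_half (m := m) β

/-- The simple zero of 1/Γ(β) = β/Γ(β+1) cancels the simple pole of T_(2β-m), whose residue in β is
(σ_m/2) f(0). The remaining constant Γ(m/2) σ_m/(2π^(m/2)) is 1. -/
lemma tendsto_K_zero (hm : 1 ≤ m) (f : 𝓢(Eu m, ℂ)) :
    Tendsto (fun β => K m β f) (𝓝[{β | β.im ≠ 0}] 0) (𝓝 (f 0)) := by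
  have hs : Tendsto (fun β : ℂ => 2 * β - 1) (𝓝[{β | β.im ≠ 0}] 0) (𝓝[≠] (-1)) := by
    refine tendsto_nhdsWithin_of_tendsto_nhds_of_eventually_within _ ?_ ?_
    · have : Continuous fun β : ℂ => 2 * β - 1 := by fun_prop
      simpa using (this.tendsto 0).mono_left nhdsWithin_le_nhds
    · filter_upwards [self_mem_nhdsWithin] with β hβ h
      have h' : β = 0 := by linear_combination (Set.mem_singleton_iff.1 h) / 2
      simp [h'] at hβ
  have h1 := (tendsto_finitePart_neg_one 1 f).comp hs
  rw [sphericalMean_one_zero hm] at h1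
  set A : ℂ → ℂ := fun β => (2 : ℂ) ^ (-2 * β) * Complex.Gamma (m / 2 - β) /
    (Real.pi : ℂ) ^ ((m : ℂ) / 2) * (Complex.Gamma (β + 1))⁻¹ * (sphereArea m / 2) with hA
  have hm0 : (0 : ℝ) < (m : ℝ) / 2 := by
    have : (1 : ℝ) ≤ m := by exact_mod_cast hm
    linarith
  have hcont : ContinuousAt A 0 := by
    have d1 : DifferentiableAt ℂ (fun β : ℂ => Complex.Gamma (m / 2 - β)) 0 := by
      refine (Complex.differentiableAt_Gamma _ fun n hn => ?_).comp 0 (by fun_prop)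
      have := congrArg Complex.re hn
      simp at this
      have hn0 : (0 : ℝ) ≤ n := n.cast_nonneg
      linarith
    have d2 : DifferentiableAt ℂ (fun β : ℂ => (2 : ℂ) ^ (-2 * β)) 0 :=
      DifferentiableAt.const_cpow (by fun_prop) (Or.inl two_ne_zero)
    have d3 : DifferentiableAt ℂ (fun β : ℂ => (Complex.Gamma (β + 1))⁻¹) 0 :=
      (Complex.differentiable_one_div_Gamma.comp
        (by fun_prop : Differentiable ℂ fun β : ℂ => β + 1)) 0
    exact ((((d2.mul d1).div_const _).mul d3).mul_const _).continuousAt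
  have hA0 : A 0 = 1 := by
    have hg : (Real.Gamma ((m : ℝ) / 2) : ℂ) ≠ 0 :=
      Complex.ofReal_ne_zero.2 (Real.Gamma_pos_of_pos hm0).ne'
    have hp : ((Real.pi ^ ((m : ℝ) / 2) : ℝ) : ℂ) ≠ 0 :=
      Complex.ofReal_ne_zero.2 (Real.rpow_pos_of_pos Real.pi_pos _).ne'
    have e1 : Complex.Gamma ((m : ℂ) / 2) = (Real.Gamma ((m : ℝ) / 2) : ℂ) := by
      rw [← Complex.Gamma_ofReal]; push_cast; rfl
    have e2 : (Real.pi : ℂ) ^ ((m : ℂ) / 2) = ((Real.pi ^ ((m : ℝ) / 2) : ℝ) : ℂ) := by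
      rw [Complex.ofReal_cpow Real.pi_pos.le]; push_cast; rfl
    simp only [hA, mul_zero, Complex.cpow_zero, sub_zero, zero_add, Complex.Gamma_one, inv_one,
      sphereArea, e1, e2]
    push_cast
    field_simp
  have h2 := (hcont.tendsto.mono_left
    (nhdsWithin_le_nhds (s := {β : ℂ | β.im ≠ 0}))).mul h1
  rw [hA0, one_mul] at h2
  refine h2.congr' ?_
  filter_upwards [self_mem_nhdsWithin] with β hβ
  rw [K_of_im hβ, T_apply, coefK, Complex.one_div_Gamma_eq_self_mul_one_div_Gamma_add_one,
    show -(m : ℂ) + 2 * β + m - 1 = 2 * β - 1 by ring]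
  simp only [hA, Function.comp_apply]
  ring

lemma tendsto_K_neg_nat (hm : 1 ≤ m) (l : ℕ) : ∀ f : 𝓢(Eu m, ℂ),
    Tendsto (fun β => K m β f) (𝓝[{β | β.im ≠ 0}] (-l)) (𝓝 (K m (-l) f)) := by
  induction l with
  | zero =>
    intro f
    have := tendsto_K_zero hm f
    rw [K_neg_nat hm]
    simpa using! this
  | succ l ih =>
    intro f
    have h1 : K m (-(l + 1 : ℕ)) f = -K m (-l) (Δ f) := by
      rw [K_neg_nat hm, K_neg_nat hm, Function.iterate_succ_apply', negLaplacian_apply]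
    rw [h1]
    have h2 : Tendsto (fun β : ℂ => β + 1) (𝓝[{β | β.im ≠ 0}] (-(l + 1 : ℕ)))
        (𝓝[{β | β.im ≠ 0}] (-l)) := by
      refine tendsto_nhdsWithin_of_tendsto_nhds_of_eventually_within _ ?_ ?_
      · have : Continuous fun β : ℂ => β + 1 := by fun_prop
        convert (this.tendsto (-(l + 1 : ℕ))).mono_left nhdsWithin_le_nhds using 2
        push_cast
        ring
      · filter_upwards [self_mem_nhdsWithin] with β hβ
        simpa using hβ
    refine (((ih (Δ f)).comp h2).neg).congr' ?_
    filter_upwards [self_mem_nhdsWithin] with β hβ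
    exact (K_eq_neg_K_laplacian hm f hβ).symm

lemma tendsto_K (hm : 1 ≤ m) (f : 𝓢(Eu m, ℂ)) {β₀ : ℂ} (h : ∀ n : ℕ, β₀ ≠ m / 2 + n) :
    Tendsto (fun β => K m β f) (𝓝[{β | β.im ≠ 0}] β₀) (𝓝 (K m β₀ f)) := by
  by_cases hl : ∀ l : ℕ, β₀ ≠ -l
  · have h1 : K m β₀ f = coefK m β₀ * T m (-m + 2 * β₀) f := by
      rw [K_eq_coefK m hl]; rfl
    rw [h1]
    refine Tendsto.congr' ?_ (((differentiableAt_coefK h).mul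
      (differentiableAt_T f hl)).continuousAt.tendsto.mono_left nhdsWithin_le_nhds)
    filter_upwards [self_mem_nhdsWithin] with β hβ
    exact (K_of_im hβ f).symm
  · push Not at hl
    obtain ⟨l, rfl⟩ := hl
    exact tendsto_K_neg_nat hm l f

/-- At β₀ = -l - 1/2 the relation L_β = ∂ K_(β+1/2) reduces the limit to that of K at -l. It is
known for nonreal β only, hence the restricted neighbourhood filter. -/
lemma tendsto_Lcomp (hm : 1 ≤ m) (j : Fin m) (f : 𝓢(Eu m, ℂ)) {β₀ : ℂ}
    (h : ∀ n : ℕ, β₀ ≠ (m + 1) / 2 + n) :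
    Tendsto (fun β => Lcomp m j β f) (𝓝[{β | β.im ≠ 0}] β₀) (𝓝 (Lcomp m j β₀ f)) := by
  by_cases hl : ∃ l : ℕ, β₀ = -l - 1 / 2
  · have h1 := tendsto_K hm (∂_{(EuclideanSpace.single j 1 : Eu m)} f) (β₀ := β₀ + 1 / 2)
      (fun n hn => by
        obtain ⟨l, rfl⟩ := hl
        have h' := congrArg Complex.re hn
        have h1 : (1 : ℝ) ≤ m := by exact_mod_cast hm
        have h2 : (0 : ℝ) ≤ n := n.cast_nonneg
        have h3 : (0 : ℝ) ≤ l := l.cast_nonneg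
        simp at h'
        linarith)
    have h2 : Tendsto (fun β : ℂ => β + 1 / 2) (𝓝[{β | β.im ≠ 0}] β₀)
        (𝓝[{β | β.im ≠ 0}] (β₀ + 1 / 2)) := by
      refine tendsto_nhdsWithin_of_tendsto_nhds_of_eventually_within _ ?_ ?_
      · have : Continuous fun β : ℂ => β + 1 / 2 := by fun_prop
        exact (this.tendsto β₀).mono_left nhdsWithin_le_nhds
      · filter_upwards [self_mem_nhdsWithin] with β hβ
        simpa using hβ
    rw [Lcomp, if_pos hl]
    refine ((h1.comp h2).neg).congr' ?_
    filter_upwards [self_mem_nhdsWithin] with β hβ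
    have hβ' : (β + 1 / 2).im ≠ 0 := by simpa using hβ
    rw [Lcomp_of_im hβ, coefL_mul_Ucomp_eq hm j f hβ, Function.comp_apply, K_of_im hβ']
  · rw [Lcomp, if_neg hl]
    push Not at hl
    refine Tendsto.congr' ?_ (((differentiableAt_coefL h).mul
      (differentiableAt_Ucomp j f hl)).continuousAt.tendsto.mono_left nhdsWithin_le_nhds)
    filter_upwards [self_mem_nhdsWithin] with β hβ
    exact (Lcomp_of_im hβ j f).symm

/-! ### Taylor expansion along segments -/

section Taylor

variable {E : Type*} [NormedAddCommGroup E] [NormedSpace ℝ E]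

lemma iteratedDeriv_comp_line {F : E → ℝ} (hF : ContDiff ℝ ((⊤ : ℕ∞) : WithTop ℕ∞) F) (a w : E)
    (k : ℕ) : iteratedDeriv k (fun t : ℝ => F (a + t • w)) =
      fun t => iteratedFDeriv ℝ k F (a + t • w) fun _ => w := by
  induction k with
  | zero => simp
  | succ k ih =>
    rw [iteratedDeriv_succ, ih]
    ext t
    have h1 : HasFDerivAt (iteratedFDeriv ℝ k F)
        (fderiv ℝ (iteratedFDeriv ℝ k F) (a + t • w)) (a + t • w) :=
      ((hF.differentiable_iteratedFDeriv (by exact_mod_cast WithTop.coe_lt_top k)) _).hasFDerivAt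
    have h2 : HasDerivAt (fun t : ℝ => a + t • w) w t := by
      simpa using ((hasDerivAt_id t).smul_const w).const_add a
    have h4 := (ContinuousMultilinearMap.apply ℝ (fun _ : Fin k => E) ℝ
      (fun _ => w)).hasFDerivAt.comp_hasDerivAt t (h1.comp_hasDerivAt t h2)
    rw [iteratedFDeriv_succ_apply_left]
    exact h4.deriv

/-- The homogeneous Taylor term of degree `k` of `F` at `a`. -/
def taylorTerm (F : E → ℝ) (k : ℕ) (a w : E) : ℝ :=
  (k.factorial : ℝ)⁻¹ * iteratedFDeriv ℝ k F a fun _ => w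

lemma taylorTerm_smul (F : E → ℝ) (k : ℕ) (a w : E) (c : ℝ) :
    taylorTerm F k a (c • w) = c ^ k * taylorTerm F k a w := by
  unfold taylorTerm
  have := (iteratedFDeriv ℝ k F a).map_smul_univ (fun _ => c) (fun _ => w)
  simp only [Finset.prod_const, Finset.card_univ, Fintype.card_fin, smul_eq_mul] at this
  rw [this]
  ring

lemma abs_taylorTerm_le (F : E → ℝ) (k : ℕ) (a w : E) :
    |taylorTerm F k a w| ≤ ‖iteratedFDeriv ℝ k F a‖ * ‖w‖ ^ k := by
  unfold taylorTerm
  rw [abs_mul, abs_of_nonneg (by positivity)]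
  have h1 : |iteratedFDeriv ℝ k F a fun _ => w| ≤ ‖iteratedFDeriv ℝ k F a‖ * ‖w‖ ^ k := by
    simpa using (iteratedFDeriv ℝ k F a).le_opNorm fun _ => w
  have h2 : (k.factorial : ℝ)⁻¹ ≤ 1 :=
    inv_le_one_of_one_le₀ (by exact_mod_cast Nat.succ_le_of_lt k.factorial_pos)
  calc _ ≤ 1 * (‖iteratedFDeriv ℝ k F a‖ * ‖w‖ ^ k) :=
        mul_le_mul h2 h1 (abs_nonneg _) zero_le_one
    _ = _ := one_mul _

lemma abs_sub_sum_taylorTerm_le {F : E → ℝ} (hF : ContDiff ℝ ((⊤ : ℕ∞) : WithTop ℕ∞) F) (a w : E)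
    (N : ℕ) {C : ℝ} (hC : ∀ t ∈ Icc (0 : ℝ) 1, ‖iteratedFDeriv ℝ N F (a + t • w)‖ ≤ C) :
    |F (a + w) - ∑ k ∈ Finset.range N, taylorTerm F k a w| ≤ C * ‖w‖ ^ N := by
  have hC0 : 0 ≤ C := (norm_nonneg _).trans (hC 0 (by simp))
  rcases N with _ | n
  · simpa using hC 1 (by simp)
  · set g : ℝ → ℝ := fun t => F (a + t • w) with hg
    have hgc : ContDiff ℝ ((⊤ : ℕ∞) : WithTop ℕ∞) g := hF.comp (by fun_prop)
    have hd : ∀ k, ∀ y ∈ Icc (0 : ℝ) 1, iteratedDerivWithin k g (Icc 0 1) y =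
        iteratedFDeriv ℝ k F (a + y • w) fun _ => w := by
      intro k y hy
      rw [iteratedDerivWithin_eq_iteratedDeriv (uniqueDiffOn_Icc zero_lt_one)
        ((hgc.of_le (by exact_mod_cast le_top)).contDiffAt) hy, hg, iteratedDeriv_comp_line hF]
    have h := taylor_mean_remainder_bound (f := g) (a := 0) (b := 1) (x := 1)
      (n := n) (C := C * ‖w‖ ^ (n + 1)) zero_le_one
      (hgc.of_le (by exact_mod_cast le_top)).contDiffOn (by simp)
      (fun y hy => by
        rw [hd _ y hy]
        refine (ContinuousMultilinearMap.le_opNorm _ _).trans ?_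
        simpa using mul_le_mul_of_nonneg_right (hC y hy) (by positivity))
    have he : taylorWithinEval g n (Icc 0 1) 0 1 =
        ∑ k ∈ Finset.range (n + 1), taylorTerm F k a w := by
      rw [taylor_within_apply]
      refine Finset.sum_congr rfl fun k _ => ?_
      rw [hd k 0 (by simp)]
      simp [taylorTerm]
    rw [he, sub_zero, one_pow, mul_one, Real.norm_eq_abs] at h
    simp only [hg, one_smul] at h
    refine h.trans (div_le_self (by positivity) (by exact_mod_cast Nat.succ_le_of_lt n.factorial_pos))

end Taylor

/-! ### The Riesz kernel away from the origin -/

/-- A bump function that is `1` near the origin and vanishes for `|x| ≥ 1/2`. -/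
def originBump (m : ℕ) : ContDiffBump (0 : Eu m) := ⟨1 / 4, 1 / 2, by norm_num, by norm_num⟩

/-- A smooth function that agrees with the kernel `x_j / |x|^(m+1)` for `|x| ≥ 1/2`. -/
def smoothRiesz (j : Fin m) (x : Eu m) : ℝ := (1 - originBump m x) * rieszKernel j x

lemma smoothRiesz_eq (j : Fin m) {x : Eu m} (hx : 1 / 2 ≤ ‖x‖) :
    smoothRiesz j x = rieszKernel j x := by
  rw [smoothRiesz, (originBump m).zero_of_le_dist (by simpa [originBump] using hx)]
  ring

lemma contDiff_smoothRiesz (j : Fin m) :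
    ContDiff ℝ ((⊤ : ℕ∞) : WithTop ℕ∞) (smoothRiesz j) := by
  refine contDiff_iff_contDiffAt.2 fun x => ?_
  by_cases hx : x = 0
  · subst hx
    have : smoothRiesz j =ᶠ[𝓝 0] fun _ => 0 := by
      filter_upwards [(originBump m).eventuallyEq_one] with x hx
      simp [smoothRiesz, hx]
    exact contDiffAt_const.congr_of_eventuallyEq this
  · have h1 : ContDiffAt ℝ ((⊤ : ℕ∞) : WithTop ℕ∞) (fun x : Eu m => ‖x‖ ^ (-(m : ℝ) - 1)) x :=
      (contDiffAt_id.norm ℝ hx).rpow_const_of_ne (norm_ne_zero_iff.2 hx)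
    have h2 : ContDiffAt ℝ ((⊤ : ℕ∞) : WithTop ℕ∞) (fun x : Eu m => x j) x := by fun_prop
    exact (contDiffAt_const.sub (originBump m).contDiffAt).mul (h1.mul h2)

lemma rieszKernel_smul (j : Fin m) {r : ℝ} (hr : 0 < r) (x : Eu m) :
    rieszKernel j (r • x) = (r ^ m)⁻¹ * rieszKernel j x := by
  have h : r ^ (-(m : ℝ) - 1) * r = (r ^ m)⁻¹ := by
    rw [← Real.rpow_natCast, ← Real.rpow_neg hr.le]
    nth_rewrite 2 [← Real.rpow_one r]
    rw [← Real.rpow_add hr]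
    ring_nf
  rw [rieszKernel, rieszKernel, norm_smul, Real.norm_of_nonneg hr.le,
    Real.mul_rpow hr.le (norm_nonneg _), ← h]
  simp
  ring

open Classical in
/-- The kernel `x_j / |x|^(m+1)`, cut off to `|x| > 1/2`. -/
def farRiesz (j : Fin m) (x : Eu m) : ℝ := if 1 / 2 < ‖x‖ then rieszKernel j x else 0

lemma measurable_farRiesz (j : Fin m) : Measurable (farRiesz j) := by
  classical
  exact Measurable.ite (measurableSet_lt measurable_const measurable_norm)
    (measurable_rieszKernel j) measurable_const

lemma abs_farRiesz_le (j : Fin m) (x : Eu m) : |farRiesz j x| ≤ 2 ^ m := by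
  unfold farRiesz
  split_ifs with h
  · have hx : x ≠ 0 := fun h' => by norm_num [h'] at h
    refine (norm_rieszKernel_le j hx).trans ?_
    rw [Real.rpow_neg (norm_nonneg _), Real.rpow_natCast]
    rw [inv_le_comm₀ (by positivity) (by positivity), ← inv_pow]
    exact pow_le_pow_left₀ (by norm_num) (by linarith) m
  · rw [abs_zero]; positivity

lemma farRiesz_neg (j : Fin m) (x : Eu m) : farRiesz j (-x) = -farRiesz j x := by
  unfold farRiesz
  rw [norm_neg, rieszKernel_neg]
  split_ifs <;> simp

lemma exists_iteratedFDeriv_bound (j : Fin m) (k : ℕ) :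
    ∃ C, 0 ≤ C ∧ ∀ x : Eu m, ‖x‖ ≤ 2 → ‖iteratedFDeriv ℝ k (smoothRiesz j) x‖ ≤ C := by
  have hc : Continuous (iteratedFDeriv ℝ k (smoothRiesz j)) :=
    (contDiff_smoothRiesz j).continuous_iteratedFDeriv (by exact_mod_cast le_top)
  obtain ⟨C, hC⟩ := (isCompact_closedBall (0 : Eu m) 2).exists_bound_of_continuousOn hc.continuousOn
  refine ⟨C, (norm_nonneg _).trans (hC 0 (by simp)), fun x hx => hC x (by simpa using hx)⟩

/-- If |w| < 1/2, then w - ω lies where the cut-off and the smooth kernel coincide, and the segment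
from -ω stays in the ball of radius 2, so Taylor's formula has a uniform constant. If |w| ≥ 1/2, the
kernel and all Taylor terms are at most a constant times |w|^N, because |w|^k ≤ 2^N |w|^N for k ≤ N.
-/
lemma exists_farRiesz_taylor (j : Fin m) (N : ℕ) : ∃ C, 0 ≤ C ∧ ∀ (ω : USphere m) (w : Eu m),
    |farRiesz j (w - ω) - ∑ k ∈ Finset.range N, taylorTerm (smoothRiesz j) k (-(ω : Eu m)) w| ≤
      C * ‖w‖ ^ N := by
  choose C hC0 hC using fun k => exists_iteratedFDeriv_bound j k
  refine ⟨C N + (2 ^ m * 2 ^ N + ∑ k ∈ Finset.range N, C k * 2 ^ N), ?_, fun ω w => ?_⟩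
  · have := fun k => hC0 k
    have h2 : 0 ≤ ∑ k ∈ Finset.range N, C k * 2 ^ N :=
      Finset.sum_nonneg fun k _ => mul_nonneg (hC0 k) (by positivity)
    have := hC0 N
    positivity
  have hω : ‖(ω : Eu m)‖ = 1 := by simp
  have h2 : 0 ≤ ∑ k ∈ Finset.range N, C k * 2 ^ N :=
      Finset.sum_nonneg fun k _ => mul_nonneg (hC0 k) (by positivity)
  rcases lt_or_ge ‖w‖ (1 / 2) with hw | hw
  · have h1 : 1 / 2 < ‖w - ω‖ := by
      have := norm_sub_norm_le (ω : Eu m) w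
      rw [norm_sub_rev] at this
      linarith
    rw [farRiesz, if_pos h1, ← smoothRiesz_eq j h1.le, sub_eq_neg_add w]
    refine (abs_sub_sum_taylorTerm_le (contDiff_smoothRiesz j) (-(ω : Eu m)) w N
      (C := C N) fun t ht => hC N _ ?_).trans ?_
    · calc _ ≤ ‖-(ω : Eu m)‖ + ‖t • w‖ := norm_add_le _ _
        _ ≤ 1 + 1 * (1 / 2) := by
          rw [norm_neg, hω, norm_smul, Real.norm_of_nonneg ht.1]
          gcongr
          exact ht.2
        _ ≤ 2 := by norm_num
    · have : (0 : ℝ) ≤ 2 ^ m * 2 ^ N := by positivity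
      gcongr
      linarith
  · have hw2 : 1 ≤ 2 * ‖w‖ := by linarith
    have hpow : ∀ k ≤ N, ‖w‖ ^ k ≤ 2 ^ N * ‖w‖ ^ N := by
      intro k hk
      have e : (2 : ℝ) ^ N * ‖w‖ ^ N = (2 ^ k * (2 * ‖w‖) ^ (N - k)) * ‖w‖ ^ k := by
        rw [← mul_pow]
        nth_rewrite 1 [← Nat.sub_add_cancel hk]
        rw [pow_add, mul_pow 2 ‖w‖ k]
        ring
      rw [e]
      refine le_mul_of_one_le_left (by positivity) ?_
      exact one_le_mul_of_one_le_of_one_le (one_le_pow₀ one_le_two) (one_le_pow₀ hw2)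
    calc _ ≤ |farRiesz j (w - ω)| +
          ∑ k ∈ Finset.range N, |taylorTerm (smoothRiesz j) k (-(ω : Eu m)) w| :=
          (abs_sub _ _).trans (add_le_add_right (Finset.abs_sum_le_sum_abs _ _) _)
      _ ≤ 2 ^ m * (2 ^ N * ‖w‖ ^ N) + ∑ k ∈ Finset.range N, C k * (2 ^ N * ‖w‖ ^ N) := by
          refine add_le_add ((abs_farRiesz_le j _).trans ?_) (Finset.sum_le_sum fun k hk => ?_)
          · refine le_mul_of_one_le_right (by positivity) ?_
            simpa using hpow 0 (Nat.zero_le _)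
          · refine (abs_taylorTerm_le _ _ _ _).trans (mul_le_mul (hC k _ (by simp [hω]))
              (hpow k (Finset.mem_range.1 hk).le) (by positivity) (hC0 k))
      _ = (0 + (2 ^ m * 2 ^ N + ∑ k ∈ Finset.range N, C k * 2 ^ N)) * ‖w‖ ^ N := by
          rw [zero_add, add_mul, Finset.sum_mul]
          congr 1
          · ring
          · exact Finset.sum_congr rfl fun k _ => by ring
      _ ≤ _ := by
          gcongr
          exact hC0 N

/-! ### Expansion of the convolution at infinity -/

/-- The coefficient of `|y|^(-m-k)` in the expansion of `pvConv j φ` at infinity, as a function of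
`y / |y|`. -/
def farCoef (j : Fin m) (φ : 𝓢(Eu m, ℂ)) (k : ℕ) (ω : USphere m) : ℂ :=
  ∫ z, (taylorTerm (smoothRiesz j) k (-(ω : Eu m)) z : ℂ) * φ z

lemma continuous_taylorTerm (j : Fin m) (k : ℕ) :
    Continuous fun p : USphere m × Eu m => taylorTerm (smoothRiesz j) k (-(p.1 : Eu m)) p.2 := by
  have hc : Continuous (iteratedFDeriv ℝ k (smoothRiesz j)) :=
    (contDiff_smoothRiesz j).continuous_iteratedFDeriv (by exact_mod_cast le_top)
  have h2 : Continuous (fun p : USphere m × Eu m =>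
      (iteratedFDeriv ℝ k (smoothRiesz j) (-(p.1 : Eu m)), (fun _ : Fin k => p.2))) := by
    fun_prop
  exact continuous_const.mul ((ContinuousEval.continuous_eval).comp h2)

lemma integrable_pow_mul_schwartz (φ : 𝓢(Eu m, ℂ)) (k : ℕ) :
    Integrable fun z => ‖z‖ ^ k * ‖φ z‖ := φ.integrable_pow_mul volume k

lemma integrable_taylorTerm_mul (j : Fin m) (φ : 𝓢(Eu m, ℂ)) (k : ℕ) (ω : USphere m) :
    Integrable fun z => (taylorTerm (smoothRiesz j) k (-(ω : Eu m)) z : ℂ) * φ z := by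
  obtain ⟨C, hC0, hC⟩ := exists_iteratedFDeriv_bound j k
  refine ((integrable_pow_mul_schwartz φ k).const_mul C).mono' ?_ (Eventually.of_forall fun z => ?_)
  · exact ((Complex.continuous_ofReal.comp ((continuous_taylorTerm j k).comp
      (Continuous.prodMk_right ω))).mul φ.continuous).aestronglyMeasurable
  · rw [norm_mul, Complex.norm_real, ← mul_assoc]
    refine mul_le_mul_of_nonneg_right ((abs_taylorTerm_le _ _ _ _).trans ?_) (norm_nonneg _)
    exact mul_le_mul_of_nonneg_right (hC _ (by simp)) (by positivity)

lemma continuous_farCoef (j : Fin m) (φ : 𝓢(Eu m, ℂ)) (k : ℕ) : Continuous (farCoef j φ k) := by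
  obtain ⟨C, hC0, hC⟩ := exists_iteratedFDeriv_bound j k
  refine continuous_of_dominated (bound := fun z => C * (‖z‖ ^ k * ‖φ z‖))
    (fun ω => (integrable_taylorTerm_mul j φ k ω).aestronglyMeasurable)
    (fun ω => Eventually.of_forall fun z => ?_) ((integrable_pow_mul_schwartz φ k).const_mul C)
    (Eventually.of_forall fun z => ?_)
  · rw [norm_mul, Complex.norm_real, ← mul_assoc]
    refine mul_le_mul_of_nonneg_right ((abs_taylorTerm_le _ _ _ _).trans ?_) (norm_nonneg _)
    exact mul_le_mul_of_nonneg_right (hC _ (by simp)) (by positivity)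
  · exact (Complex.continuous_ofReal.comp ((continuous_taylorTerm j k).comp
      (Continuous.prodMk_left z))).mul continuous_const

lemma integrable_farRiesz_mul (j : Fin m) (φ : 𝓢(Eu m, ℂ)) (r : ℝ) (ω : USphere m) :
    Integrable fun z => (farRiesz j (r⁻¹ • z - ω) : ℂ) * φ z := by
  refine φ.integrable.bdd_mul (c := 2 ^ m)
    (Complex.measurable_ofReal.comp ((measurable_farRiesz j).comp
      (by fun_prop))).aestronglyMeasurable (Eventually.of_forall fun z => ?_)
  rw [Complex.norm_real]
  exact abs_farRiesz_le j _

/-- The Taylor expansion is used at w = z/r and integrated against φ: the term of degree k scales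
like r^(-k), and the remainder costs one moment of order N. -/
lemma exists_far_expansion (j : Fin m) (φ : 𝓢(Eu m, ℂ)) (N : ℕ) :
    ∃ C, 0 ≤ C ∧ ∀ (r : ℝ), 0 < r → ∀ ω : USphere m,
      ‖(∫ z, (farRiesz j (r⁻¹ • z - ω) : ℂ) * φ z) -
        ∑ k ∈ Finset.range N, ((r ^ k)⁻¹ : ℝ) * farCoef j φ k ω‖ ≤ C * (r ^ N)⁻¹ := by
  obtain ⟨C, hC0, hC⟩ := exists_farRiesz_taylor j N
  refine ⟨C * ∫ z, ‖z‖ ^ N * ‖φ z‖, mul_nonneg hC0 (integral_nonneg fun z => by positivity),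
    fun r hr ω => ?_⟩
  have hterm : ∀ k, ((r ^ k)⁻¹ : ℝ) * farCoef j φ k ω =
      ∫ z, (taylorTerm (smoothRiesz j) k (-(ω : Eu m)) (r⁻¹ • z) : ℂ) * φ z := by
    intro k
    rw [farCoef, ← integral_const_mul]
    congr 1 with z
    rw [taylorTerm_smul, inv_pow]
    push_cast
    ring
  have hint : ∀ k, Integrable fun z =>
      (taylorTerm (smoothRiesz j) k (-(ω : Eu m)) (r⁻¹ • z) : ℂ) * φ z := by
    intro k
    refine ((integrable_taylorTerm_mul j φ k ω).const_mul (((r⁻¹) ^ k : ℝ) : ℂ)).congr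
      (Eventually.of_forall fun z => ?_)
    simp only [taylorTerm_smul]
    push_cast
    ring
  simp only [hterm]
  rw [← integral_finsetSum _ fun k _ => hint k,
    ← integral_sub (integrable_farRiesz_mul j φ r ω) (integrable_finsetSum _ fun k _ => hint k),
    mul_right_comm, ← integral_const_mul]
  refine norm_integral_le_of_norm_le ((integrable_pow_mul_schwartz φ N).const_mul _)
    (Eventually.of_forall fun z => ?_)
  rw [← Finset.sum_mul, ← sub_mul, norm_mul]
  have h := hC ω (r⁻¹ • z)
  rw [norm_smul, Real.norm_of_nonneg (by positivity), mul_pow] at h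
  rw [← mul_assoc]
  refine mul_le_mul_of_nonneg_right ?_ (norm_nonneg _)
  calc _ = |farRiesz j (r⁻¹ • z - ω) -
        ∑ k ∈ Finset.range N, taylorTerm (smoothRiesz j) k (-(ω : Eu m)) (r⁻¹ • z)| := by
        rw [← Real.norm_eq_abs, ← Complex.norm_real]; push_cast; rfl
    _ ≤ _ := h.trans (le_of_eq (by rw [inv_pow]; ring))

/-- Away from the origin the two halves of the symmetric difference converge separately, and oddness
of the kernel makes them contribute equally. The translation z = y + x and homogeneity of degree -m
give the scaled form. -/
lemma pvConv_far (j : Fin m) (φ : 𝓢(Eu m, ℂ)) {r : ℝ} (hr : 0 < r) (ω : USphere m) :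
    (1 / 2 : ℝ) • ∫ x in {x : Eu m | r / 2 < ‖x‖}, rieszKernel j x •
      (φ (r • (ω : Eu m) + x) - φ (r • (ω : Eu m) - x)) =
    ((r ^ m)⁻¹ : ℝ) * ∫ z, (farRiesz j (r⁻¹ • z - ω) : ℂ) * φ z := by
  set y : Eu m := r • (ω : Eu m) with hy
  have hsub : ∀ z : Eu m, r⁻¹ • (z - y) = r⁻¹ • z - ω := fun z => by
    rw [hy, smul_sub, smul_smul, inv_mul_cancel₀ hr.ne', one_smul]
  have hi1 : Integrable fun x => (farRiesz j (r⁻¹ • x) : ℂ) * φ (y + x) := by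
    refine ((integrable_farRiesz_mul j φ r ω).comp_add_right y).congr
      (Eventually.of_forall fun x => ?_)
    dsimp only
    rw [← hsub, add_sub_cancel_right, add_comm y]
  have hneg : (fun x => (farRiesz j (r⁻¹ • x) : ℂ) * φ (y - x)) =
      fun x => -(fun x => (farRiesz j (r⁻¹ • x) : ℂ) * φ (y + x)) (-x) := by
    ext x
    simp only [smul_neg, farRiesz_neg, ← sub_eq_add_neg]
    push_cast
    ring
  have hi2 : Integrable fun x => (farRiesz j (r⁻¹ • x) : ℂ) * φ (y - x) := by
    rw [hneg]
    exact hi1.comp_neg.neg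
  have hms : MeasurableSet {x : Eu m | r / 2 < ‖x‖} :=
    measurableSet_lt measurable_const measurable_norm
  have hind : ∀ x, ({x : Eu m | r / 2 < ‖x‖}.indicator fun x => rieszKernel j x •
      (φ (y + x) - φ (y - x))) x = ((r ^ m)⁻¹ : ℝ) *
        ((farRiesz j (r⁻¹ • x) : ℂ) * φ (y + x) - (farRiesz j (r⁻¹ • x) : ℂ) * φ (y - x)) := by
    intro x
    have hn : 1 / 2 < ‖r⁻¹ • x‖ ↔ r / 2 < ‖x‖ := by
      rw [norm_smul, Real.norm_of_nonneg (by positivity), inv_mul_eq_div, lt_div_iff₀ hr]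
      constructor <;> intro h <;> linarith
    by_cases hx : r / 2 < ‖x‖
    · rw [indicator_of_mem (by exact hx), farRiesz, if_pos (hn.2 hx),
        rieszKernel_smul j (inv_pos.2 hr), Complex.real_smul]
      have : (r : ℂ) ^ m ≠ 0 := pow_ne_zero _ (Complex.ofReal_ne_zero.2 hr.ne')
      rw [inv_pow, inv_inv]
      push_cast
      field_simp
    · rw [indicator_of_notMem (by exact hx), farRiesz, if_neg (fun h => hx (hn.1 h))]
      simp
  rw [← integral_indicator hms]
  simp only [hind]
  rw [integral_const_mul, integral_sub hi1 hi2, hneg, integral_neg,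
    integral_neg_eq_self (fun x => (farRiesz j (r⁻¹ • x) : ℂ) * φ (y + x)),
    ← integral_sub_right_eq_self (fun x => (farRiesz j (r⁻¹ • x) : ℂ) * φ (y + x)) y]
  simp only [hsub, add_sub_cancel, Complex.real_smul]
  push_cast
  ring

/-- For |x| ≤ r/2 the segment between y - x and y + x stays at distance at least r/2 from the
origin, where φ' is rapidly small. This region contributes nothing to the expansion. -/
lemma exists_near_bound (hm : 1 ≤ m) (j : Fin m) (φ : 𝓢(Eu m, ℂ)) (N : ℕ) :
    ∃ C, 0 ≤ C ∧ ∀ (r : ℝ), 1 ≤ r → ∀ y : Eu m, ‖y‖ = r →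
      ‖(1 / 2 : ℝ) • ∫ x in {x : Eu m | r / 2 < ‖x‖}ᶜ, rieszKernel j x •
        (φ (y + x) - φ (y - x))‖ ≤ C * (r ^ N)⁻¹ := by
  -- Two of the N + 2 powers make |x|^(1-m) integrable at infinity; the other N give the decay in r.
  obtain ⟨C, hC0, -, hC⟩ := exists_schwartz_decay φ (N + 2)
  have hD := integrable_rpow_mul hm (b := 1 - (m : ℝ)) (N := 2) (by linarith)
    (by push_cast; linarith)
  set D : Eu m → ℝ := fun x => ‖x‖ ^ (1 - (m : ℝ)) * ((1 + ‖x‖) ^ 2)⁻¹ with hDdef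
  have hD0 : ∀ x, 0 ≤ D x := fun x => by positivity
  refine ⟨2 ^ (N + 2) * C * ∫ x, D x, mul_nonneg (by positivity) (integral_nonneg hD0),
    fun r hr y hy => ?_⟩
  have hms : MeasurableSet {x : Eu m | r / 2 < ‖x‖}ᶜ :=
    (measurableSet_lt measurable_const measurable_norm).compl
  have hfd : ∀ z, ‖z - y‖ ≤ r / 2 → ‖fderiv ℝ φ z‖ ≤ C * 2 ^ (N + 2) * ((1 + r) ^ (N + 2))⁻¹ := by
    intro z hz
    have h1 : (1 + r) / 2 ≤ 1 + ‖z‖ := by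
      have := norm_sub_norm_le y z
      rw [norm_sub_rev, hy] at this
      linarith
    have h2 : ((1 + r) / 2) ^ (N + 2) ≤ (1 + ‖z‖) ^ (N + 2) :=
      pow_le_pow_left₀ (by positivity) h1 _
    have h3 : ‖fderiv ℝ φ z‖ * ((1 + r) / 2) ^ (N + 2) ≤ C :=
      (mul_le_mul_of_nonneg_left h2 (norm_nonneg _)).trans (hC z)
    rw [← div_eq_mul_inv, le_div_iff₀ (by positivity)]
    rw [div_pow, mul_div_assoc', div_le_iff₀ (by positivity)] at h3
    exact h3
  have hb : ‖∫ x in {x : Eu m | r / 2 < ‖x‖}ᶜ, rieszKernel j x • (φ (y + x) - φ (y - x))‖ ≤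
      ∫ x in {x : Eu m | r / 2 < ‖x‖}ᶜ, 2 * (C * 2 ^ (N + 2) * (r ^ N)⁻¹) * D x := by
    refine norm_integral_le_of_norm_le (hD.const_mul _).integrableOn ?_
    refine (ae_restrict_iff' hms).2 ?_
    filter_upwards [ae_ne_zero hm] with x hx hxr
    have hxr' : ‖x‖ ≤ r / 2 := not_lt.1 hxr
    have hx' : 0 < ‖x‖ := norm_pos_iff.2 hx
    have h1 := norm_sub_le_of_fderiv φ hxr' hfd
    rw [norm_smul]
    have hr2 : ((1 + r) ^ (N + 2))⁻¹ ≤ (r ^ N)⁻¹ * ((1 + ‖x‖) ^ 2)⁻¹ := by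
      rw [← mul_inv, pow_add]
      gcongr <;> linarith
    calc _ ≤ ‖x‖ ^ (-(m : ℝ)) * (2 * (C * 2 ^ (N + 2) * ((1 + r) ^ (N + 2))⁻¹) * ‖x‖) :=
          mul_le_mul (norm_rieszKernel_le j hx) h1 (norm_nonneg _) (by positivity)
      _ ≤ ‖x‖ ^ (-(m : ℝ)) *
          (2 * (C * 2 ^ (N + 2) * ((r ^ N)⁻¹ * ((1 + ‖x‖) ^ 2)⁻¹)) * ‖x‖) := by gcongr
      _ = _ := by
          rw [hDdef, show 1 - (m : ℝ) = -(m : ℝ) + 1 by ring]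
          simp only [Real.rpow_add hx', Real.rpow_one]
          ring
  rw [norm_smul, Real.norm_of_nonneg (by norm_num)]
  have hI : ∫ x in {x : Eu m | r / 2 < ‖x‖}ᶜ, 2 * (C * 2 ^ (N + 2) * (r ^ N)⁻¹) * D x ≤
      2 * (C * 2 ^ (N + 2) * (r ^ N)⁻¹) * ∫ x, D x := by
    rw [integral_const_mul]
    refine mul_le_mul_of_nonneg_left ?_ (by positivity)
    exact setIntegral_le_integral hD (Eventually.of_forall hD0)
  calc _ ≤ 1 / 2 * (2 * (C * 2 ^ (N + 2) * (r ^ N)⁻¹) * ∫ x, D x) := by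
        have := hb.trans hI
        gcongr
    _ = _ := by ring

/-- The asymptotic expansion of `pvConv j φ` at infinity. -/
lemma exists_pvConv_expansion (hm : 1 ≤ m) (j : Fin m) (φ : 𝓢(Eu m, ℂ)) (N : ℕ) :
    ∃ C, 0 ≤ C ∧ ∀ (r : ℝ), 1 ≤ r → ∀ ω : USphere m,
      ‖pvConv j φ (r • (ω : Eu m)) -
        ∑ k ∈ Finset.range N, ((r ^ (m + k))⁻¹ : ℝ) * farCoef j φ k ω‖ ≤ C * (r ^ (m + N))⁻¹ := by
  obtain ⟨C₁, hC₁, h1⟩ := exists_far_expansion j φ N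
  obtain ⟨C₂, hC₂, h2⟩ := exists_near_bound hm j φ (m + N)
  refine ⟨C₂ + C₁, by positivity, fun r hr ω => ?_⟩
  have hr0 : 0 < r := by linarith
  have hms : MeasurableSet {x : Eu m | r / 2 < ‖x‖} := measurableSet_lt measurable_const measurable_norm
  have hsplit := integral_add_compl hms (integrable_rieszKernel_smul hm j φ (r • (ω : Eu m)))
  rw [pvConv, ← hsplit, smul_add, pvConv_far j φ hr0 ω]
  have e : ∑ k ∈ Finset.range N, (((r ^ (m + k))⁻¹ : ℝ) : ℂ) * farCoef j φ k ω =
      ((r ^ m)⁻¹ : ℝ) * ∑ k ∈ Finset.range N, ((r ^ k)⁻¹ : ℝ) * farCoef j φ k ω := by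
    rw [Finset.mul_sum]
    refine Finset.sum_congr rfl fun k _ => ?_
    rw [pow_add, mul_inv]
    push_cast
    ring
  rw [e, add_sub_right_comm, ← mul_sub, add_mul]
  rw [add_comm (C₂ * _)]
  refine (norm_add_le _ _).trans (add_le_add ?_ (h2 r hr _ (norm_smul_sphere hr0 ω)))
  rw [norm_mul, Complex.norm_real, Real.norm_of_nonneg (by positivity), pow_add, mul_inv]
  calc _ ≤ (r ^ m)⁻¹ * (C₁ * (r ^ N)⁻¹) :=
        mul_le_mul_of_nonneg_left (h1 r hr0 ω) (by positivity)
    _ = _ := by ring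

/-! ### One-dimensional scaling -/

/-- On (1, δR] the factor Q is the constant s, and the integral is s((δR)^z - 1)/z. On (δR, ∞) the
substitution r = Rt extracts R^z. The only term independent of R is -s/z; for z = 0 a logarithm
would appear instead. -/
lemma integral_Ioi_scaling {Q : ℝ → ℂ} (hQ : Continuous Q) {δ ρ : ℝ} (hδ : 0 < δ) {s : ℂ}
    (hs : ∀ t, 0 < t → t ≤ δ → Q t = s) (h0 : ∀ t, ρ ≤ t → Q t = 0) {z : ℂ} (hz : z ≠ 0) {R : ℝ}
    (hR0 : 0 < R) (hR : 1 ≤ δ * R) :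
    IntegrableOn (fun r : ℝ => (r : ℂ) ^ (z - 1) * Q (R⁻¹ * r)) (Ioi 1) ∧
    ∫ r in Ioi (1 : ℝ), (r : ℂ) ^ (z - 1) * Q (R⁻¹ * r) =
      (s * δ ^ z / z + ∫ t in Ioi δ, (t : ℂ) ^ (z - 1) * Q t) * (R : ℂ) ^ z - s / z := by
  have hcont : ∀ r : ℝ, 0 < r → ContinuousAt (fun r : ℝ => (r : ℂ) ^ (z - 1) * Q (R⁻¹ * r)) r :=
    fun r hr => (Complex.continuousAt_ofReal_cpow_const r _ (Or.inr hr.ne')).mul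
      (hQ.comp (by fun_prop)).continuousAt
  have hint : IntegrableOn (fun r : ℝ => (r : ℂ) ^ (z - 1) * Q (R⁻¹ * r)) (Ioi 1) := by
    have h1 : IntegrableOn (fun r : ℝ => (r : ℂ) ^ (z - 1) * Q (R⁻¹ * r)) (Icc 1 (ρ * R)) :=
      (ContinuousOn.integrableOn_compact isCompact_Icc fun r hr =>
        (hcont r (by linarith [hr.1])).continuousWithinAt)
    refine h1.of_forall_sdiff_eq_zero measurableSet_Ioi fun r hr => ?_
    have h2 : ρ ≤ R⁻¹ * r := by
      have h3 : ρ * R < r := by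
        by_contra h
        exact hr.2 ⟨(mem_Ioi.1 hr.1).le, not_lt.1 h⟩
      rw [inv_mul_eq_div, le_div_iff₀ hR0]
      exact h3.le
    rw [h0 _ h2, mul_zero]
  refine ⟨hint, ?_⟩
  have hsplit : Ioi (1 : ℝ) = Ioc 1 (δ * R) ∪ Ioi (δ * R) := (Ioc_union_Ioi_eq_Ioi hR).symm
  have hi : ∫ r in Ioc (1 : ℝ) (δ * R), (r : ℂ) ^ (z - 1) * Q (R⁻¹ * r) =
      s * ((δ : ℂ) ^ z * (R : ℂ) ^ z - 1) / z := by
    have : ∀ r ∈ Ioc (1 : ℝ) (δ * R), (r : ℂ) ^ (z - 1) * Q (R⁻¹ * r) = (r : ℂ) ^ (z - 1) * s := by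
      intro r hr
      rw [hs _ (mul_pos (inv_pos.2 hR0) (by linarith [hr.1]))]
      rw [inv_mul_eq_div, div_le_iff₀ hR0]
      exact hr.2
    rw [setIntegral_congr_fun measurableSet_Ioc this, integral_mul_const,
      ← intervalIntegral.integral_of_le hR, integral_cpow]
    · rw [sub_add_cancel, Complex.ofReal_one, Complex.one_cpow, Complex.ofReal_mul,
        Complex.mul_cpow_ofReal_nonneg hδ.le hR0.le]
      ring
    · refine Or.inr ⟨fun h => hz (by linear_combination h), fun h => ?_⟩
      rw [uIcc_of_le hR] at h
      linarith [h.1]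
  have ho : ∫ r in Ioi (δ * R), (r : ℂ) ^ (z - 1) * Q (R⁻¹ * r) =
      (R : ℂ) ^ z * ∫ t in Ioi δ, (t : ℂ) ^ (z - 1) * Q t := by
    have h1 := integral_comp_mul_left_Ioi' (fun r : ℝ => (r : ℂ) ^ (z - 1) * Q (R⁻¹ * r)) δ hR0
    rw [mul_comm δ, ← h1, Complex.real_smul, ← integral_const_mul, ← integral_const_mul]
    refine setIntegral_congr_fun measurableSet_Ioi fun t ht => ?_
    have ht0 : 0 < t := hδ.trans ht
    have hRz : (R : ℂ) ^ z = R * (R : ℂ) ^ (z - 1) := by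
      have hne : (R : ℂ) ≠ 0 := Complex.ofReal_ne_zero.2 hR0.ne'
      rw [Complex.cpow_sub _ _ hne, Complex.cpow_one]
      field_simp
    rw [inv_mul_cancel_left₀ hR0.ne', Complex.ofReal_mul,
      Complex.mul_cpow_ofReal_nonneg hR0.le ht0.le, hRz]
    ring
  rw [hsplit, setIntegral_union Ioc_disjoint_Ioi_same measurableSet_Ioi
    (hint.mono_set (hsplit ▸ subset_union_left)) (hint.mono_set (hsplit ▸ subset_union_right)),
    hi, ho]
  ring

/-! ### Cutoffs -/

lemma IsCutoff.exists_bounds {χ : Eu m → ℝ} (hχ : IsCutoff χ) : ∃ B δ ρ : ℝ, 0 ≤ B ∧ 0 < δ ∧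
    (∀ x, |χ x| ≤ B) ∧ (∀ x, ‖x‖ ≤ δ → χ x = 1) ∧ ∀ x, ρ ≤ ‖x‖ → χ x = 0 := by
  obtain ⟨B, hB⟩ := hχ.2.1.exists_bound_of_continuous hχ.1.continuous
  obtain ⟨ε, hε, h1⟩ := Metric.eventually_nhds_iff.1 hχ.2.2
  obtain ⟨ρ, hρ⟩ := hχ.2.1.isCompact.isBounded.exists_norm_le
  refine ⟨B, ε / 2, ρ + 1, (norm_nonneg _).trans (hB 0), by positivity, hB, fun x hx => h1 ?_,
    fun x hx => ?_⟩
  · rw [dist_zero_right]; linarith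
  · by_contra h
    have := hρ x (subset_tsupport _ h)
    linarith

lemma IsCutoff.exists_truncation {χ : Eu m → ℝ} (hχ : IsCutoff χ) {ψ : Eu m → ℂ}
    (hψ : ContDiff ℝ ((⊤ : ℕ∞) : WithTop ℕ∞) ψ) :
    ∃ g : ℝ → 𝓢(Eu m, ℂ), ∀ R, 0 < R → ∀ y, g R y = (χ (R⁻¹ • y) : ℂ) * ψ y := by
  have h : ∀ R : ℝ, ∃ g : 𝓢(Eu m, ℂ), 0 < R → ∀ y, g y = (χ (R⁻¹ • y) : ℂ) * ψ y := by
    intro R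
    by_cases hR : 0 < R
    · have hc : HasCompactSupport fun y : Eu m => (χ (R⁻¹ • y) : ℂ) * ψ y := by
        refine HasCompactSupport.mul_right ?_
        exact (hχ.2.1.comp_smul (inv_ne_zero hR.ne')).comp_left (g := ((↑) : ℝ → ℂ)) (by simp)
      have hd : ContDiff ℝ ((⊤ : ℕ∞) : WithTop ℕ∞) fun y : Eu m => (χ (R⁻¹ • y) : ℂ) * ψ y :=
        (Complex.ofRealCLM.contDiff.comp (hχ.1.comp (contDiff_const_smul _))).mul hψ
      exact ⟨hc.toSchwartzMap hd, fun _ y => rfl⟩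
    · exact ⟨0, fun h => absurd h hR⟩
  choose g hg using h
  exact ⟨g, hg⟩

/-! ### Radial integrals -/

/-- The integral of `g` over the sphere of radius `r`, with respect to the normalized angle. -/
def radialInt (g : Eu m → ℂ) (r : ℝ) : ℂ :=
  ∫ ω : USphere m, g (r • (ω : Eu m)) ∂(volume : Measure (Eu m)).toSphere

lemma sphereInt_one (g : Eu m → ℂ) : sphereInt (1 : C(USphere m, ℝ)) g = radialInt g := by
  ext r
  simp [sphereInt, radialInt]

lemma continuous_radialInt {g : Eu m → ℂ} (hg : Continuous g) : Continuous (radialInt g) := by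
  rw [← sphereInt_one]
  exact continuous_sphereInt _ hg

lemma integrable_sphere {h : USphere m → ℂ} (hh : Continuous h) :
    Integrable h (volume : Measure (Eu m)).toSphere := by
  have := hh.continuousOn.integrableOn_compact (μ := (volume : Measure (Eu m)).toSphere)
    isCompact_univ
  rwa [integrableOn_univ] at this

/-- The angular integral `∫ χ(tω) h(ω) dω`. -/
def cutoffInt (χ : Eu m → ℝ) (h : USphere m → ℂ) (t : ℝ) : ℂ :=
  ∫ ω : USphere m, (χ (t • (ω : Eu m)) : ℂ) * h ω ∂(volume : Measure (Eu m)).toSphere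

lemma continuous_cutoffInt {χ : Eu m → ℝ} (hχ : Continuous χ) {h : USphere m → ℂ}
    (hh : Continuous h) : Continuous (cutoffInt χ h) := by
  have h := continuous_parametric_integral_of_continuous (s := univ)
    (μ := (volume : Measure (Eu m)).toSphere)
    (f := fun (t : ℝ) (ω : USphere m) => (χ (t • (ω : Eu m)) : ℂ) * h ω)
    ((Complex.continuous_ofReal.comp (hχ.comp (by fun_prop))).mul (hh.comp continuous_snd))
    isCompact_univ
  simpa only [Measure.restrict_univ] using! h

/-- The function `ψ` has the asymptotic expansion `∑_k |y|^(-m-k) h_k(y/|y|)` at infinity. -/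
def HasExpansion (ψ : Eu m → ℂ) (h : ℕ → USphere m → ℂ) : Prop :=
  (∀ k, Continuous (h k)) ∧ ∀ N : ℕ, ∃ C, 0 ≤ C ∧ ∀ r : ℝ, 1 ≤ r → ∀ ω : USphere m,
    ‖ψ (r • (ω : Eu m)) - ∑ k ∈ Finset.range N, ((r ^ (m + k))⁻¹ : ℝ) * h k ω‖ ≤
      C * (r ^ (m + N))⁻¹

/-- The angular integral of the coefficient `h`. -/
def sphereTotal (h : USphere m → ℂ) : ℂ := ∫ ω, h ω ∂(volume : Measure (Eu m)).toSphere

/-- The remainder after `N` terms of the radial integral of `χ(·/R) ψ`. -/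
def truncRemainder (χ : Eu m → ℝ) (ψ : Eu m → ℂ) (h : ℕ → USphere m → ℂ) (N : ℕ) (R r : ℝ) : ℂ :=
  radialInt (fun y => (χ (R⁻¹ • y) : ℂ) * ψ y) r -
    ∑ k ∈ Finset.range N, ((r ^ (m + k))⁻¹ : ℝ) * cutoffInt χ (h k) (R⁻¹ * r)

/-- The remainder after `N` terms of the radial integral of `ψ`. -/
def radialRemainder (ψ : Eu m → ℂ) (h : ℕ → USphere m → ℂ) (N : ℕ) (r : ℝ) : ℂ :=
  radialInt ψ r - ∑ k ∈ Finset.range N, ((r ^ (m + k))⁻¹ : ℝ) * sphereTotal (h k)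

/-! ### Remainders of the expansion and the limit of the truncated radial integrals. -/

section Remainder

variable {χ : Eu m → ℝ} {ψ : Eu m → ℂ} {h : ℕ → USphere m → ℂ}

lemma truncRemainder_eq (hχ : Continuous χ) (hψ : Continuous ψ) (hh : ∀ k, Continuous (h k))
    (N : ℕ) (R r : ℝ) : truncRemainder χ ψ h N R r =
      ∫ ω : USphere m, (χ ((R⁻¹ * r) • (ω : Eu m)) : ℂ) * (ψ (r • (ω : Eu m)) -
        ∑ k ∈ Finset.range N, ((r ^ (m + k))⁻¹ : ℝ) * h k ω)
        ∂(volume : Measure (Eu m)).toSphere := by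
  have hcχ : Continuous fun ω : USphere m => (χ ((R⁻¹ * r) • (ω : Eu m)) : ℂ) :=
    Complex.continuous_ofReal.comp (hχ.comp (by fun_prop))
  have h1 : Integrable (fun ω : USphere m => (χ ((R⁻¹ * r) • (ω : Eu m)) : ℂ) *
      ψ (r • (ω : Eu m))) (volume : Measure (Eu m)).toSphere :=
    integrable_sphere (hcχ.mul (hψ.comp (by fun_prop)))
  have h2 : ∀ k, Integrable (fun ω : USphere m => ((r ^ (m + k))⁻¹ : ℝ) *
      ((χ ((R⁻¹ * r) • (ω : Eu m)) : ℂ) * h k ω)) (volume : Measure (Eu m)).toSphere :=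
    fun k => integrable_sphere (continuous_const.mul (hcχ.mul (hh k)))
  unfold truncRemainder radialInt cutoffInt
  simp only [← integral_const_mul, smul_smul]
  rw [← integral_finsetSum _ fun k _ => h2 k, ← integral_sub h1 (integrable_finsetSum _ fun k _ => h2 k)]
  congr 1 with ω
  rw [mul_sub, Finset.mul_sum]
  congr 1
  exact Finset.sum_congr rfl fun k _ => by ring

lemma truncRemainder_eq_radialRemainder {δ : ℝ} (hδ : ∀ x, ‖x‖ ≤ δ → χ x = 1) (N : ℕ) {R r : ℝ} (hR : 0 < R)
    (hr : 0 < r) (hRr : r ≤ δ * R) :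
    truncRemainder χ ψ h N R r = radialRemainder ψ h N r := by
  have hle : R⁻¹ * r ≤ δ := by rwa [inv_mul_eq_div, div_le_iff₀ hR]
  have h1 : ∀ ω : USphere m, χ ((R⁻¹ * r) • (ω : Eu m)) = 1 := fun ω => hδ _ (by
    rw [norm_smul_sphere (by positivity)]; exact hle)
  unfold truncRemainder radialRemainder radialInt cutoffInt sphereTotal
  simp only [smul_smul, h1, Complex.ofReal_one, one_mul]

/-- The constant does not depend on R, which makes dominated convergence possible as R → ∞. -/
lemma exists_truncRemainder_bound (hm : 1 ≤ m) (hχ : Continuous χ) {B : ℝ} (hB : ∀ x, |χ x| ≤ B)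
    (hψ : Continuous ψ) (hh : HasExpansion ψ h) (N : ℕ) :
    ∃ C, ∀ R r : ℝ, 1 ≤ r → ‖truncRemainder χ ψ h N R r‖ ≤ C * (r ^ (m + N))⁻¹ := by
  obtain ⟨C, hC0, hC⟩ := hh.2 N
  have hB0 : 0 ≤ B := (abs_nonneg _).trans (hB 0)
  refine ⟨B * C * sphereArea m, fun R r hr => ?_⟩
  rw [truncRemainder_eq hχ hψ hh.1]
  refine (norm_integral_le_of_norm_le_const (C := B * (C * (r ^ (m + N))⁻¹))
    (Eventually.of_forall fun ω => ?_)).trans (le_of_eq ?_)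
  · rw [norm_mul, Complex.norm_real]
    exact mul_le_mul (hB _) (hC r hr ω) (norm_nonneg _) hB0
  · rw [toSphere_real_univ hm]; ring

lemma continuous_truncRemainder (hχ : Continuous χ) (hψ : Continuous ψ)
    (hh : ∀ k, Continuous (h k)) (N : ℕ) (R : ℝ) :
    ContinuousOn (truncRemainder χ ψ h N R) (Ioi 1) := by
  refine ContinuousOn.sub (continuous_radialInt ((Complex.continuous_ofReal.comp
    (hχ.comp (by fun_prop))).mul hψ)).continuousOn (continuousOn_finsetSum _ fun k _ => ?_)
  refine ContinuousOn.mul (fun r hr => ?_)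
    ((continuous_cutoffInt hχ (hh k)).comp (by fun_prop)).continuousOn
  have hr0 : r ≠ 0 := (zero_lt_one.trans (mem_Ioi.1 hr)).ne'
  have : ContinuousAt (fun r : ℝ => (r ^ (m + k))⁻¹) r :=
    ((continuous_id.pow (m + k)).continuousAt).inv₀ (pow_ne_zero _ hr0)
  exact (Complex.continuous_ofReal.continuousAt.comp this).continuousWithinAt

lemma continuous_radialRemainder (hψ : Continuous ψ) (N : ℕ) :
    ContinuousOn (radialRemainder ψ h N) (Ioi 1) := by
  refine ContinuousOn.sub (continuous_radialInt hψ).continuousOn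
    (continuousOn_finsetSum _ fun k _ => ContinuousOn.mul (fun r hr => ?_) continuousOn_const)
  have hr0 : r ≠ 0 := (zero_lt_one.trans (mem_Ioi.1 hr)).ne'
  have : ContinuousAt (fun r : ℝ => (r ^ (m + k))⁻¹) r :=
    ((continuous_id.pow (m + k)).continuousAt).inv₀ (pow_ne_zero _ hr0)
  exact (Complex.continuous_ofReal.continuousAt.comp this).continuousWithinAt

lemma inv_pow_eq_rpow {r : ℝ} (hr : 0 < r) (k : ℕ) : (r ^ k)⁻¹ = r ^ (-(k : ℝ)) := by
  rw [Real.rpow_neg hr.le, Real.rpow_natCast]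

lemma continuousOn_cpow_mul {μ : ℂ} {G : ℝ → ℂ} (hG : ContinuousOn G (Ioi 1)) :
    ContinuousOn (fun r : ℝ => (r : ℂ) ^ μ * G r) (Ioi 1) := by
  refine ContinuousOn.mul (fun r hr => ?_) hG
  exact (Complex.continuousAt_ofReal_cpow_const r μ
    (Or.inr (zero_lt_one.trans (mem_Ioi.1 hr)).ne')).continuousWithinAt

lemma norm_cpow_mul_le {μ : ℂ} {G : ℝ → ℂ} {C : ℝ} {a : ℕ} {r : ℝ} (hr : 1 ≤ r)
    (hG : ‖G r‖ ≤ C * (r ^ a)⁻¹) : ‖(r : ℂ) ^ μ * G r‖ ≤ C * r ^ (μ.re - a) := by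
  have hr0 : 0 < r := by linarith
  rw [norm_mul, Complex.norm_cpow_eq_rpow_re_of_pos hr0, sub_eq_add_neg, Real.rpow_add hr0,
    ← inv_pow_eq_rpow hr0]
  calc _ ≤ r ^ μ.re * (C * (r ^ a)⁻¹) := mul_le_mul_of_nonneg_left hG (by positivity)
    _ = _ := by ring

lemma integrableOn_cpow_mul {μ : ℂ} {G : ℝ → ℂ} (hG : ContinuousOn G (Ioi 1)) {C : ℝ} {a : ℕ}
    (hC : ∀ r : ℝ, 1 ≤ r → ‖G r‖ ≤ C * (r ^ a)⁻¹) (ha : μ.re - a < -1) :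
    IntegrableOn (fun r : ℝ => (r : ℂ) ^ μ * G r) (Ioi 1) := by
  refine Integrable.mono' ((integrableOn_Ioi_rpow_of_lt ha zero_lt_one).const_mul C)
    ((continuousOn_cpow_mul hG).aestronglyMeasurable measurableSet_Ioi) ?_
  exact (ae_restrict_iff' measurableSet_Ioi).2 (Eventually.of_forall fun r hr =>
    norm_cpow_mul_le (mem_Ioi.1 hr).le (hC r (mem_Ioi.1 hr).le))

lemma exists_radialRemainder_bound (hm : 1 ≤ m) (hψ : Continuous ψ) (hh : HasExpansion ψ h)
    (N : ℕ) : ∃ C, ∀ r : ℝ, 1 ≤ r → ‖radialRemainder ψ h N r‖ ≤ C * (r ^ (m + N))⁻¹ := by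
  obtain ⟨C, hC⟩ := exists_truncRemainder_bound hm (χ := fun _ => 1) (B := 1) continuous_const
    (by simp) hψ hh N
  refine ⟨C, fun r hr => ?_⟩
  rw [← truncRemainder_eq_radialRemainder (χ := fun _ => 1) (δ := 1) (R := r) (by simp) N
    (by linarith) (by linarith) (by simp)]
  exact hC r r hr

/-- Dominated convergence: at a fixed r the truncated remainder equals the untruncated one as soon
as R ≥ r/δ. -/
lemma tendsto_integral_truncRemainder (hm : 1 ≤ m) (hχ : IsCutoff χ) (hψ : Continuous ψ)
    (hh : HasExpansion ψ h) (N : ℕ) {μ : ℂ} (hμ : μ.re - (m + N : ℕ) < -1) :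
    Tendsto (fun R : ℝ => ∫ r in Ioi (1 : ℝ), (r : ℂ) ^ μ * truncRemainder χ ψ h N R r) atTop
      (𝓝 (∫ r in Ioi (1 : ℝ), (r : ℂ) ^ μ * radialRemainder ψ h N r)) := by
  obtain ⟨B, δ, ρ, -, hδ0, hB, hδ, -⟩ := hχ.exists_bounds
  obtain ⟨C, hC⟩ := exists_truncRemainder_bound hm hχ.1.continuous hB hψ hh N
  refine tendsto_integral_filter_of_dominated_convergence
    (fun r => C * r ^ (μ.re - (m + N : ℕ))) (Eventually.of_forall fun R => ?_)
    (Eventually.of_forall fun R => ?_) ((integrableOn_Ioi_rpow_of_lt hμ zero_lt_one).const_mul C) ?_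
  · exact (continuousOn_cpow_mul (continuous_truncRemainder hχ.1.continuous hψ hh.1 N
      R)).aestronglyMeasurable measurableSet_Ioi
  · exact (ae_restrict_iff' measurableSet_Ioi).2 (Eventually.of_forall fun r hr =>
      norm_cpow_mul_le (mem_Ioi.1 hr).le (hC R r (mem_Ioi.1 hr).le))
  · refine (ae_restrict_iff' measurableSet_Ioi).2 (Eventually.of_forall fun r hr => ?_)
    have hr0 : 0 < r := zero_lt_one.trans (mem_Ioi.1 hr)
    refine tendsto_const_nhds.congr' ?_
    filter_upwards [eventually_gt_atTop 0, eventually_ge_atTop (r / δ)] with R hR hR'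
    rw [truncRemainder_eq_radialRemainder hδ N hR hr0 (by
      rw [div_le_iff₀ hδ0] at hR'; linarith)]

/-- The finite part expansion of the radial integrals of the truncations `χ(·/R) ψ`. -/
lemma exists_tendsto_truncated (hm : 1 ≤ m) (hχ : IsCutoff χ) (hψ : Continuous ψ)
    (hh : HasExpansion ψ h) (N : ℕ) {μ : ℂ} (hμ : μ.re - (m + N : ℕ) < -1)
    (hk : ∀ k : ℕ, μ + 1 - m ≠ k) {F : ℝ → ℂ} (hF : ContinuousOn F (Ioi 1))
    {CF : ℝ} (hCF : ∀ r : ℝ, 1 ≤ r → ‖F r‖ ≤ CF * (r ^ (m + N))⁻¹) :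
    ∃ c : ℕ → ℂ, Tendsto (fun R : ℝ => (∫ r in Ioi (1 : ℝ), (r : ℂ) ^ μ *
        (radialInt (fun y => (χ (R⁻¹ • y) : ℂ) * ψ y) r - F r)) -
          ∑ k ∈ Finset.range N, c k * (R : ℂ) ^ (μ + 1 - m - k)) atTop
      (𝓝 ((∫ r in Ioi (1 : ℝ), (r : ℂ) ^ μ * (radialRemainder ψ h N r - F r)) -
        ∑ k ∈ Finset.range N, sphereTotal (h k) / (μ + 1 - m - k))) := by
  obtain ⟨B, δ, ρ, hB0, hδ0, hB, hδ, hρ⟩ := hχ.exists_bounds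
  obtain ⟨C, hC⟩ := exists_truncRemainder_bound hm hχ.1.continuous hB hψ hh N
  obtain ⟨C', hC'⟩ := exists_radialRemainder_bound hm hψ hh N
  have hz : ∀ k : ℕ, μ + 1 - m - k ≠ 0 := fun k => sub_ne_zero.2 (hk k)
  -- The scaling lemma for the k-th term, with z = μ + 1 - m - k. It yields the coefficient of R^z
  -- chosen below and the constant -`sphereTotal (h k)`/z of the limit.
  have hsc := fun (k : ℕ) (R : ℝ) (hR0 : 0 < R) (hR : 1 ≤ δ * R) =>
    integral_Ioi_scaling (continuous_cutoffInt hχ.1.continuous (hh.1 k)) hδ0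
      (s := sphereTotal (h k)) (ρ := max ρ 1)
      (fun t ht0 ht => by
        unfold cutoffInt sphereTotal
        congr 1 with ω
        rw [hδ _ (by rwa [norm_smul_sphere ht0])]
        simp)
      (fun t ht => by
        have ht0 : 0 < t := lt_of_lt_of_le zero_lt_one ((le_max_right _ _).trans ht)
        unfold cutoffInt
        have : ∀ ω : USphere m, χ (t • (ω : Eu m)) = 0 := fun ω => hρ _ (by
          rw [norm_smul_sphere ht0]; exact (le_max_left _ _).trans ht)
        simp [this])
      (hz k) hR0 hR
  refine ⟨fun k => sphereTotal (h k) * (δ : ℂ) ^ (μ + 1 - m - k) / (μ + 1 - m - k) +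
    ∫ t in Ioi δ, (t : ℂ) ^ (μ + 1 - m - k - 1) * cutoffInt χ (h k) t, ?_⟩
  have hFi := integrableOn_cpow_mul hF hCF hμ
  have hRi := integrableOn_cpow_mul (continuous_radialRemainder (h := h) hψ N) hC' hμ
  have hlim := ((tendsto_integral_truncRemainder hm hχ hψ hh N hμ).sub_const
    (∫ r in Ioi (1 : ℝ), (r : ℂ) ^ μ * F r)).sub_const
    (∑ k ∈ Finset.range N, sphereTotal (h k) / (μ + 1 - m - k))
  simp only [mul_sub]
  rw [integral_sub hRi hFi]
  refine hlim.congr' ?_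
  filter_upwards [eventually_gt_atTop 0, eventually_ge_atTop δ⁻¹] with R hR0 hR
  have hR' : 1 ≤ δ * R := by
    rw [inv_le_iff_one_le_mul₀ hδ0] at hR; linarith
  have hTi := integrableOn_cpow_mul (continuous_truncRemainder hχ.1.continuous hψ hh.1 N R)
    (hC R) hμ
  have hpow : ∀ k : ℕ, ∀ r ∈ Ioi (1 : ℝ), (r : ℂ) ^ μ * (((r ^ (m + k))⁻¹ : ℝ) *
      cutoffInt χ (h k) (R⁻¹ * r)) =
      (r : ℂ) ^ (μ + 1 - m - k - 1) * cutoffInt χ (h k) (R⁻¹ * r) := by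
    intro k r hr
    have hr0 : (r : ℂ) ≠ 0 := Complex.ofReal_ne_zero.2 (zero_lt_one.trans (mem_Ioi.1 hr)).ne'
    rw [show μ + 1 - m - k - 1 = μ - (m + k : ℕ) by push_cast; ring, Complex.cpow_sub _ _ hr0,
      Complex.cpow_natCast]
    push_cast
    field_simp
  have hsplit : ∫ r in Ioi (1 : ℝ), (r : ℂ) ^ μ *
      radialInt (fun y => (χ (R⁻¹ • y) : ℂ) * ψ y) r =
      (∫ r in Ioi (1 : ℝ), (r : ℂ) ^ μ * truncRemainder χ ψ h N R r) +
      ∑ k ∈ Finset.range N, ∫ r in Ioi (1 : ℝ), (r : ℂ) ^ (μ + 1 - m - k - 1) *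
        cutoffInt χ (h k) (R⁻¹ * r) := by
    rw [← integral_finsetSum _ fun k _ => (hsc k R hR0 hR').1,
      ← integral_add hTi (integrable_finsetSum _ fun k _ => (hsc k R hR0 hR').1)]
    refine setIntegral_congr_fun measurableSet_Ioi fun r hr => ?_
    rw [← Finset.sum_congr rfl fun k _ => hpow k r hr, ← Finset.mul_sum, ← mul_add, truncRemainder,
      sub_add_cancel]
  have hMi : IntegrableOn (fun r : ℝ => (r : ℂ) ^ μ *
      radialInt (fun y => (χ (R⁻¹ • y) : ℂ) * ψ y) r) (Ioi 1) := by
    refine (hTi.add (integrable_finsetSum (Finset.range N) fun k _ => (hsc k R hR0 hR').1)).congr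
      ((ae_restrict_iff' measurableSet_Ioi).2 (Eventually.of_forall fun r hr => ?_))
    rw [Pi.add_apply, ← Finset.sum_congr rfl fun k _ => hpow k r hr, ← Finset.mul_sum, ← mul_add,
      truncRemainder, sub_add_cancel]
  rw [integral_sub hMi hFi, hsplit, Finset.sum_congr rfl fun k _ => (hsc k R hR0 hR').2,
    Finset.sum_sub_distrib]
  ring

end Remainder

/-! ### `K_β` on functions that vanish near the origin -/

lemma lineDerivOp_eventuallyEq_zero {g : 𝓢(Eu m, ℂ)} (h : g =ᶠ[𝓝 0] fun _ => (0 : ℂ)) (v : Eu m) :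
    (∂_{v} g : 𝓢(Eu m, ℂ)) =ᶠ[𝓝 0] fun _ => (0 : ℂ) := by
  filter_upwards [h.fderiv (𝕜 := ℝ)] with x hx
  rw [SchwartzMap.lineDerivOp_apply_eq_fderiv, hx]
  simp

lemma laplacian_eventuallyEq_zero {g : 𝓢(Eu m, ℂ)} (h : g =ᶠ[𝓝 0] fun _ => (0 : ℂ)) :
    (Δ g : 𝓢(Eu m, ℂ)) =ᶠ[𝓝 0] fun _ => (0 : ℂ) := by
  rw [laplacian_eq_sum_coord]
  have h2 : ∀ᶠ x in 𝓝 (0 : Eu m), ∀ j, (∂_{(EuclideanSpace.single j 1 : Eu m)}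
      (∂_{(EuclideanSpace.single j 1 : Eu m)} g) : 𝓢(Eu m, ℂ)) x = 0 :=
    eventually_all.2 fun j => lineDerivOp_eventuallyEq_zero (lineDerivOp_eventuallyEq_zero h _) _
  filter_upwards [h2] with x hx
  simp [hx]

lemma K_neg_nat_eq_zero (hm : 1 ≤ m) (l : ℕ) : ∀ {g : 𝓢(Eu m, ℂ)},
    g =ᶠ[𝓝 0] (fun _ => (0 : ℂ)) → K m (-l) g = 0 := by
  simp only [K_neg_nat hm]
  induction l with
  | zero =>
    intro g h
    exact h.eq_of_nhds
  | succ l ih =>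
    intro g h
    rw [Function.iterate_succ_apply', negLaplacian_apply, ih (laplacian_eventuallyEq_zero h),
      neg_zero]

/-- Agreement on the unit ball cancels the inner integral and all Taylor data of the finite part. At
β = -l both sides vanish: (-Δ)^l δ is supported at the origin, and `coefK` contains 1/Γ(-l) = 0. -/
lemma K_sub_eq (hm : 1 ≤ m) {f g : 𝓢(Eu m, ℂ)} (h : ∀ x : Eu m, ‖x‖ ≤ 1 → f x = g x) (β : ℂ) :
    K m β f - K m β g = coefK m β *
      ∫ r in Ioi (1 : ℝ), (r : ℂ) ^ (2 * β - 1) * (radialInt f r - radialInt g r) := by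
  have h' : f =ᶠ[𝓝 0] g := by
    filter_upwards [Metric.closedBall_mem_nhds (0 : Eu m) one_pos] with x hx
    exact h x (by simpa using hx)
  by_cases hl : ∀ l : ℕ, β ≠ -l
  · rw [K_eq_coefK m hl]
    have e : -(m : ℂ) + 2 * β + m - 1 = 2 * β - 1 := by ring
    have h1 := finitePart_sub_eq 1 f g (2 * β - 1) h h'
    change coefK m β * T m (-m + 2 * β) f - coefK m β * T m (-m + 2 * β) g = _
    rw [T_apply, T_apply, e, ← mul_sub, ← mul_sub, h1, ← integral_const_mul]
    simp only [← sphereInt_one, ← sphereArea_mul_sphericalMean hm]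
    congr 2 with r
    ring
  · push Not at hl
    obtain ⟨l, rfl⟩ := hl
    have h0 : (f - g : 𝓢(Eu m, ℂ)) =ᶠ[𝓝 0] fun _ => (0 : ℂ) := by
      filter_upwards [h'] with x hx
      simp [hx]
    have hc : coefK m (-l) = 0 := by
      simp [coefK, Complex.Gamma_neg_nat_eq_zero]
    rw [hc, zero_mul, ← map_sub, K_neg_nat_eq_zero hm l h0]

/-! ### Growth at infinity -/

section Growth

variable {ψ : Eu m → ℂ} {h : ℕ → USphere m → ℂ}

lemma integrable_rpow_mul_norm (hm : 1 ≤ m) (hψ : Continuous ψ) {C : ℝ}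
    (hC : ∀ r : ℝ, 1 ≤ r → ∀ ω : USphere m, ‖ψ (r • (ω : Eu m))‖ ≤ C * (r ^ m)⁻¹) {b : ℝ}
    (hb : -m < b) (hb0 : b < 0) : Integrable fun y => ‖y‖ ^ b * ‖ψ y‖ := by
  obtain ⟨D, hD⟩ := (isCompact_closedBall (0 : Eu m) 1).exists_bound_of_continuousOn
    hψ.continuousOn
  have hD0 : 0 ≤ D := (norm_nonneg _).trans (hD 0 (by simp))
  have hbound : ∀ y : Eu m, ‖ψ y‖ ≤ (D + |C|) * 2 ^ m * ((1 + ‖y‖) ^ m)⁻¹ := by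
    intro y
    rcases le_or_gt ‖y‖ 1 with hy | hy
    · have h1 := hD y (by simpa using hy)
      have h2 : (1 : ℝ) ≤ 2 ^ m * ((1 + ‖y‖) ^ m)⁻¹ := by
        rw [← div_eq_mul_inv, one_le_div (by positivity)]
        exact pow_le_pow_left₀ (by positivity) (by linarith) m
      calc ‖ψ y‖ ≤ (D + |C|) * 1 := by linarith [abs_nonneg C]
        _ ≤ (D + |C|) * (2 ^ m * ((1 + ‖y‖) ^ m)⁻¹) := by gcongr
        _ = _ := by ring
    · have hy0 : 0 < ‖y‖ := by linarith
      have h1 := hC ‖y‖ hy.le ⟨‖y‖⁻¹ • y, by simp [norm_smul, hy0.ne']⟩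
      rw [smul_inv_smul₀ hy0.ne'] at h1
      have h2 : (‖y‖ ^ m)⁻¹ ≤ 2 ^ m * ((1 + ‖y‖) ^ m)⁻¹ := by
        rw [← div_eq_mul_inv, inv_le_comm₀ (by positivity) (by positivity), inv_div, ← div_pow]
        exact pow_le_pow_left₀ (by positivity) (by linarith) m
      calc ‖ψ y‖ ≤ (D + |C|) * (‖y‖ ^ m)⁻¹ := by
            refine h1.trans ?_
            gcongr
            linarith [le_abs_self C]
        _ ≤ (D + |C|) * (2 ^ m * ((1 + ‖y‖) ^ m)⁻¹) := by gcongr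
        _ = _ := by ring
  refine ((integrable_rpow_mul hm hb (N := m) (by linarith)).const_mul
    ((D + |C|) * 2 ^ m)).mono' ?_ (Eventually.of_forall fun y => ?_)
  · exact ((by fun_prop : Measurable fun y : Eu m => ‖y‖ ^ b)).aestronglyMeasurable.mul
      hψ.norm.aestronglyMeasurable
  · rw [Real.norm_of_nonneg (by positivity)]
    calc _ ≤ ‖y‖ ^ b * ((D + |C|) * 2 ^ m * ((1 + ‖y‖) ^ m)⁻¹) := by gcongr; exact hbound y
      _ = _ := by ring

lemma HasExpansion.integrable (hm : 1 ≤ m) (hψ : Continuous ψ) (hh : HasExpansion ψ h) {b : ℝ}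
    (hb : -m < b) (hb0 : b < 0) : Integrable fun y => ‖y‖ ^ b * ‖ψ y‖ := by
  obtain ⟨C, -, hC⟩ := hh.2 0
  exact integrable_rpow_mul_norm hm hψ (fun r hr ω => by simpa using hC r hr ω) hb hb0

lemma HasExpansion.sum {ι : Type*} (s : Finset ι) {ψ : ι → Eu m → ℂ} {h : ι → ℕ → USphere m → ℂ}
    (hh : ∀ i, HasExpansion (ψ i) (h i)) (c : ι → ℂ) :
    HasExpansion (fun y => ∑ i ∈ s, c i * ψ i y) fun k ω => ∑ i ∈ s, c i * h i k ω := by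
  refine ⟨fun k => continuous_finsetSum _ fun i _ => continuous_const.mul ((hh i).1 k),
    fun N => ?_⟩
  choose C hC0 hC using fun i => (hh i).2 N
  refine ⟨∑ i ∈ s, ‖c i‖ * C i, Finset.sum_nonneg fun i _ => mul_nonneg (norm_nonneg _) (hC0 i),
    fun r hr ω => ?_⟩
  have e : ∑ i ∈ s, c i * ψ i (r • (ω : Eu m)) -
      ∑ k ∈ Finset.range N, ((r ^ (m + k))⁻¹ : ℝ) * ∑ i ∈ s, c i * h i k ω =
      ∑ i ∈ s, c i * (ψ i (r • (ω : Eu m)) -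
        ∑ k ∈ Finset.range N, ((r ^ (m + k))⁻¹ : ℝ) * h i k ω) := by
    simp only [mul_sub, Finset.mul_sum, Finset.sum_sub_distrib]
    congr 1
    rw [Finset.sum_comm]
    exact Finset.sum_congr rfl fun i _ => Finset.sum_congr rfl fun k _ => by ring
  rw [e, Finset.sum_mul]
  refine norm_sum_le_of_le _ fun i _ => ?_
  rw [norm_mul, mul_assoc]
  exact mul_le_mul_of_nonneg_left (hC i r hr ω) (norm_nonneg _)

lemma hasExpansion_pvConv (hm : 1 ≤ m) (j : Fin m) (φ : 𝓢(Eu m, ℂ)) :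
    HasExpansion (pvConv j φ) (farCoef j φ) :=
  ⟨continuous_farCoef j φ, exists_pvConv_expansion hm j φ⟩

end Growth

/-! ### The finite part of `⟨K_β, χ(·/R) ψ⟩` -/

section FinitePart

variable {ψ : Eu m → ℂ} {h : ℕ → USphere m → ℂ}

/-- The finite part of `⟨K_β, χ(·/R) ψ⟩` as `R → ∞`, expressed by an auxiliary test function `f`
that agrees with `ψ` in the unit ball. -/
def regularPart (f : 𝓢(Eu m, ℂ)) (ψ : Eu m → ℂ) (h : ℕ → USphere m → ℂ) (N : ℕ) (β : ℂ) : ℂ :=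
  K m β f + coefK m β *
    ((∫ r in Ioi (1 : ℝ), (r : ℂ) ^ (2 * β - 1) * (radialRemainder ψ h N r - radialInt f r)) -
      ∑ k ∈ Finset.range N, sphereTotal (h k) / (2 * β - m - k))

lemma exists_radialInt_bound (hm : 1 ≤ m) (f : 𝓢(Eu m, ℂ)) (a : ℕ) :
    ∃ C, ∀ r : ℝ, 1 ≤ r → ‖radialInt f r‖ ≤ C * (r ^ a)⁻¹ := by
  refine ⟨sphereArea m * (massBound (1 : C(USphere m, ℝ)) * SchwartzMap.seminorm ℂ a 0 f),
    fun r hr => ?_⟩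
  have hr0 : 0 < r := by linarith
  rw [← sphereInt_one, ← sphereArea_mul_sphericalMean hm, norm_mul, Complex.norm_real,
    Real.norm_of_nonneg (sphereArea_pos hm).le, inv_pow_eq_rpow hr0, mul_assoc]
  exact mul_le_mul_of_nonneg_left (norm_sphericalMean_le 1 f a hr0) (sphereArea_pos hm).le

lemma re_two_mul_sub_one {β : ℂ} {N : ℕ} (hN : (2 * β - m).re < N) :
    (2 * β - 1).re - (m + N : ℕ) < -1 := by
  simp at hN ⊢
  linarith

lemma differentiableAt_regular_integral (hm : 1 ≤ m) (f : 𝓢(Eu m, ℂ)) (hψ : Continuous ψ)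
    (hh : HasExpansion ψ h) (N : ℕ) {β : ℂ} (hN : (2 * β - m).re < N) :
    DifferentiableAt ℂ (fun β : ℂ => ∫ r in Ioi (1 : ℝ), (r : ℂ) ^ (2 * β - 1) *
      (radialRemainder ψ h N r - radialInt f r)) β := by
  obtain ⟨C, hC⟩ := exists_radialRemainder_bound hm hψ hh N
  obtain ⟨C', hC'⟩ := exists_radialInt_bound hm f (m + N)
  refine DifferentiableAt.comp β (f := fun β : ℂ => 2 * β - 1)
    (g := fun μ : ℂ => ∫ r in Ioi (1 : ℝ), (r : ℂ) ^ μ *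
      (radialRemainder ψ h N r - radialInt f r))
    (differentiableAt_integral_Ioi (C := C + C') (a := (m + N : ℕ))
    ((continuous_radialRemainder hψ N).sub (continuous_radialInt f.continuous).continuousOn)
    (fun r hr => ?_) (re_two_mul_sub_one hN)) (by fun_prop)
  have hr1 : (1 : ℝ) ≤ r := (mem_Ioi.1 hr).le
  rw [← inv_pow_eq_rpow (by linarith), add_mul]
  exact (norm_sub_le _ _).trans (add_le_add (hC r hr1) (hC' r hr1))

lemma differentiableAt_regular_sum (N : ℕ) {β : ℂ} (hβ : ∀ n : ℕ, β ≠ (m + n) / 2) :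
    DifferentiableAt ℂ (fun β : ℂ => ∑ k ∈ Finset.range N,
      sphereTotal (h k) / (2 * β - m - k)) β := by
  refine DifferentiableAt.fun_sum fun k _ => DifferentiableAt.div (by fun_prop) (by fun_prop) ?_
  intro h0
  exact hβ k (by linear_combination h0 / 2)

lemma ne_pole_of_im {β : ℂ} (h : β.im ≠ 0) (n : ℕ) : β ≠ (m + n) / 2 := by
  have := ne_natCast_of_im h ((m + n) / 2)
  push_cast at this
  exact this

/-- By the parity of n, the excluded values (m+n)/2 are the Gamma poles of K_β (n even) and of L_β
(n odd). -/
lemma ne_gammaPole {β : ℂ} (hβ : ∀ n : ℕ, β ≠ (m + n) / 2) (n : ℕ) : β ≠ m / 2 + n := by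
  intro hn
  refine hβ (2 * n) ?_
  rw [hn]
  push_cast
  ring

lemma ne_gammaPole' {β : ℂ} (hβ : ∀ n : ℕ, β ≠ (m + n) / 2) (n : ℕ) : β ≠ (m + 1) / 2 + n := by
  intro hn
  refine hβ (2 * n + 1) ?_
  rw [hn]
  push_cast
  ring

lemma differentiableAt_regularPart (hm : 1 ≤ m) (f : 𝓢(Eu m, ℂ)) (hψ : Continuous ψ)
    (hh : HasExpansion ψ h) (N : ℕ) {β : ℂ} (hN : (2 * β - m).re < N) (hβ : β.im ≠ 0) :
    DifferentiableAt ℂ (regularPart f ψ h N) β := by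
  have hK : DifferentiableAt ℂ (fun β => K m β f) β := by
    refine ((differentiableAt_coefK_of_im (m := m) hβ).mul
      (differentiableAt_T_of_im f hβ)).congr_of_eventuallyEq ?_
    filter_upwards [(isOpen_ne_fun Complex.continuous_im continuous_const).mem_nhds hβ] with z hz
    exact K_of_im hz f
  exact hK.add ((differentiableAt_coefK_of_im hβ).mul
    ((differentiableAt_regular_integral hm f hψ hh N hN).sub
      (differentiableAt_regular_sum N (ne_pole_of_im hβ))))

lemma tendsto_regularPart (hm : 1 ≤ m) (f : 𝓢(Eu m, ℂ)) (hψ : Continuous ψ)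
    (hh : HasExpansion ψ h) (N : ℕ) {β : ℂ} (hN : (2 * β - m).re < N)
    (hβ : ∀ n : ℕ, β ≠ (m + n) / 2) :
    Tendsto (regularPart f ψ h N) (𝓝[{β | β.im ≠ 0}] β) (𝓝 (regularPart f ψ h N β)) := by
  have h1 := ((differentiableAt_coefK (m := m) (ne_gammaPole hβ)).mul
    ((differentiableAt_regular_integral hm f hψ hh N hN).sub
      (differentiableAt_regular_sum (h := h) N hβ))).continuousAt.tendsto.mono_left
        (nhdsWithin_le_nhds (s := {β : ℂ | β.im ≠ 0}))
  exact (tendsto_K hm f (ne_gammaPole hβ)).add h1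

/-- For 0 < Re β < m/2 the powers r^(2β-1-m-k) are integrable on (1, ∞) with integral -1/(2β-m-k).
The subtracted terms therefore recombine with the remainder to the integral of ψ - f outside the
unit ball, and inside the ball ψ = f. -/
lemma regularPart_eq_integral (hm : 1 ≤ m) {f : 𝓢(Eu m, ℂ)} (hψ : Continuous ψ)
    (hf : ∀ x : Eu m, ‖x‖ ≤ 1 → f x = ψ x) (hh : HasExpansion ψ h) (N : ℕ) {β : ℂ}
    (h0 : 0 < β.re) (h1 : β.re < m / 2) :
    regularPart f ψ h N β = coefK m β * ∫ y, (‖y‖ : ℂ) ^ (-m + 2 * β) * ψ y := by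
  have hre : -(m : ℝ) < (-m + 2 * β : ℂ).re := by simpa using h0
  have hN : (2 * β - m).re < N := by
    have : (0 : ℝ) ≤ N := N.cast_nonneg
    simp
    linarith
  have hfi := integrable_norm_cpow_mul hm hre f
  have hψi : Integrable fun y => (‖y‖ : ℂ) ^ (-m + 2 * β) * ψ y := by
    refine (hh.integrable hm hψ (b := -m + 2 * β.re) (by linarith) (by linarith)).mono'
      ((measurable_norm_cpow _).aestronglyMeasurable.mul hψ.aestronglyMeasurable) ?_
    filter_upwards [ae_ne_zero hm] with y hy
    rw [norm_mul, norm_cpow_norm_le _ hy]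
    simp
  have hK : K m β f = coefK m β * ∫ y, (‖y‖ : ℂ) ^ (-m + 2 * β) * f y := by
    have hl : ∀ l : ℕ, β ≠ -l := by
      rintro l rfl
      have : (0 : ℝ) ≤ l := l.cast_nonneg
      simp at h0
      linarith
    rw [K_eq_coefK m hl, ← T_eq_integral hm hre]
    rfl
  have hgi : Integrable fun y => (‖y‖ : ℂ) ^ (-m + 2 * β) * (ψ y - f y) := by
    simp only [mul_sub]
    exact hψi.sub hfi
  have hpolar := integral_homogeneous hm 1 (lam := -m + 2 * β)
    (A := fun y => (‖y‖ : ℂ) ^ (-m + 2 * β)) (g := fun y => ψ y - f y)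
    (fun r hr ω => by simp [norm_smul_sphere hr]) hgi
  rw [sphereInt_one, show -(m : ℂ) + 2 * β + m - 1 = 2 * β - 1 by ring] at hpolar
  have hzero : ∀ r ∈ Ioi (0 : ℝ) \ Ioi 1, (r : ℂ) ^ (2 * β - 1) *
      radialInt (fun y => ψ y - f y) r = 0 := by
    intro r hr
    have hr0 : 0 < r := hr.1
    have hr1 : r ≤ 1 := not_lt.1 hr.2
    have : ∀ ω : USphere m, ψ (r • (ω : Eu m)) - f (r • (ω : Eu m)) = 0 := fun ω => by
      rw [hf _ (by rw [norm_smul_sphere hr0]; exact hr1), sub_self]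
    simp [radialInt, this]
  rw [setIntegral_eq_of_subset_of_forall_sdiff_eq_zero measurableSet_Ioi
    (Ioi_subset_Ioi zero_le_one) hzero] at hpolar
  have hk : ∀ k : ℕ, (2 * β - m - k - 1).re < -1 := fun k => by
    have : (0 : ℝ) ≤ k := k.cast_nonneg
    simp
    linarith
  have hterm : ∀ (k : ℕ) (r : ℝ), r ∈ Ioi (1 : ℝ) →
      (r : ℂ) ^ (2 * β - 1) * (((r ^ (m + k))⁻¹ : ℝ) * sphereTotal (h k)) =
      (r : ℂ) ^ (2 * β - m - k - 1) * sphereTotal (h k) := by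
    intro k r hr
    have hr0 : (r : ℂ) ≠ 0 := Complex.ofReal_ne_zero.2 (zero_lt_one.trans (mem_Ioi.1 hr)).ne'
    rw [show 2 * β - m - k - 1 = 2 * β - 1 - (m + k : ℕ) by push_cast; ring,
      Complex.cpow_sub (2 * β - 1) _ hr0, Complex.cpow_natCast]
    push_cast
    field_simp
  obtain ⟨C, hC⟩ := exists_radialRemainder_bound hm hψ hh N
  obtain ⟨C', hC'⟩ := exists_radialInt_bound hm f (m + N)
  have hRi : IntegrableOn (fun r : ℝ => (r : ℂ) ^ (2 * β - 1) *
      (radialRemainder ψ h N r - radialInt f r)) (Ioi 1) := integrableOn_cpow_mul (μ := 2 * β - 1) (C := C + C') (a := m + N)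
    ((continuous_radialRemainder (h := h) hψ N).sub
      (continuous_radialInt f.continuous).continuousOn)
    (fun r hr => by
      rw [add_mul]
      exact (norm_sub_le _ _).trans (add_le_add (hC r hr) (hC' r hr))) (re_two_mul_sub_one hN)
  have hsi : ∀ k : ℕ, IntegrableOn (fun r : ℝ => (r : ℂ) ^ (2 * β - m - k - 1) *
      sphereTotal (h k)) (Ioi 1) := fun k =>
    (integrableOn_Ioi_cpow_of_lt (hk k) zero_lt_one).mul_const _
  have hsplit : ∫ r in Ioi (1 : ℝ), (r : ℂ) ^ (2 * β - 1) * radialInt (fun y => ψ y - f y) r =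
      (∫ r in Ioi (1 : ℝ), (r : ℂ) ^ (2 * β - 1) * (radialRemainder ψ h N r - radialInt f r)) +
      ∑ k ∈ Finset.range N, ∫ r in Ioi (1 : ℝ), (r : ℂ) ^ (2 * β - m - k - 1) *
        sphereTotal (h k) := by
    rw [← integral_finsetSum _ fun k _ => hsi k,
      ← integral_add hRi (integrable_finsetSum (Finset.range N) fun k _ => hsi k)]
    refine setIntegral_congr_fun measurableSet_Ioi fun r hr => ?_
    have hsub : radialInt (fun y => ψ y - f y) r = radialInt ψ r - radialInt f r :=
      integral_sub (integrable_sphere (hψ.comp (by fun_prop)))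
        (integrable_sphere (f.continuous.comp (by fun_prop)))
    rw [← Finset.sum_congr rfl fun k _ => hterm k r hr, ← Finset.mul_sum, ← mul_add,
      radialRemainder, hsub]
    ring
  have hval : ∀ k : ℕ, ∫ r in Ioi (1 : ℝ), (r : ℂ) ^ (2 * β - m - k - 1) * sphereTotal (h k) =
      -(sphereTotal (h k) / (2 * β - m - k)) := fun k => by
    rw [integral_mul_const, integral_Ioi_cpow_of_lt (hk k) zero_lt_one, sub_add_cancel,
      Complex.ofReal_one, Complex.one_cpow]
    ring
  rw [hsplit, Finset.sum_congr rfl fun k _ => hval k, Finset.sum_neg_distrib] at hpolar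
  have hdiff : ∫ y, (‖y‖ : ℂ) ^ (-m + 2 * β) * (ψ y - f y) =
      (∫ y, (‖y‖ : ℂ) ^ (-m + 2 * β) * ψ y) - ∫ y, (‖y‖ : ℂ) ^ (-m + 2 * β) * f y := by
    simp only [mul_sub]
    exact integral_sub hψi hfi
  rw [hdiff] at hpolar
  rw [regularPart, hK]
  linear_combination -coefK m β * hpolar

/-- The regular part is determined by its values where the integral converges. -/
lemma regularPart_eq (hm : 1 ≤ m) {f : 𝓢(Eu m, ℂ)} (hψ : Continuous ψ)
    (hf : ∀ x : Eu m, ‖x‖ ≤ 1 → f x = ψ x) (hh : HasExpansion ψ h) (N : ℕ) {Λ : ℂ → ℂ}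
    (hΛ : ∀ β : ℂ, β.im ≠ 0 → DifferentiableAt ℂ Λ β)
    (hΛe : ∀ β : ℂ, β.im ≠ 0 → 0 < β.re → β.re < m / 2 →
      coefK m β * ∫ y, (‖y‖ : ℂ) ^ (-m + 2 * β) * ψ y = Λ β) {β : ℂ}
    (hN : (2 * β - m).re < N) (hβ : ∀ n : ℕ, β ≠ (m + n) / 2)
    (hlim : Tendsto Λ (𝓝[{β | β.im ≠ 0}] β) (𝓝 (Λ β))) :
    regularPart f ψ h N β = Λ β := by
  have hmr : (1 : ℝ) ≤ m := by exact_mod_cast hm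
  have hNn : (0 : ℝ) ≤ N := N.cast_nonneg
  have hre : ∀ β : ℂ, (2 * β - m).re < N ↔ β.re < (N + m) / 2 := fun β => by
    simp
    constructor <;> intro h <;> linarith
  have key : ∀ z : ℂ, z.re < (N + m) / 2 → z.im ≠ 0 → regularPart f ψ h N z = Λ z := by
    intro z hz hzi
    -- In this half plane N terms of the expansion suffice, and m/4 is the midpoint of the strip
    -- where the integral converges.
    refine eq_off_real_of_eventually (V := {z : ℂ | z.re < (N + m) / 2})
      (isOpen_lt Complex.continuous_re continuous_const) (convex_halfSpace_re_lt _)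
      (fun w hw hwi => differentiableAt_regularPart hm f hψ hh N ((hre w).2 hw) hwi)
      (fun w _ hwi => hΛ w hwi) (a := m / 4) ?_ ?_ hz hzi
    · show ((m / 4 : ℝ) : ℂ).re < _
      rw [Complex.ofReal_re]
      linarith
    · filter_upwards [eventually_strip (a := 0) (b := m / 2) (c := m / 4)
        (by linarith) (by linarith)] with w hw hwi
      rw [regularPart_eq_integral hm hψ hf hh N hw.1 hw.2]
      exact hΛe w hwi hw.1 hw.2
  -- The given β may be real. The equality there is the limit of the equalities at nonreal points,
  -- which accumulate at every β.
  have hne : (𝓝[{β : ℂ | β.im ≠ 0}] β).NeBot := by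
    refine mem_closure_iff_nhdsWithin_neBot.1 ?_
    have : {β : ℂ | β.im ≠ 0} = Complex.im ⁻¹' {0}ᶜ := rfl
    rw [this, Complex.closure_preimage_im, closure_compl_singleton]
    trivial
  refine tendsto_nhds_unique_of_eventuallyEq (tendsto_regularPart hm f hψ hh N hN hβ) hlim ?_
  have hopen : ∀ᶠ z in 𝓝[{β : ℂ | β.im ≠ 0}] β, z.re < ((N : ℝ) + m) / 2 :=
    nhdsWithin_le_nhds ((isOpen_lt Complex.continuous_re continuous_const).mem_nhds ((hre β).1 hN))
  filter_upwards [hopen, self_mem_nhdsWithin] with z hz hzi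
  exact key z hz hzi

/-- The finite part of `⟨K_β, χ(·/R) ψ⟩` as `R → ∞`. -/
lemma exists_tendsto_K_truncation (hm : 1 ≤ m)
    (hψ : ContDiff ℝ ((⊤ : ℕ∞) : WithTop ℕ∞) ψ) (hh : HasExpansion ψ h) {χ : Eu m → ℝ}
    (hχ : IsCutoff χ) {g : ℝ → 𝓢(Eu m, ℂ)}
    (hg : ∀ R, 0 < R → ∀ y, g R y = (χ (R⁻¹ • y) : ℂ) * ψ y) {Λ : ℂ → ℂ}
    (hΛ : ∀ β : ℂ, β.im ≠ 0 → DifferentiableAt ℂ Λ β)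
    (hΛe : ∀ β : ℂ, β.im ≠ 0 → 0 < β.re → β.re < m / 2 →
      coefK m β * ∫ y, (‖y‖ : ℂ) ^ (-m + 2 * β) * ψ y = Λ β) {β : ℂ}
    (hβ : ∀ n : ℕ, β ≠ (m + n) / 2)
    (hlim : Tendsto Λ (𝓝[{β | β.im ≠ 0}] β) (𝓝 (Λ β))) :
    ∃ (N : ℕ) (c : ℕ → ℂ), Tendsto (fun R : ℝ => K m β (g R) -
      ∑ k ∈ Finset.range N, c k * (R : ℂ) ^ (2 * β - m - k)) atTop (𝓝 (Λ β)) := by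
  obtain ⟨B, δ, ρ, -, hδ0, -, hδ, -⟩ := hχ.exists_bounds
  obtain ⟨N, hN⟩ := exists_nat_gt (2 * β - m).re
  have hone : ∀ R : ℝ, δ⁻¹ ≤ R → ∀ x : Eu m, ‖x‖ ≤ 1 → g R x = ψ x := by
    intro R hR x hx
    have hR0 : 0 < R := (inv_pos.2 hδ0).trans_le hR
    rw [hg R hR0, hδ _ ?_, Complex.ofReal_one, one_mul]
    rw [norm_smul, Real.norm_of_nonneg (inv_pos.2 hR0).le, inv_mul_eq_div, div_le_iff₀ hR0]
    rw [inv_le_iff_one_le_mul₀ hδ0] at hR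
    linarith
  -- At the scale δ⁻¹ the cutoff is 1 on the unit ball, so this truncation serves as the auxiliary
  -- test function.
  set f := g δ⁻¹ with hfdef
  have hf := hone δ⁻¹ le_rfl
  obtain ⟨C', hC'⟩ := exists_radialInt_bound hm f (m + N)
  have e : 2 * β - 1 + 1 - (m : ℂ) = 2 * β - m := by ring
  obtain ⟨c, hc⟩ := exists_tendsto_truncated hm hχ hψ.continuous hh N (re_two_mul_sub_one hN)
    (fun k hk => hβ k (by linear_combination hk / 2))
    (continuous_radialInt f.continuous).continuousOn hC'
  simp only [e] at hc
  refine ⟨N, fun k => coefK m β * c k, ?_⟩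
  rw [← regularPart_eq hm hψ.continuous hf hh N hΛ hΛe hN hβ hlim, regularPart]
  refine ((hc.const_mul (coefK m β)).const_add (K m β f)).congr' ?_
  filter_upwards [eventually_ge_atTop δ⁻¹] with R hR
  have hR0 : 0 < R := (inv_pos.2 hδ0).trans_le hR
  have h2 := K_sub_eq hm (f := g R) (g := f)
    (fun x hx => (hone R hR x hx).trans (hf x hx).symm) β
  have h3 : (g R : Eu m → ℂ) = fun y => (χ (R⁻¹ • y) : ℂ) * ψ y := funext (hg R hR0)
  rw [h3] at h2
  rw [mul_sub, ← h2, Finset.mul_sum]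
  simp only [← mul_assoc]
  ring

end FinitePart

/-! ### Return to Clifford components and removal of the powers of R. -/

lemma functional_sum_e (l : Module.Dual ℂ (Cl m)) (a : Fin m → ℂ) :
    l (∑ j, e m j * algebraMap ℂ (Cl m) (a j)) = ∑ j, l (e m j) * a j := by
  rw [map_sum]
  refine Finset.sum_congr rfl fun j _ => ?_
  rw [← Algebra.commutes, ← Algebra.smul_def, map_smul, smul_eq_mul, mul_comm]

lemma component_L_apply (hm : 1 ≤ m) (l : Module.Dual ℂ (Cl m)) (β : ℂ) (φ : 𝓢(Eu m, ℂ)) :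
    component l (L m β) φ = ∑ j, l (e m j) * Lcomp m j β φ := by
  rw [component_apply, L_apply hm, functional_sum_e]

lemma component_hilbertKernel_apply (hm : 1 ≤ m) (l : Module.Dual ℂ (Cl m)) (φ : 𝓢(Eu m, ℂ))
    (y : Eu m) : component l (hilbertKernel m) (SchwartzMap.compSubConstCLM ℂ (-y) φ) =
      ∑ j, l (e m j) * coefL m 0 * pvConv j φ y := by
  rw [hilbertKernel_eq hm, component_L_apply hm]
  refine Finset.sum_congr rfl fun j _ => ?_
  rw [Lcomp, if_neg, mul_zero, add_zero, pvConv_eq_Ucomp hm, mul_assoc]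
  rintro ⟨k, hk⟩
  have h1 : (0 : ℝ) ≤ k := k.cast_nonneg
  have h2 := congrArg Complex.re hk
  simp at h2
  linarith

lemma coefK_mul_integral_component (hm : 1 ≤ m) (l : Module.Dual ℂ (Cl m)) (φ : 𝓢(Eu m, ℂ))
    {β : ℂ} (hi : β.im ≠ 0) (h0 : 0 < β.re) (h1 : β.re < m / 2) :
    coefK m β * ∫ y, (‖y‖ : ℂ) ^ (-m + 2 * β) * ∑ j, l (e m j) * coefL m 0 * pvConv j φ y =
      ∑ j, l (e m j) * Lcomp m j β φ := by
  have hni : ∀ j, Integrable fun y => ‖y‖ ^ (-m + 2 * β.re) * ‖pvConv j φ y‖ := fun j =>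
    (hasExpansion_pvConv hm j φ).integrable hm (continuous_pvConv hm j φ) (by linarith)
      (by linarith)
  have hci : ∀ j, Integrable fun y => l (e m j) *
      ((‖y‖ : ℂ) ^ (-m + 2 * β) * (coefL m 0 * pvConv j φ y)) := by
    intro j
    refine Integrable.const_mul (((hni j).const_mul ‖coefL m 0‖).mono'
      ((measurable_norm_cpow _).aestronglyMeasurable.mul
        (continuous_const.mul (continuous_pvConv hm j φ)).aestronglyMeasurable) ?_) _
    filter_upwards [ae_ne_zero hm] with y hy
    change ‖(‖y‖ : ℂ) ^ (-m + 2 * β) * (coefL m 0 * pvConv j φ y)‖ ≤ _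
    rw [norm_mul, norm_mul, norm_cpow_norm_le _ hy]
    refine le_of_eq ?_
    simp
    ring
  have he : ∀ y : Eu m, (‖y‖ : ℂ) ^ (-m + 2 * β) * ∑ j, l (e m j) * coefL m 0 * pvConv j φ y =
      ∑ j, l (e m j) * ((‖y‖ : ℂ) ^ (-m + 2 * β) * (coefL m 0 * pvConv j φ y)) := fun y => by
    rw [Finset.mul_sum]
    exact Finset.sum_congr rfl fun j _ => by ring
  simp only [he]
  rw [integral_finsetSum _ fun j _ => hci j, Finset.mul_sum]
  refine Finset.sum_congr rfl fun j _ => ?_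
  rw [integral_const_mul, Lcomp_of_im hi, ← coefK_mul_integral_pvConv hm j h0 h1 φ (hni j)]
  ring

lemma tendsto_cpow_atTop_zero {z : ℂ} (hz : z.re < 0) :
    Tendsto (fun R : ℝ => (R : ℂ) ^ z) atTop (𝓝 0) := by
  have h := tendsto_rpow_neg_atTop (neg_pos.2 hz)
  rw [neg_neg] at h
  refine squeeze_zero_norm' ?_ h
  filter_upwards [eventually_gt_atTop 0] with R hR
  rw [Complex.norm_cpow_eq_rpow_re_of_pos hR]

/-- Powers with negative real part tend to zero and can be dropped; the remaining ones are those
that a finite part may remove. -/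
lemma hasFinitePartAtTop_of_powers {g : ℝ → ℂ} {a lam : ℂ} {N : ℕ} {c : ℕ → ℂ}
    (hl : ∀ k : ℕ, lam - k ≠ 0)
    (h : Tendsto (fun R : ℝ => g R - ∑ k ∈ Finset.range N, c k * (R : ℂ) ^ (lam - k)) atTop
      (𝓝 a)) : HasFinitePartAtTop g a := by
  classical
  set s := (Finset.range N).filter fun k : ℕ => 0 ≤ (lam - k).re with hs
  -- Coefficients have to be indexed by the exponent: k is recovered from z = lam - k as the floor
  -- of Re(lam - z).
  refine ⟨s.image fun k : ℕ => lam - k, fun z => c ⌊(lam - z).re⌋₊, fun z hz => ?_, ?_⟩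
  · obtain ⟨k, hk, rfl⟩ := Finset.mem_image.1 hz
    exact ⟨(Finset.mem_filter.1 hk).2, hl k⟩
  · have hneg : Tendsto (fun R : ℝ => ∑ k ∈ (Finset.range N).filter
        (fun k : ℕ => ¬ 0 ≤ (lam - k).re), c k * (R : ℂ) ^ (lam - k)) atTop (𝓝 0) := by
      have := tendsto_finsetSum ((Finset.range N).filter (fun k : ℕ => ¬ 0 ≤ (lam - k).re))
        (fun k hk => (tendsto_cpow_atTop_zero (not_le.1 (Finset.mem_filter.1 hk).2)).const_mul (c k))
      simpa using this
    have h2 := h.add hneg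
    rw [add_zero] at h2
    refine h2.congr fun R => ?_
    rw [Finset.sum_image fun i _ j _ hij => by simpa using hij,
      ← Finset.sum_filter_add_sum_filter_not (Finset.range N) fun k : ℕ => 0 ≤ (lam - k).re]
    simp only [sub_sub_cancel, Complex.natCast_re, Nat.floor_natCast]
    ring

lemma tendsto_of_negative_powers {g : ℝ → ℂ} {a lam : ℂ} {N : ℕ} {c : ℕ → ℂ} (hl : lam.re < 0)
    (h : Tendsto (fun R : ℝ => g R - ∑ k ∈ Finset.range N, c k * (R : ℂ) ^ (lam - k)) atTop
      (𝓝 a)) : Tendsto g atTop (𝓝 a) := by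
  have hneg : Tendsto (fun R : ℝ => ∑ k ∈ Finset.range N, c k * (R : ℂ) ^ (lam - k)) atTop
      (𝓝 0) := by
    have := tendsto_finsetSum (Finset.range N) (fun k _ => (tendsto_cpow_atTop_zero
      (z := lam - k) (by
        have : (0 : ℝ) ≤ (k : ℕ) := k.cast_nonneg
        simp
        linarith)).const_mul (c k))
    simpa using this
  simpa using h.add hneg

/-- The asymptotics of `⟨H * (χ(·/R) K_β), φ⟩` as `R → ∞`. -/
lemma exists_truncated_convolution (hm : 1 ≤ m) {β : ℂ} (hβ : ∀ n : ℕ, β ≠ ((m : ℂ) + n) / 2)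
    (l : Module.Dual ℂ (Cl m)) (φ : 𝓢(Eu m, ℂ)) {χ : Eu m → ℝ} (hχ : IsCutoff χ) :
    ∃ ψ : ℝ → 𝓢(Eu m, ℂ), IsTruncatedTest (component l (hilbertKernel m)) χ φ ψ ∧
      ∃ (N : ℕ) (c : ℕ → ℂ), Tendsto (fun R : ℝ => K m β (ψ R) -
        ∑ k ∈ Finset.range N, c k * (R : ℂ) ^ (2 * β - m - k)) atTop
        (𝓝 (component l (L m β) φ)) := by
  have hsmooth : ContDiff ℝ ((⊤ : ℕ∞) : WithTop ℕ∞)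
      fun y => ∑ j, l (e m j) * coefL m 0 * pvConv j φ y :=
    ContDiff.sum fun j _ => contDiff_const.mul (contDiff_pvConv hm j φ)
  obtain ⟨ψ, hψ⟩ := hχ.exists_truncation hsmooth
  refine ⟨ψ, fun R hR y => ?_, ?_⟩
  · rw [hψ R hR, component_hilbertKernel_apply hm]
  · rw [component_L_apply hm]
    refine exists_tendsto_K_truncation hm hsmooth
      (HasExpansion.sum Finset.univ (fun j => hasExpansion_pvConv hm j φ) _) hχ hψ
      (Λ := fun β => ∑ j, l (e m j) * Lcomp m j β φ) (fun z hz => ?_)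
      (fun z hz h0 h1 => coefK_mul_integral_component hm l φ hz h0 h1) hβ
      (tendsto_finsetSum _ fun j _ =>
        (tendsto_Lcomp hm j φ (ne_gammaPole' hβ)).const_mul _)
    refine DifferentiableAt.fun_sum fun j _ => DifferentiableAt.const_mul ?_ _
    refine ((differentiableAt_coefL_of_im (m := m) hz).mul
      (differentiableAt_Ucomp_of_im j φ hz)).congr_of_eventuallyEq ?_
    filter_upwards [(isOpen_ne_fun Complex.continuous_im continuous_const).mem_nhds hz] with w hw
    exact Lcomp_of_im hw j φ

end CliffordDist

end

theorem proposition7p2 (m : ℕ) (hm : 1 ≤ m) (β : ℂ)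
    (hβ : ∀ n : ℕ, β ≠ ((m : ℂ) + n) / 2) :
    CliffordDist.IsHilbertTransform (CliffordDist.K m β) (CliffordDist.L m β) ∧
      (β.re < (m : ℝ) / 2 →
        CliffordDist.IsConvolution (CliffordDist.hilbertKernel m)
          (CliffordDist.K m β) (CliffordDist.L m β)) := by
  refine ⟨fun l φ χ hχ => ?_, fun hre l φ χ hχ => ?_⟩
  · obtain ⟨ψ, hψ, N, c, h⟩ := CliffordDist.exists_truncated_convolution hm hβ l φ hχ
    exact ⟨ψ, hψ, CliffordDist.hasFinitePartAtTop_of_powers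
      -- The exponent 2β - m - k vanishes exactly at the excluded value β = (m+k)/2.
      (fun k hk => hβ k (by linear_combination hk / 2)) h⟩
  · obtain ⟨ψ, hψ, N, c, h⟩ := CliffordDist.exists_truncated_convolution hm hβ l φ hχ
    exact ⟨ψ, hψ, CliffordDist.tendsto_of_negative_powers (by simp; linarith) h⟩
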